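/- **Setting.** Let $\theta\in M_d(\mathbb R)$ be antisymmetric, and let $\mathbb T^d_\theta$ be the noncommutative torus generated by unitaries $U_1,\dots,U_d$ with $U_kU_l=e^{i\theta_{kl}}U_lU_k$. Put $e_n=U_1^{n_1}\cdots U_d^{n_d}$ for $n\in\mathbb Z^d$, so that $e_me_n=e^{-i\sum_{j<k}\theta_{jk}n_jm_k}e_{m+n}$. The Hilbert space $L_2(\mathbb T^d_\theta)$ has orthonormal basis $(e_n)_{n\in\mathbb Z^d}$, norm $\|\cdot\|_2$ and unit vector $1=e_0$. Let $\lambda_l,\lambda_r$ denote left and right multiplication, and let $L_\infty(\mathbb T^d_\theta)$ be the von Neumann algebra on $L_2(\mathbb T^d_\theta)$ generated by the operators $\lambda_l(e_n)$; its elements are written as $x$ or as $\lambda_l(x)$. Let $W^{k,2}=\{\xi\in L_2(\mathbb T^d_\theta):\sum_n|n|^{2k}|\hat\xi(n)|^2<\infty\}$ with $|n|$ the Euclidean norm, let $D_j\xi=\sum_n n_j\hat\xi(n)e_n$ with domain $W^{1,2}$, and let $C^\infty(\mathbb T^d_\theta)$ be the set of all $x\in L_\infty(\mathbb T^d_\theta)$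 with $D_1^{\alpha_1}\cdots D_d^{\alpha_d}x\in L_\infty(\mathbb T^d_\theta)$ for every multi-index $\alpha$. Let $g$ be a Riemannian metric, i.e. a positive element of $\mathrm{GL}_d(C^\infty(\mathbb T^d_\theta))$ such that all $g_{ij}$ and all $(g^{-1})_{ij}$ are self-adjoint. Put $$x(s)=\sum_{i,j}s_is_j(g^{-1})_{ij}\quad(s\in\mathbb R^d),\qquad \nu=\pi^{-d/2}\int_{\mathbb R^d}e^{-x(t)}\,dt,$$ $$A_g=\lambda_l(\nu^{-1/2})\sum_{i,j}D_i\,\lambda_l(\nu^{1/2}(g^{-1})_{ij}\nu^{1/2})\,D_j\,\lambda_l(\nu^{-1/2})\quad\text{with domain }W^{2,2},$$ $$V(s)=\sum_i s_i\Big(\sum_j\lambda_l((g^{-1})_{ij}\nu^{1/2})D_j\lambda_l(\nu^{-1/2})+\sum_j\lambda_l(\nu^{-1/2})D_j\lambda_l(\nu^{1/2}(g^{-1})_{ji})\Big).$$ For $s\in\mathbb R^d$, $z\in\mathbb C\setminus(-\infty,0]$ and a finite set $\mathscr A$ of natural numbers, put $x_0=x_0^{\mathscr A}=1$ and, for $m\ge1$,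 $$x_m(s,z)=(V(s)+A_g)\big((x(s)+z)^{-1}x_{m-1}(s,z)\big),$$ $$x_m^{\mathscr A}(s,z)=\begin{cases}V(s)\big((x(s)+z)^{-1}x_{m-1}^{\mathscr A}(s,z)\big),&m\in\mathscr A,\\ A_g\big((x(s)+z)^{-1}x_{m-1}^{\mathscr A}(s,z)\big),&m\notin\mathscr A,\end{cases}$$ $$\mathrm{good}_k(s,z)=(x(s)+z)^{-1}\sum_{k/2\le m\le\min(k,d)}(-1)^m\sum_{\mathscr A\subset\{1,\dots,m\},\ |\mathscr A|=2m-k}x_m^{\mathscr A}(s,z),$$ $$\mathrm{bad}_n(z)=\big(\lambda_r(e_n)^*(A_g+z)^{-1}\lambda_r(e_n)\big)\big(x_{d+1}(n,z)\big)\qquad(n\in\mathbb Z^d).$$ **Theorem 5.2.** All these objects are well defined: the integral defining $\nu$ converges absolutely in operator norm and $\nu$ is positive and invertible; the expression for $A_g$ makes sense on $W^{2,2}$; for every $z\in\mathbb C\setminus(-\infty,0]$, $A_g+z$ has a bounded everywhere defined inverse, $x(s)+z$ is invertible for all $s\in\mathbb R^d$, and the vectors to which $V(s)$ and $A_g$ are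 applied above lie in the domains of these operators. Moreover: 1. For all $0\ne n\in\mathbb Z^d$ and $z\in\mathbb C\setminus(-\infty,0]$, $$\big(\lambda_r(e_n)^*(A_g+z)^{-1}\lambda_r(e_n)\big)(1)=\sum_{k=0}^{2d}\mathrm{good}_k(n,z)+(-1)^{d+1}\mathrm{bad}_n(z).$$ 2. For all $k\ge0$ and $s\in\mathbb R^d$, the function $\mathrm{good}_k(s,\cdot)$ takes values in $C^\infty(\mathbb T^d_\theta)$ and is analytic on $\mathbb C\setminus(-\infty,0]$, both as an $L_2(\mathbb T^d_\theta)$-valued and as an $L_\infty(\mathbb T^d_\theta)$-valued function. 3. There is a constant $C$, depending only on $d,\theta,g$, such that for all $0\ne n\in\mathbb Z^d$ and all $z\ne0$ with $\operatorname{Re}z\ge0$, $$\|\mathrm{bad}_n(z)\|_2\le C\,|z|^{-1}\,(|n|^2+|z|)^{-\frac{d+1}{2}}.$$ -/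

import Mathlib

noncomputable section

namespace NCTorus

open scoped BigOperators ComplexOrder

/-! ### The Hilbert space of the noncommutative torus and its regular representations -/

/-- The Hilbert space `L_2` of the `d`-dimensional noncommutative torus, described through Fourier
coefficients: the completion of the algebra generated by unitaries `U_1, …, U_d` with
`U_k U_l = exp (i θ_kl) U_l U_k`, for the inner product `τ (x* y)`, has the orthonormal basis
`e_n = U_1 ^ n_1 ⋯ U_d ^ n_d`, and `ξ = ∑ ξ n • e_n`. -/
abbrev L2 (d : ℕ) : Type := lp (fun _ : Fin d → ℤ => ℂ) 2

/-- The orthonormal basis vector `e_n`. -/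
def e {d : ℕ} (n : Fin d → ℤ) : L2 d := lp.single 2 n (1 : ℂ)

/-- The unit `1 = e_0` of the noncommutative torus, as a vector of `L_2`. -/
def vac (d : ℕ) : L2 d := e 0

/-- The structure constants of the noncommutative torus: `e_m e_n = cocycle θ m n • e_{m+n}` with
`cocycle θ m n = exp (-i ∑_{j<k} θ_jk n_j m_k)`. -/
def cocycle {d : ℕ} (θ : Matrix (Fin d) (Fin d) ℝ) (m n : Fin d → ℤ) : ℂ :=
  Complex.exp (-(Complex.I *
    ∑ j : Fin d, ∑ k : Fin d, if j < k then ((θ j k * n j * m k : ℝ) : ℂ) else 0))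

theorem norm_cocycle {d : ℕ} (θ : Matrix (Fin d) (Fin d) ℝ) (m n : Fin d → ℤ) :
    ‖cocycle θ m n‖ = 1 := by
  have h : cocycle θ m n = Complex.exp ((-(∑ j : Fin d, ∑ k : Fin d,
      if j < k then θ j k * n j * m k else 0) : ℝ) * Complex.I) := by
    unfold cocycle
    congr 1
    push_cast
    have : ∀ j k : Fin d, (((if j < k then θ j k * n j * m k else 0 : ℝ)) : ℂ)
        = if j < k then (θ j k : ℂ) * n j * m k else 0 := by
      intro j k
      split_ifs <;> simp
    simp only [this]
    ring
  rw [h, Complex.norm_exp_ofReal_mul_I]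

theorem norm_shift_sq {d : ℕ} (u : (Fin d → ℤ) → ℂ) (hu : ∀ k, ‖u k‖ = 1) (m : Fin d → ℤ)
    (ξ : L2 d) :
    HasSum (fun k => ‖u k * ξ (k - m)‖ ^ (2 : ENNReal).toReal) (‖ξ‖ ^ (2 : ENNReal).toReal) := by
  have h := lp.hasSum_norm (p := 2) (by norm_num) ξ
  have h2 := (Equiv.subRight m).hasSum_iff.mpr h
  simpa [Function.comp_def, hu] using h2

/-- The unimodular weighted shift `(T ξ) k = u k * ξ (k - m)` on `L_2`, with `|u k| = 1`. -/
def weightedShift {d : ℕ} (u : (Fin d → ℤ) → ℂ) (hu : ∀ k, ‖u k‖ = 1) (m : Fin d → ℤ) :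
    L2 d →L[ℂ] L2 d :=
  LinearMap.mkContinuous
    { toFun := fun ξ => ⟨fun k => u k * ξ (k - m), memℓp_gen (norm_shift_sq u hu m ξ).summable⟩
      map_add' := by
        intro ξ η
        ext k
        exact mul_add (u k) (ξ (k - m)) (η (k - m))
      map_smul' := by
        intro c ξ
        ext k
        simp only [lp.coeFn_smul, Pi.smul_apply, smul_eq_mul, RingHom.id_apply]
        ring }
    1
    (by
      intro ξ
      rw [one_mul]
      refine le_of_eq ?_
      have h1 := norm_shift_sq u hu m ξ
      have h2 := lp.hasSum_norm (p := 2) (by norm_num)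
        (⟨fun k => u k * ξ (k - m), memℓp_gen h1.summable⟩ : L2 d)
      have h3 := h2.unique h1
      simp only [ENNReal.toReal_ofNat, Real.rpow_ofNat] at h3
      exact (pow_left_inj₀ (norm_nonneg _) (norm_nonneg _) two_ne_zero).mp h3)

/-- The unitary `λ_l(e_m)` of left multiplication by `e_m`, i.e. `e_n ↦ e_m e_n`. -/
def lmul {d : ℕ} (θ : Matrix (Fin d) (Fin d) ℝ) (m : Fin d → ℤ) : L2 d →L[ℂ] L2 d :=
  weightedShift (fun k => cocycle θ m (k - m)) (fun _ => norm_cocycle _ _ _) m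

/-- The unitary `λ_r(e_n)` of right multiplication by `e_n`, i.e. `e_m ↦ e_m e_n`. -/
def rmul {d : ℕ} (θ : Matrix (Fin d) (Fin d) ℝ) (n : Fin d → ℤ) : L2 d →L[ℂ] L2 d :=
  weightedShift (fun k => cocycle θ (k - n) n) (fun _ => norm_cocycle _ _ _) n

/-- The von Neumann algebra `L_∞` of the noncommutative torus: the von Neumann algebra on `L_2`
generated by the unitaries `λ_l(e_m)` (the double commutant, i.e. the weak closure of the algebra
they span). Its elements `x` are identified with the operators `λ_l(x)`; as a vector of `L_2`,
the element `x` is `x 1 = x (e_0)`. -/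
def LInfty {d : ℕ} (θ : Matrix (Fin d) (Fin d) ℝ) : VonNeumannAlgebra (L2 d) where
  toStarSubalgebra := StarSubalgebra.centralizer ℂ
    (StarSubalgebra.centralizer ℂ (Set.range (lmul θ)) : Set (L2 d →L[ℂ] L2 d))
  centralizer_centralizer' := by
    change Set.centralizer (Set.centralizer ((StarSubalgebra.centralizer ℂ
      (StarSubalgebra.centralizer ℂ (Set.range (lmul θ)) : Set (L2 d →L[ℂ] L2 d)) :
        StarSubalgebra ℂ (L2 d →L[ℂ] L2 d)) : Set (L2 d →L[ℂ] L2 d))) =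
      ((StarSubalgebra.centralizer ℂ
      (StarSubalgebra.centralizer ℂ (Set.range (lmul θ)) : Set (L2 d →L[ℂ] L2 d)) :
        StarSubalgebra ℂ (L2 d →L[ℂ] L2 d)) : Set (L2 d →L[ℂ] L2 d))
    simp only [StarSubalgebra.coe_centralizer_centralizer, Set.centralizer_centralizer_centralizer]

/-- The smooth algebra `C^∞` of the noncommutative torus: those `x ∈ L_∞` such that, for every
multi-index `α`, `D^α x = ∑ n^α x̂(n) e_n` is again an element of `L_∞`. -/
def smooth {d : ℕ} (θ : Matrix (Fin d) (Fin d) ℝ) : Set (L2 d →L[ℂ] L2 d) :=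
  {x | x ∈ LInfty θ ∧ ∀ α : Fin d → ℕ, ∃ y ∈ LInfty θ, ∀ n : Fin d → ℤ,
    (y (vac d) : L2 d) n = (∏ k, (n k : ℂ) ^ α k) * (x (vac d) : L2 d) n}

/-! ### Sobolev spaces and unbounded operators -/

/-- The square `|n|²` of the Euclidean length of `n ∈ ℤ^d`. -/
def normSq {d : ℕ} (n : Fin d → ℤ) : ℝ := ∑ i, (n i : ℝ) ^ 2

theorem normSq_nonneg {d : ℕ} (n : Fin d → ℤ) : 0 ≤ normSq n :=
  Finset.sum_nonneg fun _ _ => sq_nonneg _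

/-- The Sobolev space `W^{k,2}`: the vectors with `∑ |n|^{2k} |ξ̂(n)|² < ∞`. -/
def sobolev (d k : ℕ) : Submodule ℂ (L2 d) where
  carrier := {ξ | Summable fun n : Fin d → ℤ => normSq n ^ k * ‖ξ n‖ ^ 2}
  zero_mem' := by simp [summable_zero]
  add_mem' := by
    intro ξ η hξ hη
    refine Summable.of_nonneg_of_le
      (fun n => mul_nonneg (pow_nonneg (normSq_nonneg n) k) (sq_nonneg _)) (fun n => ?_)
      ((hξ.mul_left 2).add (hη.mul_left 2))
    have h1 : ‖(ξ + η : L2 d) n‖ ≤ ‖ξ n‖ + ‖η n‖ := by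
      simpa using norm_add_le (ξ n) (η n)
    have h2 : ‖(ξ + η : L2 d) n‖ ^ 2 ≤ 2 * ‖ξ n‖ ^ 2 + 2 * ‖η n‖ ^ 2 := by
      nlinarith [norm_nonneg ((ξ + η : L2 d) n), norm_nonneg (ξ n), norm_nonneg (η n),
        sq_nonneg (‖ξ n‖ - ‖η n‖)]
    have h3 := mul_le_mul_of_nonneg_left h2 (pow_nonneg (normSq_nonneg n) k)
    linarith
  smul_mem' := by
    intro c ξ hξ
    have h : Summable fun n : Fin d → ℤ => ‖c‖ ^ 2 * (normSq n ^ k * ‖ξ n‖ ^ 2) :=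
      Summable.mul_left _ hξ
    refine h.congr fun n => ?_
    simp only [lp.coeFn_smul, Pi.smul_apply, norm_smul]
    ring

/-- The operator `D_i (∑ ξ̂(n) e_n) = ∑ n_i ξ̂(n) e_n` with domain `W^{1,2}`. -/
def D {d : ℕ} (i : Fin d) : L2 d →ₗ.[ℂ] L2 d where
  domain := sobolev d 1
  toFun :=
    { toFun := fun ξ => ⟨fun n => (n i : ℂ) * (ξ : L2 d) n, memℓp_gen (by
        refine Summable.of_nonneg_of_le (fun n => by positivity) (fun n => ?_) ξ.2
        have h : (n i : ℝ) ^ 2 ≤ normSq n :=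
          Finset.single_le_sum (f := fun j => (n j : ℝ) ^ 2) (fun _ _ => sq_nonneg _)
            (Finset.mem_univ i)
        simp only [ENNReal.toReal_ofNat, Real.rpow_ofNat, norm_mul, Complex.norm_intCast, mul_pow,
          sq_abs, pow_one]
        exact mul_le_mul_of_nonneg_right h (sq_nonneg _))⟩
      map_add' := by
        intro ξ η
        ext n
        exact mul_add (n i : ℂ) ((ξ : L2 d) n) ((η : L2 d) n)
      map_smul' := by
        intro c ξ
        ext n
        simp only [Submodule.coe_smul, lp.coeFn_smul, Pi.smul_apply, smul_eq_mul,
          RingHom.id_apply]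
        ring }

section Operators

variable {H : Type*} [NormedAddCommGroup H] [InnerProductSpace ℂ H]

/-- A bounded operator as an everywhere defined partial operator. -/
def bdd (a : H →L[ℂ] H) : H →ₗ.[ℂ] H :=
  (a : H →ₗ[ℂ] H).toPMap ⊤

/-- The composition `B A` of unbounded operators, on its natural domain
`{ξ ∈ dom A | A ξ ∈ dom B}`. -/
def comp (B A : H →ₗ.[ℂ] H) : H →ₗ.[ℂ] H where
  domain :=
    { carrier := {ξ | ∃ h : ξ ∈ A.domain, A ⟨ξ, h⟩ ∈ B.domain}
      zero_mem' := ⟨A.domain.zero_mem, by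
        have h : A ⟨0, A.domain.zero_mem⟩ = 0 := A.map_zero
        rw [h]
        exact B.domain.zero_mem⟩
      add_mem' := by
        rintro ξ η ⟨h1, k1⟩ ⟨h2, k2⟩
        have h : A ⟨ξ + η, A.domain.add_mem h1 h2⟩ = A ⟨ξ, h1⟩ + A ⟨η, h2⟩ :=
          A.map_add ⟨ξ, h1⟩ ⟨η, h2⟩
        exact ⟨A.domain.add_mem h1 h2, by rw [h]; exact B.domain.add_mem k1 k2⟩
      smul_mem' := by
        rintro c ξ ⟨h1, k1⟩
        have h : A ⟨c • ξ, A.domain.smul_mem c h1⟩ = c • A ⟨ξ, h1⟩ := A.map_smul c ⟨ξ, h1⟩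
        exact ⟨A.domain.smul_mem c h1, by rw [h]; exact B.domain.smul_mem c k1⟩ }
  toFun :=
    { toFun := fun ξ => B ⟨A ⟨ξ, ξ.2.choose⟩, ξ.2.choose_spec⟩
      map_add' := by
        rintro ⟨ξ, h1, k1⟩ ⟨η, h2, k2⟩
        rw [← B.map_add]
        congr 1
        exact Subtype.ext (A.map_add ⟨ξ, h1⟩ ⟨η, h2⟩)
      map_smul' := by
        rintro c ⟨ξ, h1, k1⟩
        rw [RingHom.id_apply, ← B.map_smul]
        congr 1
        exact Subtype.ext (A.map_smul c ⟨ξ, h1⟩) }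

open Classical in
/-- The value of an unbounded operator at a vector of its domain (and `0` elsewhere). -/
def value (A : H →ₗ.[ℂ] H) (ξ : H) : H :=
  if h : ξ ∈ A.domain then A ⟨ξ, h⟩ else 0

/-- `R` is the bounded everywhere defined two-sided inverse of `A + z`. -/
structure IsResolvent (A : H →ₗ.[ℂ] H) (z : ℂ) (R : H →L[ℂ] H) : Prop where
  right_inv : ∀ ξ : H, ∃ h : R ξ ∈ A.domain, A ⟨R ξ, h⟩ + z • R ξ = ξ
  left_inv : ∀ η : A.domain, R (A η + z • (η : H)) = η

open Classical in
/-- The resolvent `(A + z)⁻¹` (and `0` if `A + z` has no bounded inverse). -/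
def resolv (A : H →ₗ.[ℂ] H) (z : ℂ) : H →L[ℂ] H :=
  if h : ∃ R, IsResolvent A z R then h.choose else 0

end Operators

/-! ### Riemannian metrics and the Laplace-Beltrami operator -/

/-- A Riemannian metric on the noncommutative torus: a positive element `g` of `GL_d(C^∞)` such
that all the entries of `g` and of `g⁻¹` are self-adjoint. -/
structure IsRiemannianMetric {d : ℕ} (θ : Matrix (Fin d) (Fin d) ℝ)
    (g : (Matrix (Fin d) (Fin d) (L2 d →L[ℂ] L2 d))ˣ) : Prop where
  smooth_entry : ∀ i j, g.val i j ∈ smooth θ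
  smooth_inv_entry : ∀ i j, g.inv i j ∈ smooth θ
  nonneg : ∀ ξ : Fin d → L2 d, 0 ≤ ∑ i, ∑ j, inner ℂ (ξ i) (g.val i j (ξ j))
  selfAdjoint_entry : ∀ i j, IsSelfAdjoint (g.val i j)
  selfAdjoint_inv_entry : ∀ i j, IsSelfAdjoint (g.inv i j)

section Determinant

variable {H : Type*} [NormedAddCommGroup H] [InnerProductSpace ℂ H] [CompleteSpace H] {d : ℕ}
  (g : (Matrix (Fin d) (Fin d) (H →L[ℂ] H))ˣ)

/-- `x(s) = ∑ s_i s_j (g⁻¹)_ij`. -/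
def xs (s : Fin d → ℝ) : H →L[ℂ] H :=
  ∑ i, ∑ j, ((s i * s j : ℝ) : ℂ) • g.inv i j

/-- The integrand `exp (-∑ t_i t_j (g⁻¹)_ij)`. -/
def nuIntegrand (t : Fin d → ℝ) : H →L[ℂ] H := NormedSpace.exp (-(xs g t))

/-- `ν = π^{-d/2} ∫ exp (-∑ t_i t_j (g⁻¹)_ij) dt`, the square root of the determinant of `g`. -/
def nu : H →L[ℂ] H :=
  ((Real.pi ^ (-(d : ℝ) / 2) : ℝ) : ℂ) • ∫ t : Fin d → ℝ, nuIntegrand g t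

/-- `ν^{1/2}`, by the continuous functional calculus. -/
def nuHalf : H →L[ℂ] H := nu g ^ (1 / 2 : ℝ)

/-- `ν^{-1/2}`, by the continuous functional calculus. -/
def nuNegHalf : H →L[ℂ] H := nu g ^ (-(1 / 2) : ℝ)

end Determinant

section Metric

variable {d : ℕ} (g : (Matrix (Fin d) (Fin d) (L2 d →L[ℂ] L2 d))ˣ)

/-- `A_g = ν^{-1/2} (∑ D_i ν^{1/2} (g⁻¹)_ij ν^{1/2} D_j) ν^{-1/2}` with domain `W^{2,2}`: the
operator unitarily equivalent, via `λ_l(ν^{-1/2})`, to the Laplace-Beltrami operator. -/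
def Ag : L2 d →ₗ.[ℂ] L2 d :=
  (comp (bdd (nuNegHalf g)) (comp
    (∑ i, ∑ j, comp (D i) (comp (bdd (nuHalf g * g.inv i j * nuHalf g)) (D j)))
    (bdd (nuNegHalf g)))).domRestrict (sobolev d 2)

/-- The first order operators
`A_i = ∑_j (g⁻¹)_ij ν^{1/2} D_j ν^{-1/2} + ∑_j ν^{-1/2} D_j ν^{1/2} (g⁻¹)_ji`. -/
def Ai (i : Fin d) : L2 d →ₗ.[ℂ] L2 d :=
  (∑ j, comp (bdd (g.inv i j * nuHalf g)) (comp (D j) (bdd (nuNegHalf g)))) +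
    ∑ j, comp (bdd (nuNegHalf g)) (comp (D j) (bdd (nuHalf g * g.inv j i)))

/-- `V(s) = ∑ s_i A_i`. -/
def V (s : Fin d → ℝ) : L2 d →ₗ.[ℂ] L2 d := ∑ i, (s i : ℂ) • Ai g i

/-- `(x(s) + z)⁻¹`. -/
def xInv (s : Fin d → ℝ) (z : ℂ) : L2 d →L[ℂ] L2 d := Ring.inverse (xs g s + z • 1)

/-- `x_0(s,z) = 1` and `x_m(s,z) = (V(s) + A_g)((x(s) + z)⁻¹ x_{m-1}(s,z))`. -/
def xm (s : Fin d → ℝ) (z : ℂ) : ℕ → L2 d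
  | 0 => vac d
  | m + 1 => value (V g s + Ag g) (xInv g s z (xm s z m))

/-- `x_0^𝒜(s,z) = 1`, `x_m^𝒜(s,z) = V(s)((x(s) + z)⁻¹ x_{m-1}^𝒜(s,z))` if `m ∈ 𝒜`, and
`x_m^𝒜(s,z) = A_g((x(s) + z)⁻¹ x_{m-1}^𝒜(s,z))` if `m ∉ 𝒜`. -/
def xmA (𝒜 : Finset ℕ) (s : Fin d → ℝ) (z : ℂ) : ℕ → L2 d
  | 0 => vac d
  | m + 1 =>
    if m + 1 ∈ 𝒜 then value (V g s) (xInv g s z (xmA 𝒜 s z m))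
    else value (Ag g) (xInv g s z (xmA 𝒜 s z m))

/-- `good_k(s,z) = (x(s) + z)⁻¹ ∑_{k/2 ≤ m ≤ min(k,d)} (-1)^m ∑ x_m^𝒜(s,z)`, the inner sum over
the subsets `𝒜` of `{1, …, m}` of cardinality `2m - k`. -/
def good (k : ℕ) (s : Fin d → ℝ) (z : ℂ) : L2 d :=
  xInv g s z (∑ m ∈ (Finset.range (min k d + 1)).filter (fun m => k ≤ 2 * m),
    (-1 : ℂ) ^ m • ∑ 𝒜 ∈ (Finset.Icc 1 m).powersetCard (2 * m - k), xmA g 𝒜 s z m)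

/-- The conjugated resolvent `λ_r(e_n)^* (A_g + z)⁻¹ λ_r(e_n)`. -/
def conjResolv (θ : Matrix (Fin d) (Fin d) ℝ) (n : Fin d → ℤ) (z : ℂ) : L2 d →L[ℂ] L2 d :=
  star (rmul θ n) * resolv (Ag g) z * rmul θ n

/-- `bad_n(z) = (λ_r(e_n)^* (A_g + z)⁻¹ λ_r(e_n)) (x_{d+1}(n,z))`. -/
def bad (θ : Matrix (Fin d) (Fin d) ℝ) (n : Fin d → ℤ) (z : ℂ) : L2 d :=
  conjResolv g θ n z (xm g (fun i => (n i : ℝ)) z (d + 1))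

end Metric

end NCTorus

end

/-!
# The resolvent of the Laplacian on the noncommutative torus

Everything is expressed through Fourier coefficients. An element `x` of `L_∞` commutes with all
right multiplications `λ_r(e_n)`, so its matrix coefficients are determined by the vector `x 1`, and
`D_j x = [D_j, x]` is the operator with matrix coefficients `(m_j - n_j) x_{mn}` (`IsDeriv`). These
derivations satisfy the Leibniz rule and `δ(x⁻¹) = -x⁻¹ δ(x) x⁻¹`, hence families of smooth elements
all of whose derivatives obey symbol bounds are stable under sums, products, derivations and
inverses (`Tame`). The same bookkeeping serves four purposes: smoothness of integrals, smoothness of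
inverses, analyticity in `z`, and bounds uniform in `(s, z)`.

*The volume element.* Positivity of `g` gives `∑ ⟨ξ_i, (g⁻¹)_ij ξ_j⟩ ≥ c ∑ ‖ξ_i‖²`
(`IsRiemannianMetric.elliptic`), whence `x(s) ≥ c |s|²`. So the Gaussian integral converges and `ν`
is bounded below. For smoothness, `∫ (1 + x(t))^{-(d+1)} dt` is, by the Gamma integral, Fubini and
scaling, a multiple of `ν` (`exists_nu_eq_integral_xInv`), and it is the integral of a tame family.
Its powers `ν^{±1/2}` are smooth because the square root is an integral of resolvents
(`rpow_half_mem_smooth`).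

*The resolvent.* Write `b = ν^{1/2} g⁻¹ ν^{1/2}` and `L = ∑ D_i b_ij D_j`; then
`A_g + z = ν^{-1/2} (L + z ν) ν^{-1/2}`. With `J = (1 + ∑ D_k²)⁻¹` the operator `(L + z ν) J` is
bounded, and pairing it with `(κ + ∑ D_k²) J` for large `κ` gives a coercive form
(`exists_coercive`); hence it is invertible, and `A_g + z` has the inverse
`ν^{1/2} J ((L + z ν) J)⁻¹ ν^{1/2}` with range `W^{2,2}`. No elliptic regularity is needed. Since
`A_g` is nonnegative, the inverse has norm at most `|z|⁻¹` when `Re z ≥ 0` (`norm_resolv_le`).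

*The splitting.* Conjugation by `λ_r(e_n)` replaces `D_j` by `D_j + n_j` and fixes `L_∞`, so it
turns `A_g` into `x(n) + V(n) + A_g` (`isVal_Ag_rmul`). The conjugated resolvent `R` therefore
satisfies `R x_m = (x(n) + z)⁻¹ x_m - R x_{m+1}` (`conjResolv_xm`). Iterating `d + 1` times,
expanding `x_m` into the `x_m^𝒜` and sorting by `k = 2m - |𝒜|` gives the splitting.

*The estimates.* As tame families, `(x(s) + z)⁻¹` has weight `(|s|² + |z|)⁻¹`, `V(s)` multiplies
weights by `(|s|² + |z|)^{1/2}` and `A_g` leaves them unchanged, so `x_m` has weight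
`(|s|² + |z|)^{-m/2}` (`exists_norm_xmOp_le`). For fixed `s` the same families are analytic in `z`.
-/

noncomputable section

namespace NCTorus

open scoped BigOperators ComplexOrder

/-- The real normed space structure of `L_2` obtained by restriction of scalars from `ℂ`. The real
structure that `lp` carries as a sequence space agrees with it, but not by definition, and the
continuous functional calculus on `L_2` refers to this one. -/
local instance (priority := 5000) realNormedSpace {d : ℕ} : NormedSpace ℝ (L2 d) :=
  NormedSpace.complexToReal

/-- The real module structure underlying `realNormedSpace`. -/
local instance (priority := 5000) realModule {d : ℕ} : Module ℝ (L2 d) :=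
  NormedSpace.complexToReal.toModule

/-- The bounded operators on `L_2`. -/
abbrev Op (d : ℕ) : Type := L2 d →L[ℂ] L2 d

/-! ### Matrix coefficients and the von Neumann algebra -/

section Coefficients

variable {d : ℕ}

theorem e_apply (n k : Fin d → ℤ) : (e n : L2 d) k = if k = n then 1 else 0 := by
  unfold e
  rw [lp.coeFn_single, Pi.single_apply]

theorem inner_e (n : Fin d → ℤ) (ξ : L2 d) : inner ℂ (e n) ξ = ξ n := by
  unfold e
  rw [lp.inner_single_left]
  simp

theorem hasSum_coeff (x : Op d) (ξ : L2 d) (m : Fin d → ℤ) :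
    HasSum (fun n => (x (e n) : L2 d) m * ξ n) ((x ξ : L2 d) m) := by
  have h := lp.hasSum_inner (𝕜 := ℂ) (ContinuousLinearMap.adjoint x (e m)) ξ
  rw [ContinuousLinearMap.adjoint_inner_left, inner_e] at h
  refine h.congr_fun ?_
  intro n
  have h2 : (ContinuousLinearMap.adjoint x (e m) : L2 d) n
      = (starRingEnd ℂ) ((x (e n) : L2 d) m) := by
    rw [← inner_e n, ContinuousLinearMap.adjoint_inner_right, ← inner_conj_symm, inner_e]
  rw [h2]
  simp [mul_comm]

theorem coeff_continuous (m : Fin d → ℤ) : Continuous fun ξ : L2 d => ξ m := by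
  have : (fun ξ : L2 d => ξ m) = fun ξ : L2 d => inner ℂ (e m) ξ := by
    funext ξ; rw [inner_e]
  rw [this]
  fun_prop

theorem op_ext_coeff {x y : Op d} (h : ∀ m n, (x (e n) : L2 d) m = (y (e n) : L2 d) m) :
    x = y := by
  ext ξ m
  have h1 := hasSum_coeff x ξ m
  simp only [h] at h1
  exact h1.unique (hasSum_coeff y ξ m)

variable (θ : Matrix (Fin d) (Fin d) ℝ)

theorem rmul_apply (n : Fin d → ℤ) (ξ : L2 d) (k : Fin d → ℤ) :
    (rmul θ n ξ : L2 d) k = cocycle θ (k - n) n * ξ (k - n) := rfl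

theorem cocycle_zero_left (n : Fin d → ℤ) : cocycle θ 0 n = 1 := by
  simp [cocycle]

theorem cocycle_add_left (a b c : Fin d → ℤ) :
    cocycle θ (a + b) c = cocycle θ a c * cocycle θ b c := by
  unfold cocycle
  rw [← Complex.exp_add, ← neg_add, ← mul_add, ← Finset.sum_add_distrib]
  congr 3
  refine Finset.sum_congr rfl fun j _ => ?_
  rw [← Finset.sum_add_distrib]
  refine Finset.sum_congr rfl fun k _ => ?_
  split_ifs
  · push_cast [Pi.add_apply]; ring
  · simp

theorem cocycle_add_right (a b c : Fin d → ℤ) :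
    cocycle θ a (b + c) = cocycle θ a b * cocycle θ a c := by
  unfold cocycle
  rw [← Complex.exp_add, ← neg_add, ← mul_add, ← Finset.sum_add_distrib]
  congr 3
  refine Finset.sum_congr rfl fun j _ => ?_
  rw [← Finset.sum_add_distrib]
  refine Finset.sum_congr rfl fun k _ => ?_
  split_ifs
  · push_cast [Pi.add_apply]; ring
  · simp

theorem rmul_vac (n : Fin d → ℤ) : rmul θ n (vac d) = e n := by
  ext k
  rw [rmul_apply, vac, e_apply, e_apply]
  by_cases h : k = n
  · subst h
    simp [cocycle_zero_left]
  · have h' : k - n ≠ 0 := fun h0 => h (sub_eq_zero.mp h0)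
    simp [h, h']

theorem lmul_mul_rmul (m n : Fin d → ℤ) : lmul θ m * rmul θ n = rmul θ n * lmul θ m := by
  ext ξ k
  change cocycle θ m (k - m) * (cocycle θ (k - m - n) n * ξ (k - m - n))
    = cocycle θ (k - n) n * (cocycle θ m (k - n - m) * ξ (k - n - m))
  have h1 : k - n - m = k - m - n := by abel
  have h2 : k - m = (k - m - n) + n := by abel
  have h3 : k - n = m + (k - m - n) := by abel
  rw [h1]
  conv_lhs => rw [h2]
  conv_rhs => rw [h3]
  rw [cocycle_add_left, cocycle_add_right]
  simp only [add_sub_cancel_right]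
  ring

/-- Membership in `L_∞` is commutation with the operators commuting with all the `λ_l(e_m)` and
their adjoints. -/
theorem mem_LInfty_iff {x : Op d} : x ∈ LInfty θ ↔
    ∀ T ∈ StarSubalgebra.centralizer ℂ (Set.range (lmul θ)), T * x = x * T := by
  change x ∈ StarSubalgebra.centralizer ℂ
    (StarSubalgebra.centralizer ℂ (Set.range (lmul θ)) : Set (Op d)) ↔ _
  rw [StarSubalgebra.mem_centralizer_iff]
  constructor
  · intro h T hT
    exact (h T hT).1
  · intro h T hT
    exact ⟨h T hT, h _ (star_mem hT)⟩

theorem weightedShift_e (u : (Fin d → ℤ) → ℂ) (hu : ∀ k, ‖u k‖ = 1) (m k : Fin d → ℤ) :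
    weightedShift u hu m (e k) = u (k + m) • (e (k + m) : L2 d) := by
  ext l
  change u l * (e k : L2 d) (l - m) = u (k + m) * (e (k + m) : L2 d) l
  rw [e_apply, e_apply]
  by_cases h : l = k + m
  · subst h; simp
  · have h' : l - m ≠ k := fun h0 => h (by rw [← h0]; abel)
    simp [h, h']

theorem star_weightedShift_apply (u : (Fin d → ℤ) → ℂ) (hu : ∀ k, ‖u k‖ = 1) (m : Fin d → ℤ)
    (ξ : L2 d) (k : Fin d → ℤ) :
    (star (weightedShift u hu m) ξ : L2 d) k = (starRingEnd ℂ) (u (k + m)) * ξ (k + m) := by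
  rw [← inner_e, ContinuousLinearMap.star_eq_adjoint, ContinuousLinearMap.adjoint_inner_right,
    weightedShift_e, inner_smul_left, inner_e]

theorem weightedShift_mul_star (u : (Fin d → ℤ) → ℂ) (hu : ∀ k, ‖u k‖ = 1) (m : Fin d → ℤ) :
    weightedShift u hu m * star (weightedShift u hu m) = 1 := by
  ext ξ k
  change u k * (star (weightedShift u hu m) ξ : L2 d) (k - m) = ξ k
  rw [star_weightedShift_apply, sub_add_cancel, ← mul_assoc, Complex.mul_conj,
    Complex.normSq_eq_norm_sq, hu]
  simp

theorem star_weightedShift_mul (u : (Fin d → ℤ) → ℂ) (hu : ∀ k, ‖u k‖ = 1) (m : Fin d → ℤ) :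
    star (weightedShift u hu m) * weightedShift u hu m = 1 := by
  ext ξ k
  change (star (weightedShift u hu m) (weightedShift u hu m ξ) : L2 d) k = ξ k
  rw [star_weightedShift_apply]
  change _ * (u (k + m) * ξ (k + m - m)) = ξ k
  rw [add_sub_cancel_right, ← mul_assoc, mul_comm ((starRingEnd ℂ) _), Complex.mul_conj,
    Complex.normSq_eq_norm_sq, hu]
  simp

theorem rmul_mem_centralizer (n : Fin d → ℤ) :
    rmul θ n ∈ StarSubalgebra.centralizer ℂ (Set.range (lmul θ)) := by
  rw [StarSubalgebra.mem_centralizer_iff]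
  rintro _ ⟨m, rfl⟩
  refine ⟨lmul_mul_rmul θ m n, ?_⟩
  have h1 : lmul θ m * star (lmul θ m) = 1 := weightedShift_mul_star _ _ _
  have h2 : star (lmul θ m) * lmul θ m = 1 := star_weightedShift_mul _ _ _
  calc star (lmul θ m) * rmul θ n
      = star (lmul θ m) * (rmul θ n * lmul θ m) * star (lmul θ m) := by
        rw [mul_assoc, mul_assoc, h1, mul_one]
    _ = star (lmul θ m) * lmul θ m * rmul θ n * star (lmul θ m) := by
        rw [← lmul_mul_rmul]; simp only [mul_assoc]
    _ = rmul θ n * star (lmul θ m) := by rw [h2, one_mul]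

theorem rmul_mul_of_mem {x : Op d} (hx : x ∈ LInfty θ) (n : Fin d → ℤ) :
    rmul θ n * x = x * rmul θ n :=
  (mem_LInfty_iff θ).mp hx _ (rmul_mem_centralizer θ n)

/-- An element of `L_∞` is determined by its vector `x 1`, as it commutes with `λ_r(e_n)`. -/
theorem coeff_of_mem {x : Op d} (hx : x ∈ LInfty θ) (m n : Fin d → ℤ) :
    (x (e n) : L2 d) m = cocycle θ (m - n) n * (x (vac d) : L2 d) (m - n) := by
  have h := congrArg (fun T : Op d => T (vac d)) (rmul_mul_of_mem θ hx n)
  change rmul θ n (x (vac d)) = x (rmul θ n (vac d)) at h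
  rw [← rmul_vac θ n, ← h, rmul_apply]

theorem algebraMap_mem_LInfty (c : ℂ) : (c • (1 : Op d)) ∈ LInfty θ := by
  rw [mem_LInfty_iff]
  intro T _
  simp

theorem add_mem_LInfty {x y : Op d} (hx : x ∈ LInfty θ) (hy : y ∈ LInfty θ) :
    x + y ∈ LInfty θ := by
  rw [mem_LInfty_iff] at *
  intro T hT
  rw [mul_add, add_mul, hx T hT, hy T hT]

theorem mul_mem_LInfty {x y : Op d} (hx : x ∈ LInfty θ) (hy : y ∈ LInfty θ) :
    x * y ∈ LInfty θ := by
  rw [mem_LInfty_iff] at *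
  intro T hT
  rw [← mul_assoc, hx T hT, mul_assoc, hy T hT, mul_assoc]

theorem smul_mem_LInfty {x : Op d} (hx : x ∈ LInfty θ) (c : ℂ) : c • x ∈ LInfty θ := by
  rw [mem_LInfty_iff] at *
  intro T hT
  rw [mul_smul_comm, hx T hT, smul_mul_assoc]

theorem inverse_mem_LInfty {x : Op d} (hx : x ∈ LInfty θ) : Ring.inverse x ∈ LInfty θ := by
  rw [mem_LInfty_iff] at *
  intro T hT
  by_cases h : IsUnit x
  · have h1 := Ring.mul_inverse_cancel x h
    have h2 := Ring.inverse_mul_cancel x h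
    calc T * Ring.inverse x = Ring.inverse x * x * T * Ring.inverse x := by rw [h2, one_mul]
      _ = Ring.inverse x * (T * x) * Ring.inverse x := by rw [hx T hT]; simp only [mul_assoc]
      _ = Ring.inverse x * T := by simp only [mul_assoc, h1, mul_one]
  · rw [Ring.inverse_non_unit x h]; simp

theorem integral_mem_LInfty {T : Type*} [MeasurableSpace T] {μ : MeasureTheory.Measure T}
    {F : T → Op d} (hF : ∀ t, F t ∈ LInfty θ) (hi : MeasureTheory.Integrable F μ) :
    (∫ t, F t ∂μ) ∈ LInfty θ := by
  rw [mem_LInfty_iff]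
  intro S hS
  have h1 := ((ContinuousLinearMap.mul ℂ (Op d)) S).integral_comp_comm hi
  have h2 := ((ContinuousLinearMap.mul ℂ (Op d)).flip S).integral_comp_comm hi
  simp only [ContinuousLinearMap.mul_apply', ContinuousLinearMap.flip_apply] at h1 h2
  rw [← h1, ← h2]
  congr 1
  funext t
  exact (mem_LInfty_iff θ).mp (hF t) S hS

end Coefficients

/-! ### The derivations -/

section Derivations

variable {d : ℕ}

/-- `η = D_j ξ`, expressed through Fourier coefficients. -/
def IsD (j : Fin d) (ξ η : L2 d) : Prop := ∀ n, η n = (n j : ℂ) * ξ n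

/-- `y` is the commutator `[D_j, x]`, i.e. the derivative `δ_j x` of the element `x`, expressed
through matrix coefficients. -/
def IsDeriv (θ : Matrix (Fin d) (Fin d) ℝ) (j : Fin d) (x y : Op d) : Prop :=
  y ∈ LInfty θ ∧ ∀ m n : Fin d → ℤ, (y (e n) : L2 d) m = ((m j : ℂ) - n j) * (x (e n) : L2 d) m

variable {θ : Matrix (Fin d) (Fin d) ℝ}

theorem norm_diag_term_sq_le (f : (Fin d → ℤ) → ℂ) (C : ℝ) (hf : ∀ n, ‖f n‖ ≤ C) (ξ : L2 d) :
    ∀ n, ‖f n * ξ n‖ ^ 2 ≤ C ^ 2 * ‖ξ n‖ ^ 2 := fun n => by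
  rw [norm_mul, mul_pow]
  gcongr
  exact hf n

theorem summable_norm_sq (ξ : L2 d) : Summable fun n => ‖ξ n‖ ^ 2 := by
  have h := (lp.hasSum_norm (p := 2) (by norm_num) ξ).summable
  simpa using h

theorem norm_sq_eq_tsum (ξ : L2 d) : ‖ξ‖ ^ 2 = ∑' n, ‖ξ n‖ ^ 2 := by
  have h := (lp.hasSum_norm (p := 2) (by norm_num) ξ).tsum_eq
  simpa using h.symm

theorem memlp_of_summable {f : (Fin d → ℤ) → ℂ} (h : Summable fun n => ‖f n‖ ^ 2) :
    Memℓp f 2 := memℓp_gen (by simpa using h)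

/-- The diagonal operator `e_n ↦ f(n) e_n` given by a function bounded by `C`. -/
def diag (f : (Fin d → ℤ) → ℂ) (C : ℝ) (hf : ∀ n, ‖f n‖ ≤ C) : Op d :=
  LinearMap.mkContinuous
    { toFun := fun ξ => ⟨fun n => f n * ξ n, memlp_of_summable
        (((summable_norm_sq ξ).mul_left (C ^ 2)).of_nonneg_of_le (fun _ => by positivity)
          (norm_diag_term_sq_le f C hf ξ))⟩
      map_add' := by
        intro ξ η
        ext n
        exact mul_add (f n) (ξ n) (η n)
      map_smul' := by
        intro c ξ
        ext n
        simp only [lp.coeFn_smul, Pi.smul_apply, smul_eq_mul, RingHom.id_apply]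
        ring }
    C
    (by
      intro ξ
      have hC : 0 ≤ C := (norm_nonneg _).trans (hf 0)
      refine (pow_le_pow_iff_left₀ (norm_nonneg _) (by positivity) two_ne_zero).mp ?_
      rw [norm_sq_eq_tsum, mul_pow, norm_sq_eq_tsum ξ, ← tsum_mul_left]
      exact Summable.tsum_le_tsum (norm_diag_term_sq_le f C hf ξ)
        (((summable_norm_sq ξ).mul_left (C ^ 2)).of_nonneg_of_le (fun _ => by positivity)
          (norm_diag_term_sq_le f C hf ξ)) ((summable_norm_sq ξ).mul_left (C ^ 2)))

theorem diag_apply (f : (Fin d → ℤ) → ℂ) (C : ℝ) (hf : ∀ n, ‖f n‖ ≤ C) (ξ : L2 d)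
    (n : Fin d → ℤ) : (diag f C hf ξ : L2 d) n = f n * ξ n := rfl

theorem diag_e (f : (Fin d → ℤ) → ℂ) (C : ℝ) (hf : ∀ n, ‖f n‖ ≤ C) (n : Fin d → ℤ) :
    diag f C hf (e n) = f n • (e n : L2 d) := by
  ext m
  rw [diag_apply, lp.coeFn_smul, Pi.smul_apply, smul_eq_mul, e_apply]
  split_ifs with h
  · rw [h]
  · simp

theorem diag_tendsto {f : ℕ → (Fin d → ℤ) → ℂ} {C : ℝ} (hf : ∀ k n, ‖f k n‖ ≤ C)
    (h : ∀ n, Filter.Tendsto (fun k => f k n) Filter.atTop (nhds 1)) (ξ : L2 d) :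
    Filter.Tendsto (fun k => diag (f k) C (hf k) ξ) Filter.atTop (nhds ξ) := by
  rw [tendsto_iff_norm_sub_tendsto_zero]
  have key : Filter.Tendsto (fun k => ‖diag (f k) C (hf k) ξ - ξ‖ ^ 2) Filter.atTop (nhds 0) := by
    simp only [norm_sq_eq_tsum]
    have h0 : (0 : ℝ) = ∑' _ : Fin d → ℤ, (0 : ℝ) := by simp
    rw [h0]
    refine tendsto_tsum_of_dominated_convergence
      (bound := fun n => (C + 1) ^ 2 * ‖ξ n‖ ^ 2) ((summable_norm_sq ξ).mul_left _) ?_ ?_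
    · intro n
      have h1 : Filter.Tendsto (fun k => ‖f k n * ξ n - ξ n‖ ^ 2) Filter.atTop
          (nhds (‖(1 : ℂ) * ξ n - ξ n‖ ^ 2)) :=
        ((((h n).mul_const (ξ n)).sub_const (ξ n)).norm).pow 2
      rw [one_mul, sub_self, norm_zero, zero_pow two_ne_zero] at h1
      exact h1
    · refine Filter.Eventually.of_forall fun k n => ?_
      change ‖‖f k n * ξ n - ξ n‖ ^ 2‖ ≤ _
      rw [Real.norm_of_nonneg (by positivity), ← mul_pow]
      gcongr
      calc ‖f k n * ξ n - ξ n‖ ≤ ‖f k n * ξ n‖ + ‖ξ n‖ := norm_sub_le _ _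
        _ ≤ C * ‖ξ n‖ + ‖ξ n‖ := by rw [norm_mul]; gcongr; exact hf k n
        _ = (C + 1) * ‖ξ n‖ := by ring
  have := key.sqrt
  simpa [Real.sqrt_sq] using this

theorem IsD.unique {j : Fin d} {ξ η η' : L2 d} (h : IsD j ξ η) (h' : IsD j ξ η') : η = η' := by
  ext n; rw [h n, h' n]

theorem isD_e (j : Fin d) (n : Fin d → ℤ) : IsD j (e n) ((n j : ℂ) • (e n : L2 d)) := fun m => by
  simp only [lp.coeFn_smul, Pi.smul_apply, e_apply, smul_eq_mul]
  split_ifs with h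
  · rw [h]
  · simp

theorem isD_vac (j : Fin d) : IsD j (vac d) 0 := by
  have h := isD_e j (0 : Fin d → ℤ)
  simpa [vac] using h

/-- The product rule `D_j (x ξ) = x (D_j ξ) + (δ_j x) ξ`. -/
theorem IsD.apply {j : Fin d} {ξ ξ' : L2 d} {x y : Op d} (h : IsD j ξ ξ')
    (hx : IsDeriv θ j x y) : IsD j (x ξ) (x ξ' + y ξ) := by
  intro m
  have h1 := (hasSum_coeff x ξ' m).add (hasSum_coeff y ξ m)
  have h2 := (hasSum_coeff x ξ m).mul_left (m j : ℂ)
  have h3 : (fun n => (x (e n) : L2 d) m * ξ' n + (y (e n) : L2 d) m * ξ n)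
      = fun n => (m j : ℂ) * ((x (e n) : L2 d) m * ξ n) := by
    funext n
    rw [h n, hx.2 m n]; ring
  rw [h3] at h1
  exact h1.unique h2

theorem isDeriv_of_isD_e {j : Fin d} {x y : Op d} (hy : y ∈ LInfty θ)
    (h : ∀ n, IsD j (x (e n)) (x ((n j : ℂ) • (e n : L2 d)) + y (e n))) : IsDeriv θ j x y := by
  refine ⟨hy, fun m n => ?_⟩
  have := h n m
  rw [lp.coeFn_add, Pi.add_apply, map_smul, lp.coeFn_smul, Pi.smul_apply, smul_eq_mul] at this
  linear_combination this

theorem IsDeriv.mul {j : Fin d} {x y x' y' : Op d} (hx : x ∈ LInfty θ) (hy : y ∈ LInfty θ)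
    (h : IsDeriv θ j x x') (k : IsDeriv θ j y y') : IsDeriv θ j (x * y) (x' * y + x * y') := by
  refine isDeriv_of_isD_e
    (add_mem_LInfty θ (mul_mem_LInfty θ h.1 hy) (mul_mem_LInfty θ hx k.1)) fun n => ?_
  have := ((isD_e j n).apply k).apply h
  have e1 : (x * y) ((n j : ℂ) • (e n : L2 d)) + (x' * y + x * y') (e n)
      = x (y ((n j : ℂ) • e n) + y' (e n)) + x' (y (e n)) := ?_
  · rw [e1]
    exact this
  change x (y ((n j : ℂ) • e n)) + (x' (y (e n)) + x (y' (e n))) = _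
  rw [map_add]
  abel

theorem IsDeriv.add {j : Fin d} {x y x' y' : Op d}
    (h : IsDeriv θ j x x') (k : IsDeriv θ j y y') : IsDeriv θ j (x + y) (x' + y') := by
  refine ⟨add_mem_LInfty θ h.1 k.1, fun m n => ?_⟩
  rw [add_apply, add_apply, lp.coeFn_add, lp.coeFn_add,
    Pi.add_apply, Pi.add_apply, h.2, k.2]
  ring

theorem IsDeriv.smul_one (j : Fin d) (c : ℂ) : IsDeriv θ j (c • (1 : Op d)) 0 := by
  refine ⟨zero_mem _, fun m n => ?_⟩
  change (0 : ℂ) = _ * (c * (e n : L2 d) m)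
  rw [e_apply]
  split_ifs with h
  · simp [h]
  · simp

theorem IsDeriv.unique {j : Fin d} {x y y' : Op d} (h : IsDeriv θ j x y) (h' : IsDeriv θ j x y') :
    y = y' :=
  op_ext_coeff fun m n => by rw [h.2, h'.2]

theorem one_add_mul_I_ne_zero (t : ℝ) : (1 + (t : ℂ) * Complex.I) ≠ 0 := by
  intro h
  have := congrArg Complex.re h
  simp at this

theorem one_le_norm_one_add_mul_I (t : ℝ) : 1 ≤ ‖(1 + (t : ℂ) * Complex.I)‖ := by
  have := Complex.abs_re_le_norm (1 + (t : ℂ) * Complex.I)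
  simpa using this

theorem abs_le_norm_one_add_mul_I (t : ℝ) : |t| ≤ ‖(1 + (t : ℂ) * Complex.I)‖ := by
  have := Complex.abs_im_le_norm (1 + (t : ℂ) * Complex.I)
  simpa using this

/-- The derivation passes to inverses. A priori `x⁻¹ e_n` need not lie in the domain of `D_j`, so
the computation is carried out with the bounded regularizations `D_j (1 + i ε D_j)⁻¹` of `D_j`. -/
theorem IsDeriv.inverse {j : Fin d} {x x' : Op d} (hx : x ∈ LInfty θ) (h : IsDeriv θ j x x') :
    IsDeriv θ j (Ring.inverse x) (-(Ring.inverse x * x' * Ring.inverse x)) := by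
  have hi := inverse_mem_LInfty θ hx
  have hm : -(Ring.inverse x * x' * Ring.inverse x) ∈ LInfty θ := by
    rw [← neg_one_smul ℂ]
    exact smul_mem_LInfty θ (mul_mem_LInfty θ (mul_mem_LInfty θ hi h.1) hi) _
  by_cases hu : IsUnit x
  · refine ⟨hm, fun m n => ?_⟩
    set r := Ring.inverse x with hr
    have hxr : x * r = 1 := Ring.mul_inverse_cancel x hu
    have hrx : r * x = 1 := Ring.inverse_mul_cancel x hu
    let ε : ℕ → ℝ := fun k => 1 / ((k : ℝ) + 1)
    have hε : ∀ k, 0 < ε k := fun k => by positivity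
    have hε0 : Filter.Tendsto ε Filter.atTop (nhds 0) := tendsto_one_div_add_atTop_nhds_zero_nat
    let s : ℕ → (Fin d → ℤ) → ℂ := fun k n => (1 + ((ε k * n j : ℝ) : ℂ) * Complex.I)⁻¹
    have hs : ∀ k n, ‖s k n‖ ≤ 1 := fun k n => by
      rw [norm_inv]
      exact inv_le_one_of_one_le₀ (one_le_norm_one_add_mul_I _)
    let p : ℕ → (Fin d → ℤ) → ℂ := fun k n => (n j : ℂ) * s k n
    have hp : ∀ k n, ‖p k n‖ ≤ (ε k)⁻¹ := fun k n => by
      have h1 := abs_le_norm_one_add_mul_I (ε k * n j)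
      have h2 : 0 < ‖(1 + ((ε k * n j : ℝ) : ℂ) * Complex.I)‖ :=
        lt_of_lt_of_le one_pos (one_le_norm_one_add_mul_I _)
      change ‖(n j : ℂ) * (1 + ((ε k * n j : ℝ) : ℂ) * Complex.I)⁻¹‖ ≤ _
      rw [norm_mul, norm_inv, Complex.norm_intCast, ← div_eq_mul_inv, div_le_iff₀ h2,
        inv_mul_eq_div, le_div_iff₀ (hε k)]
      rwa [abs_mul, abs_of_pos (hε k), mul_comm] at h1
    have hps : ∀ k m n, p k m - p k n = s k m * ((m j : ℂ) - n j) * s k n := fun k m n => by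
      have h1 := one_add_mul_I_ne_zero (ε k * m j)
      have h2 := one_add_mul_I_ne_zero (ε k * n j)
      change (m j : ℂ) * (1 + ((ε k * m j : ℝ) : ℂ) * Complex.I)⁻¹
        - (n j : ℂ) * (1 + ((ε k * n j : ℝ) : ℂ) * Complex.I)⁻¹
        = (1 + ((ε k * m j : ℝ) : ℂ) * Complex.I)⁻¹ * ((m j : ℂ) - n j)
          * (1 + ((ε k * n j : ℝ) : ℂ) * Complex.I)⁻¹
      have h3 : (m j : ℂ) * (1 + ((ε k * n j : ℝ) : ℂ) * Complex.I)
          - n j * (1 + ((ε k * m j : ℝ) : ℂ) * Complex.I) = m j - n j := by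
        push_cast; ring
      rw [← h3]
      generalize (1 + ((ε k * m j : ℝ) : ℂ) * Complex.I) = a at h1 ⊢
      generalize (1 + ((ε k * n j : ℝ) : ℂ) * Complex.I) = b at h2 ⊢
      field_simp
    have hcomm : ∀ k, diag (p k) _ (hp k) * x - x * diag (p k) _ (hp k)
        = diag (s k) _ (hs k) * x' * diag (s k) _ (hs k) := fun k => by
      refine op_ext_coeff fun m n => ?_
      change p k m * (x (e n) : L2 d) m - (x (diag (p k) _ (hp k) (e n)) : L2 d) m
        = s k m * (x' (diag (s k) _ (hs k) (e n)) : L2 d) m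
      rw [diag_e, diag_e, map_smul, map_smul, lp.coeFn_smul, lp.coeFn_smul, Pi.smul_apply,
        Pi.smul_apply, smul_eq_mul, smul_eq_mul, h.2]
      linear_combination (x (e n) : L2 d) m * hps k m n
    have hcomm' : ∀ k, diag (p k) _ (hp k) * r - r * diag (p k) _ (hp k)
        = -(r * (diag (s k) _ (hs k) * x' * diag (s k) _ (hs k)) * r) := fun k => by
      rw [← hcomm, mul_sub, sub_mul, ← mul_assoc r x, hrx, one_mul,
        ← mul_assoc r (diag (p k) _ (hp k)) x, mul_assoc _ x r, hxr, mul_one]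
      abel
    have hentry : ∀ k, s k m * ((m j : ℂ) - n j) * s k n * (r (e n) : L2 d) m
        = -(r (diag (s k) _ (hs k) (x' (diag (s k) _ (hs k) (r (e n))))) : L2 d) m := fun k => by
      have h1 := congrArg (fun T : Op d => (T (e n) : L2 d) m) (hcomm' k)
      change p k m * (r (e n) : L2 d) m - (r (diag (p k) _ (hp k) (e n)) : L2 d) m
        = -(r (diag (s k) _ (hs k) (x' (diag (s k) _ (hs k) (r (e n))))) : L2 d) m at h1
      rw [diag_e, map_smul, lp.coeFn_smul, Pi.smul_apply, smul_eq_mul] at h1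
      rw [← h1, ← hps]
      ring
    have hs1 : ∀ n, Filter.Tendsto (fun k => s k n) Filter.atTop (nhds 1) := fun n => by
      have h1 : Filter.Tendsto (fun k => (1 + ((ε k * n j : ℝ) : ℂ) * Complex.I)⁻¹)
          Filter.atTop (nhds ((1 + ((0 * n j : ℝ) : ℂ) * Complex.I)⁻¹)) := by
        refine Filter.Tendsto.inv₀ ?_ (one_add_mul_I_ne_zero _)
        refine Filter.Tendsto.const_add _ (Filter.Tendsto.mul_const _ ?_)
        exact (Complex.continuous_ofReal.tendsto _).comp (hε0.mul_const _)
      rw [zero_mul, Complex.ofReal_zero, zero_mul, add_zero, inv_one] at h1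
      exact h1
    have hlim1 : Filter.Tendsto
        (fun k => s k m * ((m j : ℂ) - n j) * s k n * (r (e n) : L2 d) m) Filter.atTop
        (nhds (1 * ((m j : ℂ) - n j) * 1 * (r (e n) : L2 d) m)) :=
      (((hs1 m).mul_const _).mul (hs1 n)).mul_const _
    have hstrong : ∀ {ξ : ℕ → L2 d} {ξ₀ : L2 d}, Filter.Tendsto ξ Filter.atTop (nhds ξ₀) →
        Filter.Tendsto (fun k => diag (s k) _ (hs k) (ξ k)) Filter.atTop (nhds ξ₀) := by
      intro ξ ξ₀ hξ
      have h1 := diag_tendsto hs hs1 ξ₀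
      have h2 : Filter.Tendsto (fun k => diag (s k) _ (hs k) (ξ k - ξ₀)) Filter.atTop
          (nhds 0) := by
        refine squeeze_zero_norm (fun k => ?_) (tendsto_iff_norm_sub_tendsto_zero.mp hξ)
        refine ((diag (s k) _ (hs k)).le_of_opNorm_le
          (LinearMap.mkContinuous_norm_le _ zero_le_one _) _).trans ?_
        rw [one_mul]
      have h3 := h1.add h2
      simpa [map_sub] using h3
    have hlim2 : Filter.Tendsto
        (fun k => -(r (diag (s k) _ (hs k) (x' (diag (s k) _ (hs k) (r (e n))))) : L2 d) m)
        Filter.atTop (nhds (-(r (x' (r (e n))) : L2 d) m)) := by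
      have h1 := hstrong ((x'.continuous.tendsto _).comp (diag_tendsto hs hs1 (r (e n))))
      exact ((coeff_continuous m).tendsto _ |>.comp ((r.continuous.tendsto _).comp h1)).neg
    simp only [hentry] at hlim1
    have h1 := tendsto_nhds_unique hlim2 hlim1
    rw [one_mul, mul_one] at h1
    exact h1
  · rw [Ring.inverse_non_unit x hu] at hm ⊢
    refine ⟨hm, fun m n => ?_⟩
    simp

/-- For elements of `L_∞`, the relation `y = [D_j, x]` can be tested on the vector `1`. -/
theorem isDeriv_of_vac {j : Fin d} {x y : Op d} (hx : x ∈ LInfty θ) (hy : y ∈ LInfty θ)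
    (h : IsD j (x (vac d)) (y (vac d))) : IsDeriv θ j x y := by
  refine ⟨hy, fun m n => ?_⟩
  rw [coeff_of_mem θ hx, coeff_of_mem θ hy, h]
  push_cast [Pi.sub_apply]
  ring

theorem IsDeriv.isD_vac {j : Fin d} {x y : Op d} (h : IsDeriv θ j x y) :
    IsD j (x (vac d)) (y (vac d)) := by
  simpa using (NCTorus.isD_vac j).apply h

theorem IsDeriv.integral {j : Fin d} {T : Type*} [MeasurableSpace T]
    {μ : MeasureTheory.Measure T} {F F' : T → Op d} (h : ∀ t, IsDeriv θ j (F t) (F' t))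
    (hF : MeasureTheory.Integrable F μ) (hF' : MeasureTheory.Integrable F' μ) :
    IsDeriv θ j (∫ t, F t ∂μ) (∫ t, F' t ∂μ) := by
  refine ⟨integral_mem_LInfty θ (fun t => (h t).1) hF', fun m n => ?_⟩
  have key : ∀ {G : T → Op d}, MeasureTheory.Integrable G μ →
      (((∫ t, G t ∂μ) (e n) : L2 d) m) = ∫ t, ((G t) (e n) : L2 d) m ∂μ := by
    intro G hG
    have := ((innerSL ℂ (e m : L2 d)).comp
      (ContinuousLinearMap.apply ℂ (L2 d) (e n : L2 d))).integral_comp_comm hG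
    simp only [ContinuousLinearMap.comp_apply, ContinuousLinearMap.apply_apply,
      innerSL_apply_apply, inner_e] at this
    exact this.symm
  rw [key hF, key hF', ← MeasureTheory.integral_const_mul]
  congr 1
  funext t
  exact (h t).2 m n

end Derivations

/-! ### Smooth families of operators with symbol estimates -/

section Families

variable {d : ℕ} (θ : Matrix (Fin d) (Fin d) ℝ)

open Classical in
/-- The derivation `δ_j x = [D_j, x]`, and `0` where it is not defined as an element of `L_∞`. -/
def der (j : Fin d) (x : Op d) : Op d := if h : ∃ y, IsDeriv θ j x y then h.choose else 0

variable {θ}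

theorem IsDeriv.der_eq {j : Fin d} {x y : Op d} (h : IsDeriv θ j x y) : der θ j x = y := by
  have h' : ∃ y, IsDeriv θ j x y := ⟨y, h⟩
  unfold der
  rw [dif_pos h']
  exact h'.choose_spec.unique h

theorem IsDeriv.der {j : Fin d} {x y : Op d} (h : IsDeriv θ j x y) :
    IsDeriv θ j x (der θ j x) := by
  rw [h.der_eq]; exact h

variable (θ) {T : Type*} (R : Subalgebra ℂ (T → Op d)) (S : Set T)

/-- A family of elements of `L_∞`, lying in the algebra `R` of (say measurable, or analytic)
families and bounded by a multiple of the weight `w` on `S`. -/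
def Base (w : T → ℝ) (F : T → Op d) : Prop :=
  (∀ t, F t ∈ LInfty θ) ∧ F ∈ R ∧ ∃ C : ℝ, ∀ t ∈ S, ‖F t‖ ≤ C * w t

/-- A family all of whose derivatives of order at most `N` exist, belong to `R` and are bounded by
multiples of the weight `w` on `S`. -/
def TameN : ℕ → (T → ℝ) → (T → Op d) → Prop
  | 0, w, F => Base θ R S w F
  | N + 1, w, F => Base θ R S w F ∧
      ∀ j, (∀ t, IsDeriv θ j (F t) (der θ j (F t))) ∧ TameN N w (fun t => der θ j (F t))

/-- A family of elements of `C^∞` all of whose derivatives belong to `R` and are bounded by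
multiples of the weight `w` on `S`. -/
def Tame (w : T → ℝ) (F : T → Op d) : Prop := ∀ N, TameN θ R S N w F

variable {θ R S} {w w' : T → ℝ} {F G : T → Op d} {N : ℕ}

theorem TameN.base (h : TameN θ R S N w F) : Base θ R S w F := by
  cases N with
  | zero => exact h
  | succ N => exact h.1

theorem TameN.of_succ (h : TameN θ R S (N + 1) w F) : TameN θ R S N w F := by
  induction N generalizing F with
  | zero => exact h.1
  | succ N ih => exact ⟨h.1, fun j => ⟨(h.2 j).1, ih (h.2 j).2⟩⟩

theorem TameN.succ_of (h : Base θ R S w F)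
    (h' : ∀ j, ∃ F' : T → Op d, (∀ t, IsDeriv θ j (F t) (F' t)) ∧ TameN θ R S N w F') :
    TameN θ R S (N + 1) w F := by
  refine ⟨h, fun j => ?_⟩
  obtain ⟨F', h1, h2⟩ := h' j
  have h3 : (fun t => NCTorus.der θ j (F t)) = F' := funext fun t => (h1 t).der_eq
  exact ⟨fun t => (h1 t).der, h3 ▸ h2⟩

theorem Base.add (h : Base θ R S w F) (k : Base θ R S w G) :
    Base θ R S w (fun t => F t + G t) := by
  obtain ⟨C, hC⟩ := h.2.2
  obtain ⟨C', hC'⟩ := k.2.2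
  refine ⟨fun t => add_mem_LInfty θ (h.1 t) (k.1 t), R.add_mem h.2.1 k.2.1, C + C',
    fun t ht => ?_⟩
  rw [add_mul]
  exact (norm_add_le _ _).trans (add_le_add (hC t ht) (hC' t ht))

theorem Base.mul (h : Base θ R S w F) (k : Base θ R S w' G) :
    Base θ R S (fun t => w t * w' t) (fun t => F t * G t) := by
  obtain ⟨C, hC⟩ := h.2.2
  obtain ⟨C', hC'⟩ := k.2.2
  refine ⟨fun t => mul_mem_LInfty θ (h.1 t) (k.1 t), R.mul_mem h.2.1 k.2.1, C * C',
    fun t ht => ?_⟩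
  calc ‖F t * G t‖ ≤ ‖F t‖ * ‖G t‖ := norm_mul_le _ _
    _ ≤ (C * w t) * (C' * w' t) :=
      mul_le_mul (hC t ht) (hC' t ht) (norm_nonneg _) ((norm_nonneg _).trans (hC t ht))
    _ = _ := by ring

theorem Base.weight (h : Base θ R S w F) (K : ℝ) (hw0 : ∀ t ∈ S, 0 ≤ w t)
    (hw : ∀ t ∈ S, w t ≤ K * w' t) : Base θ R S w' F := by
  obtain ⟨C, hC⟩ := h.2.2
  refine ⟨h.1, h.2.1, |C| * K, fun t ht => ?_⟩
  calc ‖F t‖ ≤ C * w t := hC t ht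
    _ ≤ |C| * w t := mul_le_mul_of_nonneg_right (le_abs_self C) (hw0 t ht)
    _ ≤ |C| * (K * w' t) := mul_le_mul_of_nonneg_left (hw t ht) (abs_nonneg C)
    _ = _ := by ring

theorem Base.smul (h : Base θ R S w F) (c : ℂ) : Base θ R S w (fun t => c • F t) := by
  obtain ⟨C, hC⟩ := h.2.2
  refine ⟨fun t => smul_mem_LInfty θ (h.1 t) c, R.smul_mem h.2.1 c, ‖c‖ * C, fun t ht => ?_⟩
  rw [norm_smul, mul_assoc]
  exact mul_le_mul_of_nonneg_left (hC t ht) (norm_nonneg c)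

theorem IsDeriv.smul {j : Fin d} {x y : Op d} (h : IsDeriv θ j x y) (c : ℂ) :
    IsDeriv θ j (c • x) (c • y) := by
  refine ⟨smul_mem_LInfty θ h.1 c, fun m n => ?_⟩
  change c * (y (e n) : L2 d) m = _ * (c * (x (e n) : L2 d) m)
  rw [h.2]; ring

theorem TameN.add (h : TameN θ R S N w F) (k : TameN θ R S N w G) :
    TameN θ R S N w (fun t => F t + G t) := by
  induction N generalizing F G with
  | zero => exact Base.add h k
  | succ N ih =>
    exact TameN.succ_of (Base.add h.1 k.1) fun j =>
      ⟨_, fun t => ((h.2 j).1 t).add ((k.2 j).1 t), ih (h.2 j).2 (k.2 j).2⟩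

theorem TameN.smul (h : TameN θ R S N w F) (c : ℂ) : TameN θ R S N w (fun t => c • F t) := by
  induction N generalizing F with
  | zero => exact Base.smul h c
  | succ N ih =>
    exact TameN.succ_of (Base.smul h.1 c) fun j => ⟨_, fun t => ((h.2 j).1 t).smul c, ih (h.2 j).2⟩

theorem TameN.mul (h : TameN θ R S N w F) (k : TameN θ R S N w' G) :
    TameN θ R S N (fun t => w t * w' t) (fun t => F t * G t) := by
  induction N generalizing F G with
  | zero => exact Base.mul h k
  | succ N ih =>
    exact TameN.succ_of (Base.mul h.1 k.1) fun j =>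
      ⟨_, fun t => ((h.2 j).1 t).mul (h.1.1 t) (k.1.1 t) ((k.2 j).1 t),
        (ih (h.2 j).2 k.of_succ).add (ih h.of_succ (k.2 j).2)⟩

theorem TameN.weight (h : TameN θ R S N w F) (K : ℝ) (hw0 : ∀ t ∈ S, 0 ≤ w t)
    (hw : ∀ t ∈ S, w t ≤ K * w' t) : TameN θ R S N w' F := by
  induction N generalizing F with
  | zero => exact Base.weight h K hw0 hw
  | succ N ih => exact ⟨h.1.weight K hw0 hw, fun j => ⟨(h.2 j).1, ih (h.2 j).2⟩⟩

theorem TameN.inverse (h : TameN θ R S N w F) (hb : Base θ R S w' (fun t => Ring.inverse (F t)))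
    (K : ℝ) (hw0 : ∀ t ∈ S, 0 ≤ w t) (hw0' : ∀ t ∈ S, 0 ≤ w' t)
    (hw : ∀ t ∈ S, w t * w' t ≤ K) : TameN θ R S N w' (fun t => Ring.inverse (F t)) := by
  induction N with
  | zero => exact hb
  | succ N ih =>
    refine TameN.succ_of hb fun j => ⟨_, fun t => ((h.2 j).1 t).inverse (h.1.1 t), ?_⟩
    have h1 := ((((ih h.of_succ).mul (h.2 j).2).mul (ih h.of_succ)).smul (-1)).weight
      (w' := w') K (fun t ht => mul_nonneg (mul_nonneg (hw0' t ht) (hw0 t ht)) (hw0' t ht))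
      (fun t ht => by
        have := mul_le_mul_of_nonneg_right (hw t ht) (hw0' t ht)
        calc w' t * w t * w' t = w t * w' t * w' t := by ring
          _ ≤ _ := this)
    simpa using h1

theorem TameN.scalar (c : T → ℂ) (hc : (fun t => c t • (1 : Op d)) ∈ R) (C : ℝ)
    (hC : ∀ t ∈ S, ‖c t‖ ≤ C * w t) : TameN θ R S N w (fun t => c t • (1 : Op d)) := by
  have hb : Base θ R S w (fun t => c t • (1 : Op d)) := by
    refine ⟨fun t => algebraMap_mem_LInfty θ _, hc, C, fun t ht => ?_⟩
    rw [norm_smul]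
    have h1 : ‖(1 : Op d)‖ ≤ 1 := ContinuousLinearMap.norm_id_le
    have h2 := hC t ht
    nlinarith [norm_nonneg (c t)]
  have hz : ∀ N, TameN θ R S N w (fun _ => (0 : Op d)) := by
    have hb0 : Base θ R S w (fun _ => (0 : Op d)) := by
      simpa using hb.smul 0
    intro N
    induction N with
    | zero => exact hb0
    | succ N ih =>
      refine TameN.succ_of hb0 fun j => ⟨_, fun t => ?_, ih⟩
      simpa using IsDeriv.smul_one (θ := θ) j 0
  cases N with
  | zero => exact hb
  | succ N => exact TameN.succ_of hb fun j => ⟨_, fun t => IsDeriv.smul_one j _, hz N⟩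

theorem Tame.base (h : Tame θ R S w F) : Base θ R S w F := (h 0).base

theorem Tame.isDeriv (h : Tame θ R S w F) (j : Fin d) (t : T) :
    IsDeriv θ j (F t) (NCTorus.der θ j (F t)) := ((h 1).2 j).1 t

theorem Tame.der (h : Tame θ R S w F) (j : Fin d) :
    Tame θ R S w (fun t => NCTorus.der θ j (F t)) := fun N => ((h (N + 1)).2 j).2

theorem Tame.add (h : Tame θ R S w F) (k : Tame θ R S w G) :
    Tame θ R S w (fun t => F t + G t) := fun N => (h N).add (k N)

theorem Tame.smul (h : Tame θ R S w F) (c : ℂ) : Tame θ R S w (fun t => c • F t) :=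
  fun N => (h N).smul c

theorem Tame.mul (h : Tame θ R S w F) (k : Tame θ R S w' G) :
    Tame θ R S (fun t => w t * w' t) (fun t => F t * G t) := fun N => (h N).mul (k N)

theorem Tame.weight (h : Tame θ R S w F) (K : ℝ) (hw0 : ∀ t ∈ S, 0 ≤ w t)
    (hw : ∀ t ∈ S, w t ≤ K * w' t) : Tame θ R S w' F := fun N => (h N).weight K hw0 hw

theorem Tame.scalar (c : T → ℂ) (hc : (fun t => c t • (1 : Op d)) ∈ R) (C : ℝ)
    (hC : ∀ t ∈ S, ‖c t‖ ≤ C * w t) : Tame θ R S w (fun t => c t • (1 : Op d)) :=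
  fun _ => TameN.scalar c hc C hC

theorem Tame.zero : Tame θ R S w (fun _ => (0 : Op d)) := by
  have h := Tame.scalar (θ := θ) (R := R) (S := S) (w := w) (fun _ => 0)
    (by simp only [zero_smul]; exact R.zero_mem) 0 (by simp)
  simpa using h

theorem Tame.sum {ι : Type*} {s : Finset ι} {Φ : ι → T → Op d}
    (h : ∀ i ∈ s, Tame θ R S w (Φ i)) : Tame θ R S w (fun t => ∑ i ∈ s, Φ i t) := by
  classical
  induction s using Finset.induction_on with
  | empty => simpa using Tame.zero
  | insert a s ha ih =>
    simp only [Finset.sum_insert ha]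
    exact (h a (Finset.mem_insert_self a s)).add
      (ih fun i hi => h i (Finset.mem_insert_of_mem hi))

/-- Inverses of families of symbol type: by `δ(x⁻¹) = -x⁻¹ δ(x) x⁻¹`, only the inverse itself has to be estimated. -/
theorem Tame.inverse (h : Tame θ R S w F) (hR : (fun t => Ring.inverse (F t)) ∈ R) (C K : ℝ)
    (hC : ∀ t ∈ S, ‖Ring.inverse (F t)‖ ≤ C * w' t)
    (hw0 : ∀ t ∈ S, 0 ≤ w t) (hw0' : ∀ t ∈ S, 0 ≤ w' t)
    (hw : ∀ t ∈ S, w t * w' t ≤ K) : Tame θ R S w' (fun t => Ring.inverse (F t)) := fun N =>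
  (h N).inverse ⟨fun t => inverse_mem_LInfty θ (h.base.1 t), hR, C, hC⟩ K hw0 hw0' hw

/-- `C^∞` is stable under the derivations. -/
theorem smooth.der {x : Op d} (hx : x ∈ smooth θ) (j : Fin d) :
    IsDeriv θ j x (NCTorus.der θ j x) ∧ NCTorus.der θ j x ∈ smooth θ := by
  obtain ⟨y, hy, h⟩ := hx.2 (Pi.single j 1)
  have h1 : IsD j (x (vac d)) (y (vac d)) := fun n => by
    rw [h n]
    congr 1
    rw [Finset.prod_eq_single j (fun k _ hk => by simp [hk]) (by simp)]
    simp
  have h2 := isDeriv_of_vac hx.1 hy h1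
  rw [h2.der_eq]
  refine ⟨h2, hy, fun α => ?_⟩
  obtain ⟨u, hu, h3⟩ := hx.2 (α + Pi.single j 1)
  refine ⟨u, hu, fun n => ?_⟩
  rw [h3 n, h1 n, ← mul_assoc]
  congr 1
  simp only [Pi.add_apply, pow_add, Finset.prod_mul_distrib]
  congr 1
  rw [Finset.prod_eq_single j (fun k _ hk => by simp [hk]) (by simp)]
  simp

/-- The members of a family with derivatives of all orders belong to `C^∞`. -/
theorem Tame.mem_smooth (h : Tame θ R S w F) (t : T) : F t ∈ smooth θ := by
  refine ⟨h.base.1 t, fun α => ?_⟩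
  obtain ⟨N, hN⟩ : ∃ N, ∑ k, α k = N := ⟨_, rfl⟩
  induction N generalizing F α with
  | zero =>
    have hα : α = 0 := by
      funext k
      have := Finset.sum_eq_zero_iff.mp hN k (Finset.mem_univ k)
      simpa using this
    exact ⟨F t, h.base.1 t, fun n => by simp [hα]⟩
  | succ N ih =>
    obtain ⟨j, hj⟩ : ∃ j, α j ≠ 0 := by
      by_contra hc
      push Not at hc
      simp [hc] at hN
    obtain ⟨β, rfl⟩ : ∃ β : Fin d → ℕ, α = β + Pi.single j 1 := by
      refine ⟨α - Pi.single j 1, ?_⟩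
      funext k
      by_cases hk : k = j
      · subst hk
        simp only [Pi.add_apply, Pi.sub_apply, Pi.single_eq_same]
        omega
      · simp [hk]
    have hβ : ∑ k, β k = N := by
      simp only [Pi.add_apply, Finset.sum_add_distrib, Finset.sum_pi_single', Finset.mem_univ,
        if_true] at hN
      omega
    obtain ⟨y, hy, h1⟩ := ih (h.der j) β hβ
    refine ⟨y, hy, fun n => ?_⟩
    rw [h1 n, (h.isDeriv j t).isD_vac n, ← mul_assoc]
    congr 1
    simp only [Pi.add_apply, pow_add, Finset.prod_mul_distrib]
    congr 1
    rw [Finset.prod_eq_single j (fun k _ hk => by simp [hk]) (by simp)]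
    simp

theorem Tame.const (hR : ∀ x : Op d, (fun _ : T => x) ∈ R) {x : Op d} (hx : x ∈ smooth θ)
    (hw : ∀ t ∈ S, 1 ≤ w t) : Tame θ R S w (fun _ => x) := by
  intro N
  have hb : ∀ y ∈ smooth θ, Base θ R S w (fun _ => y) := fun y hy =>
    ⟨fun _ => hy.1, hR y, ‖y‖, fun t ht => by nlinarith [hw t ht, norm_nonneg y]⟩
  induction N generalizing x with
  | zero => exact hb x hx
  | succ N ih =>
    exact TameN.succ_of (hb x hx) fun j => ⟨_, fun _ => (smooth.der hx j).1, ih (smooth.der hx j).2⟩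

/-- Integrals of families with integrable weights belong to `C^∞`. -/
theorem Tame.integral_mem_smooth [MeasurableSpace T] {μ : MeasureTheory.Measure T}
    (hR : ∀ F ∈ R, MeasureTheory.AEStronglyMeasurable F μ) (hS : ∀ᵐ t ∂μ, t ∈ S)
    (hw : MeasureTheory.Integrable w μ) (h : Tame θ R S w F) :
    MeasureTheory.Integrable F μ ∧ (∫ t, F t ∂μ) ∈ smooth θ := by
  have hint : ∀ {G : T → Op d}, Base θ R S w G → MeasureTheory.Integrable G μ := by
    intro G hG
    obtain ⟨C, hC⟩ := hG.2.2
    refine (hw.const_mul C).mono' (hR G hG.2.1) ?_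
    filter_upwards [hS] with t ht using hC t ht
  refine ⟨hint h.base, ?_⟩
  -- a constant family over a point, so that the weights no longer matter
  have key : ∀ N (G : T → Op d), TameN θ R S N w G →
      TameN θ (⊤ : Subalgebra ℂ (Unit → Op d)) Set.univ N (fun _ => 1) (fun _ => ∫ t, G t ∂μ) := by
    intro N
    induction N with
    | zero =>
      intro G hG
      exact ⟨fun _ => integral_mem_LInfty θ hG.base.1 (hint hG.base), trivial,
        ‖∫ t, G t ∂μ‖, fun _ _ => by simp⟩
    | succ N ih =>
      intro G hG
      refine TameN.succ_of ⟨fun _ => integral_mem_LInfty θ hG.base.1 (hint hG.base), trivial,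
        ‖∫ t, G t ∂μ‖, fun _ _ => by simp⟩ fun j => ⟨_, fun _ => ?_, ih _ (hG.2 j).2⟩
      exact IsDeriv.integral (hG.2 j).1 (hint hG.base) (hint (hG.2 j).2.base)
  exact Tame.mem_smooth (F := fun _ : Unit => ∫ t, F t ∂μ) (fun N => key N F (h N)) ()

/-! ### The algebra of smooth elements -/

theorem smooth_tame {x : Op d} (hx : x ∈ smooth θ) :
    Tame θ (⊤ : Subalgebra ℂ (Unit → Op d)) Set.univ (fun _ => 1) (fun _ => x) :=
  Tame.const (fun _ => Algebra.mem_top) hx (fun _ _ => le_rfl)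

theorem smooth_mul {x y : Op d} (hx : x ∈ smooth θ) (hy : y ∈ smooth θ) : x * y ∈ smooth θ :=
  ((smooth_tame hx).mul (smooth_tame hy)).mem_smooth ()

theorem smooth_smul {x : Op d} (hx : x ∈ smooth θ) (c : ℂ) : c • x ∈ smooth θ :=
  ((smooth_tame hx).smul c).mem_smooth ()

theorem smooth_sum {ι : Type*} {s : Finset ι} {x : ι → Op d} (hx : ∀ i ∈ s, x i ∈ smooth θ) :
    ∑ i ∈ s, x i ∈ smooth θ :=
  (Tame.sum fun i hi => smooth_tame (hx i hi)).mem_smooth ()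

theorem smooth_smul_one (c : ℂ) : c • (1 : Op d) ∈ smooth θ :=
  (Tame.scalar (T := Unit) (R := ⊤) (S := Set.univ) (w := fun _ => 1) (fun _ => c)
    Algebra.mem_top ‖c‖ (fun _ _ => by simp)).mem_smooth ()

theorem smooth_inverse {x : Op d} (hx : x ∈ smooth θ) : Ring.inverse x ∈ smooth θ :=
  ((smooth_tame hx).inverse (w' := fun _ => 1) trivial ‖Ring.inverse x‖ 1 (fun _ _ => by simp)
    (fun _ _ => zero_le_one) (fun _ _ => zero_le_one) (fun _ _ => by simp)).mem_smooth ()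

end Families

/-! ### Ellipticity of the metric -/

section Forms

variable {d : ℕ}

/-- The sesquilinear form `∑ ⟨η_i, m_ij ζ_j⟩` of a matrix of operators. -/
def form (m : Fin d → Fin d → Op d) (η ζ : Fin d → L2 d) : ℂ :=
  ∑ i, ∑ j, inner ℂ (η i) (m i j (ζ j))

variable (m : Fin d → Fin d → Op d)

theorem form_add_left (η η' ζ : Fin d → L2 d) :
    form m (η + η') ζ = form m η ζ + form m η' ζ := by
  simp only [form, Pi.add_apply, inner_add_left, Finset.sum_add_distrib]

theorem form_add_right (η ζ ζ' : Fin d → L2 d) :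
    form m η (ζ + ζ') = form m η ζ + form m η ζ' := by
  simp only [form, Pi.add_apply, map_add, inner_add_right, Finset.sum_add_distrib]

theorem form_smul_left (c : ℂ) (η ζ : Fin d → L2 d) :
    form m (c • η) ζ = (starRingEnd ℂ) c * form m η ζ := by
  simp only [form, Pi.smul_apply, inner_smul_left, Finset.mul_sum]

theorem form_smul_right (c : ℂ) (η ζ : Fin d → L2 d) :
    form m η (c • ζ) = c * form m η ζ := by
  simp only [form, Pi.smul_apply, map_smul, inner_smul_right, Finset.mul_sum]

theorem norm_form_le {M : ℝ} (hM : ∀ i j, ‖m i j‖ ≤ M) (η ζ : Fin d → L2 d) :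
    ‖form m η ζ‖ ≤ M * ∑ i, ∑ j, ‖η i‖ * ‖ζ j‖ := by
  rw [form, Finset.mul_sum]
  refine norm_sum_le_of_le _ fun i _ => ?_
  rw [Finset.mul_sum]
  refine norm_sum_le_of_le _ fun j _ => ?_
  have hM0 : 0 ≤ M := (norm_nonneg _).trans (hM i j)
  calc ‖inner ℂ (η i) (m i j (ζ j))‖ ≤ ‖η i‖ * ‖m i j (ζ j)‖ := norm_inner_le_norm _ _
    _ ≤ ‖η i‖ * (M * ‖ζ j‖) := by
      gcongr
      exact (m i j).le_of_opNorm_le (hM i j) _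
    _ = _ := by ring

theorem norm_form_self_le {M : ℝ} (hM0 : 0 ≤ M) (hM : ∀ i j, ‖m i j‖ ≤ M) (ζ : Fin d → L2 d) :
    ‖form m ζ ζ‖ ≤ M * d * ∑ i, ‖ζ i‖ ^ 2 := by
  refine (norm_form_le m hM ζ ζ).trans ?_
  rw [mul_assoc]
  gcongr
  calc ∑ i, ∑ j, ‖ζ i‖ * ‖ζ j‖ ≤ ∑ i, ∑ j, (‖ζ i‖ ^ 2 / 2 + ‖ζ j‖ ^ 2 / 2) := by
        refine Finset.sum_le_sum fun i _ => Finset.sum_le_sum fun j _ => ?_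
        nlinarith [sq_nonneg (‖ζ i‖ - ‖ζ j‖)]
    _ = d * ∑ i, ‖ζ i‖ ^ 2 := by
        simp only [Finset.sum_add_distrib, Finset.sum_const, Finset.card_univ, Fintype.card_fin,
          nsmul_eq_mul, ← Finset.mul_sum, ← Finset.sum_div]
        ring

/-- The real part of a form with nonnegative quadratic form is symmetric. -/
theorem re_form_symm (h : ∀ ξ, 0 ≤ form m ξ ξ) (η ζ : Fin d → L2 d) :
    (form m η ζ).re = (form m ζ η).re := by
  have h1 := (Complex.le_def.mp (h (η + Complex.I • ζ))).2
  have h2 := (Complex.le_def.mp (h η)).2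
  have h3 := (Complex.le_def.mp (h ζ)).2
  simp only [form_add_left, form_add_right, form_smul_left, form_smul_right] at h1
  simp at h1 h2 h3
  linarith

/-- For a positive matrix `m`, the quantity `∑ ‖(m η)_i‖²` is controlled by the quadratic form. -/
theorem sum_sq_le_form (h : ∀ ξ, 0 ≤ form m ξ ξ) {G : ℝ} (hG : 0 < G)
    (hb : ∀ ζ, ‖form m ζ ζ‖ ≤ G * ∑ i, ‖ζ i‖ ^ 2) (η : Fin d → L2 d) :
    G⁻¹ * ∑ i, ‖∑ j, m i j (η j)‖ ^ 2 ≤ (form m η η).re := by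
  set ζ : Fin d → L2 d := fun i => ∑ j, m i j (η j) with hζ
  have h1 : (form m ζ η).re = ∑ i, ‖ζ i‖ ^ 2 := by
    have : form m ζ η = ∑ i, inner ℂ (ζ i) (ζ i) := by
      simp only [form, hζ, ← inner_sum]
    rw [this, Complex.re_sum]
    refine Finset.sum_congr rfl fun i _ => ?_
    rw [inner_self_eq_norm_sq_to_K]
    norm_cast
  -- test positivity on `η - G⁻¹ m η`
  have h2 := (Complex.le_def.mp (h (η + ((-G⁻¹ : ℝ) : ℂ) • ζ))).1
  simp only [form_add_left, form_add_right, form_smul_left, form_smul_right, Complex.conj_ofReal,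
    Complex.add_re, Complex.re_ofReal_mul, Complex.zero_re] at h2
  rw [re_form_symm m h η ζ, h1] at h2
  have h3 : (form m ζ ζ).re ≤ G * ∑ i, ‖ζ i‖ ^ 2 := (Complex.re_le_norm _).trans (hb ζ)
  have h4 : G⁻¹ * (G⁻¹ * (form m ζ ζ).re) ≤ G⁻¹ * (G⁻¹ * (G * ∑ i, ‖ζ i‖ ^ 2)) := by gcongr
  rw [inv_mul_cancel_left₀ hG.ne'] at h4
  linarith

variable {θ : Matrix (Fin d) (Fin d) ℝ} {g : (Matrix (Fin d) (Fin d) (Op d))ˣ}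

/-- The inverse metric is bounded below: `∑ ⟨ξ_i, (g⁻¹)_ij ξ_j⟩ ≥ c ∑ ‖ξ_i‖²`. -/
theorem IsRiemannianMetric.elliptic (hg : IsRiemannianMetric θ g) :
    ∃ c : ℝ, 0 < c ∧ ∀ ξ : Fin d → L2 d,
      c * ∑ i, ‖ξ i‖ ^ 2 ≤ (form (fun i j => g.inv i j) ξ ξ).re ∧
        (form (fun i j => g.inv i j) ξ ξ).im = 0 := by
  have hpos : ∀ ξ, 0 ≤ form (fun i j => g.val i j) ξ ξ := hg.nonneg
  set M : ℝ := ∑ i, ∑ j, ‖g.val i j‖ with hM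
  have hM1 : ∀ i j, ‖g.val i j‖ ≤ M := fun i j =>
    (Finset.single_le_sum (f := fun j => ‖g.val i j‖) (fun _ _ => norm_nonneg _)
      (Finset.mem_univ j)).trans (Finset.single_le_sum (f := fun i => ∑ j, ‖g.val i j‖)
        (fun _ _ => Finset.sum_nonneg fun _ _ => norm_nonneg _) (Finset.mem_univ i))
  have hM0 : 0 ≤ M := Finset.sum_nonneg fun _ _ => Finset.sum_nonneg fun _ _ => norm_nonneg _
  have hG : 0 < M * d + 1 := by positivity
  refine ⟨(M * d + 1)⁻¹, inv_pos.mpr hG, fun ξ => ?_⟩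
  set η : Fin d → L2 d := fun i => ∑ j, g.inv i j (ξ j) with hη
  have h1 : ∀ i, ∑ j, g.val i j (η j) = ξ i := fun i => by
    have h2 : ∀ k, (∑ j, g.val i j * g.inv j k) = if i = k then 1 else 0 := fun k => by
      have := congrFun (congrFun g.val_inv i) k
      rwa [Matrix.mul_apply, Matrix.one_apply] at this
    calc ∑ j, g.val i j (η j) = ∑ k, (∑ j, g.val i j * g.inv j k) (ξ k) := by
          simp only [hη, map_sum, sum_apply]
          exact Finset.sum_comm
      _ = ξ i := by
          simp only [h2]
          rw [Finset.sum_eq_single i (fun k _ hk => by simp [Ne.symm hk]) (by simp)]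
          simp
  have h2 := sum_sq_le_form _ hpos hG (fun ζ => (norm_form_self_le _ hM0 hM1 ζ).trans (by
    have : 0 ≤ ∑ i, ‖ζ i‖ ^ 2 := Finset.sum_nonneg fun _ _ => sq_nonneg _
    nlinarith)) η
  have h3 : form (fun i j => g.inv i j) ξ ξ
      = (starRingEnd ℂ) (form (fun i j => g.val i j) η η) := by
    have e1 : form (fun i j => g.inv i j) ξ ξ = ∑ i, inner ℂ (ξ i) (η i) := by
      simp only [form, hη, ← inner_sum]
    have e2 : form (fun i j => g.val i j) η η = ∑ i, inner ℂ (η i) (ξ i) := by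
      simp only [form, ← inner_sum, h1]
    rw [e1, e2, map_sum]
    simp
  rw [h3]
  simp only [h1] at h2
  refine ⟨by simpa using h2, ?_⟩
  have := (Complex.le_def.mp (hpos η)).2
  simp at this ⊢
  exact this.symm

end Forms

/-! ### Coercive operators -/

section Coercive

variable {d : ℕ}

/-- The Lax–Milgram lemma, with the bound for the inverse. -/
theorem isUnit_of_coercive {a : Op d} {c : ℝ} (hc : 0 < c)
    (h : ∀ ξ, c * ‖ξ‖ ^ 2 ≤ ‖inner ℂ ξ (a ξ)‖) : IsUnit a ∧ ‖Ring.inverse a‖ ≤ c⁻¹ := by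
  have hu : IsUnit a :=
    ContinuousLinearMap.isUnit_of_forall_le_norm_inner_map a (c := ⟨c, hc.le⟩) hc fun ξ => by
      rw [norm_inner_symm, mul_comm]
      exact h ξ
  refine ⟨hu, ContinuousLinearMap.opNorm_le_bound _ (by positivity) fun ξ => ?_⟩
  have h1 : a (Ring.inverse a ξ) = ξ :=
    congrArg (fun T : Op d => T ξ) (Ring.mul_inverse_cancel a hu)
  set η := Ring.inverse a ξ
  have h2 := (h η).trans (norm_inner_le_norm _ _)
  rw [h1] at h2
  rw [inv_mul_eq_div, le_div_iff₀ hc]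
  by_cases h0 : ‖η‖ = 0
  · rw [h0, zero_mul]; exact norm_nonneg _
  · have h3 : 0 < ‖η‖ := lt_of_le_of_ne (norm_nonneg _) (Ne.symm h0)
    refine le_of_mul_le_mul_left ?_ h3
    calc ‖η‖ * (‖η‖ * c) = c * ‖η‖ ^ 2 := by ring
      _ ≤ _ := h2

theorem slitPlane_pos {z : ℂ} (hz : z ∈ Complex.slitPlane) : 0 < ‖z‖ + z.re := by
  rcases hz with h | h
  · have := norm_nonneg z; linarith
  · have h1 : |z.re| < ‖z‖ := by
      rw [Complex.abs_re_lt_norm]; exact h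
    linarith [neg_abs_le z.re]

theorem norm_add_mul_ge_slit {z : ℂ} (hz : z ∈ Complex.slitPlane) {a N : ℝ} (ha : 0 ≤ a) :
    (‖z‖ + z.re) / 2 * N ≤ ‖(a : ℂ) + z * N‖ := by
  have h0 : z ≠ 0 := Complex.slitPlane_ne_zero hz
  have hz0 : 0 < ‖z‖ := norm_pos_iff.mpr h0
  have hp := slitPlane_pos hz
  -- rotate by `1 + conj z / |z|`, which moves both `1` and `z` into the right half plane
  set ω : ℂ := 1 + (starRingEnd ℂ) z / ‖z‖ with hω
  have hω2 : ‖ω‖ ≤ 2 := by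
    refine (norm_add_le _ _).trans ?_
    rw [norm_one, norm_div, RCLike.norm_conj, Complex.norm_real, norm_norm, div_self hz0.ne']
    norm_num
  have h1 : (ω * ((a : ℂ) + z * N)).re = a * (1 + z.re / ‖z‖) + (‖z‖ + z.re) * N := by
    have h2 : ω * z = z + ‖z‖ := by
      rw [hω, add_mul, one_mul, div_mul_eq_mul_div, mul_comm _ z, Complex.mul_conj,
        Complex.normSq_eq_norm_sq]
      push_cast
      field_simp
    have h3 : ω * ((a : ℂ) + z * N) = a * ω + (z + ‖z‖) * N := by
      rw [← h2]; ring
    have h4 : ω.re = 1 + z.re / ‖z‖ := by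
      simp [hω, Complex.div_ofReal_re]
    rw [h3, Complex.add_re, Complex.re_ofReal_mul, h4, Complex.re_mul_ofReal]
    simp [add_comm]
  have h2 := (Complex.re_le_norm (ω * ((a : ℂ) + z * N)))
  rw [h1, norm_mul] at h2
  have h3 : 0 ≤ 1 + z.re / ‖z‖ := by
    rw [← div_self hz0.ne', ← add_div]; positivity
  have h4 : ‖ω‖ * ‖(a : ℂ) + z * N‖ ≤ 2 * ‖(a : ℂ) + z * N‖ := by gcongr
  nlinarith [mul_nonneg ha h3]

theorem norm_add_mul_ge_half {z : ℂ} (hz : 0 ≤ z.re) {a N : ℝ} (ha : 0 ≤ a)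
    (hN : 0 ≤ N) : (a + ‖z‖ * N) / 2 ≤ ‖(a : ℂ) + z * N‖ ∧ ‖z‖ * N ≤ ‖(a : ℂ) + z * N‖ := by
  have h1 : ‖(a : ℂ) + z * N‖ ^ 2 = a ^ 2 + 2 * a * (z.re * N) + ‖z‖ ^ 2 * N ^ 2 := by
    rw [← Complex.normSq_eq_norm_sq, ← Complex.normSq_eq_norm_sq, Complex.normSq_apply,
      Complex.normSq_apply]
    simp
    ring
  have h2 : 0 ≤ 2 * a * (z.re * N) := by positivity
  have h3 := norm_nonneg ((a : ℂ) + z * N)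
  have h4 : 0 ≤ ‖z‖ * N := by positivity
  constructor
  · refine le_of_sq_le_sq ?_ h3
    nlinarith [sq_nonneg (a - ‖z‖ * N)]
  · refine le_of_sq_le_sq ?_ h3
    nlinarith [sq_nonneg a]

end Coercive

/-! ### The quadratic `x(s)` and its resolvent -/

section Quadratic

variable {d : ℕ} {θ : Matrix (Fin d) (Fin d) ℝ} {g : (Matrix (Fin d) (Fin d) (Op d))ˣ}

/-- The square `|s|²` of the Euclidean length of `s ∈ ℝ^d`. -/
def lenSq (s : Fin d → ℝ) : ℝ := ∑ i, s i ^ 2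

theorem lenSq_nonneg (s : Fin d → ℝ) : 0 ≤ lenSq s := Finset.sum_nonneg fun _ _ => sq_nonneg _

theorem sq_le_lenSq (s : Fin d → ℝ) (i : Fin d) : s i ^ 2 ≤ lenSq s :=
  Finset.single_le_sum (f := fun i => s i ^ 2) (fun _ _ => sq_nonneg _) (Finset.mem_univ i)

theorem abs_mul_le_lenSq (s : Fin d → ℝ) (i j : Fin d) : |s i * s j| ≤ lenSq s := by
  rw [abs_mul]
  nlinarith [sq_le_lenSq s i, sq_le_lenSq s j, sq_abs (s i), sq_abs (s j),
    sq_nonneg (|s i| - |s j|)]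

theorem inner_xs (s : Fin d → ℝ) (ξ : L2 d) :
    inner ℂ ξ (xs g s ξ) = form (fun i j => g.inv i j) (fun i => (s i : ℂ) • ξ)
      (fun i => (s i : ℂ) • ξ) := by
  simp only [xs, form, sum_apply, inner_sum]
  refine Finset.sum_congr rfl fun i _ => Finset.sum_congr rfl fun j _ => ?_
  rw [map_smul, inner_smul_left, inner_smul_right, smul_apply, inner_smul_right,
    Complex.conj_ofReal]
  push_cast
  ring

theorem IsRiemannianMetric.inner_xs_ge (hg : IsRiemannianMetric θ g) :
    ∃ c : ℝ, 0 < c ∧ ∀ (s : Fin d → ℝ) (ξ : L2 d),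
      ∃ a : ℝ, inner ℂ ξ (xs g s ξ) = (a : ℂ) ∧ c * lenSq s * ‖ξ‖ ^ 2 ≤ a := by
  obtain ⟨c, hc, h⟩ := hg.elliptic
  refine ⟨c, hc, fun s ξ => ⟨(inner ℂ ξ (xs g s ξ) : ℂ).re, ?_, ?_⟩⟩
  · rw [inner_xs]
    apply Complex.ext
    · simp
    · simpa using (h _).2
  · rw [inner_xs]
    refine le_trans (le_of_eq ?_) (h _).1
    simp only [norm_smul, mul_pow, ← Finset.sum_mul, lenSq, Complex.norm_real, Real.norm_eq_abs,
      sq_abs]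
    ring

theorem isSelfAdjoint_xs (hg : IsRiemannianMetric θ g) (s : Fin d → ℝ) :
    IsSelfAdjoint (xs g s) := by
  refine isSelfAdjoint_sum _ fun i _ => isSelfAdjoint_sum _ fun j _ => ?_
  refine IsSelfAdjoint.smul ?_ (hg.selfAdjoint_inv_entry i j)
  rw [isSelfAdjoint_iff, Complex.star_def, Complex.conj_ofReal]

variable (g) in
/-- A bound for `x(s)` on the unit sphere. -/
def xsBound : ℝ := ∑ i, ∑ j, ‖g.inv i j‖

theorem norm_xs_le (s : Fin d → ℝ) : ‖xs g s‖ ≤ xsBound g * lenSq s := by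
  rw [xs, xsBound, Finset.sum_mul]
  refine norm_sum_le_of_le _ fun i _ => ?_
  rw [Finset.sum_mul]
  refine norm_sum_le_of_le _ fun j _ => ?_
  rw [norm_smul, Complex.norm_real, Real.norm_eq_abs, mul_comm]
  exact mul_le_mul_of_nonneg_left (abs_mul_le_lenSq s i j) (norm_nonneg _)

theorem inner_smul_one_apply (z : ℂ) (a : Op d) (ξ : L2 d) :
    inner ℂ ξ ((a + z • (1 : Op d)) ξ) = inner ℂ ξ (a ξ) + z * ((‖ξ‖ ^ 2 : ℝ) : ℂ) := by
  change inner ℂ ξ (a ξ + z • ξ) = _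
  rw [inner_add_right, inner_smul_right, inner_self_eq_norm_sq_to_K]
  norm_cast

theorem isUnit_xs_add (hg : IsRiemannianMetric θ g) (s : Fin d → ℝ) {z : ℂ}
    (hz : z ∈ Complex.slitPlane) : IsUnit (xs g s + z • (1 : Op d)) := by
  obtain ⟨c, hc, h⟩ := hg.inner_xs_ge
  have hp := slitPlane_pos hz
  refine (isUnit_of_coercive (c := (‖z‖ + z.re) / 2) (by positivity) fun ξ => ?_).1
  obtain ⟨a, ha, hl⟩ := h s ξ
  rw [inner_smul_one_apply, ha]
  have h0 := lenSq_nonneg s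
  exact norm_add_mul_ge_slit hz (le_trans (by positivity) hl)

theorem norm_xInv_le (hg : IsRiemannianMetric θ g) : ∃ C : ℝ, 0 < C ∧
    ∀ (s : Fin d → ℝ) (z : ℂ), z ≠ 0 → 0 ≤ z.re →
      ‖xInv g s z‖ ≤ C * (lenSq s + ‖z‖)⁻¹ := by
  obtain ⟨c, hc, h⟩ := hg.inner_xs_ge
  have hm : 0 < min c 1 / 2 := by positivity
  refine ⟨(min c 1 / 2)⁻¹, inv_pos.mpr hm, fun s z hz hre => ?_⟩
  have h0 := lenSq_nonneg s
  have hz0 : 0 < ‖z‖ := norm_pos_iff.mpr hz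
  rw [← mul_inv]
  refine (isUnit_of_coercive (c := min c 1 / 2 * (lenSq s + ‖z‖)) (by positivity) fun ξ => ?_).2
  obtain ⟨a, ha, hl⟩ := h s ξ
  rw [inner_smul_one_apply, ha]
  have ha0 : 0 ≤ a := le_trans (by positivity) hl
  refine le_trans ?_ (norm_add_mul_ge_half hre ha0 (sq_nonneg ‖ξ‖)).1
  have h1 : min c 1 * (lenSq s * ‖ξ‖ ^ 2) ≤ c * (lenSq s * ‖ξ‖ ^ 2) := by
    gcongr; exact min_le_left _ _
  have h2 : min c 1 * (‖z‖ * ‖ξ‖ ^ 2) ≤ 1 * (‖z‖ * ‖ξ‖ ^ 2) := by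
    gcongr; exact min_le_right _ _
  nlinarith

variable {T : Type*} {R : Subalgebra ℂ (T → Op d)} {S : Set T}

/-- `x(s) + z` as a family of symbols of order two. -/
theorem tame_xs_add (hg : IsRiemannianMetric θ g) (hR : ∀ x : Op d, (fun _ : T => x) ∈ R)
    (s : T → Fin d → ℝ) (z : T → ℂ)
    (hs : ∀ i, (fun t => (s t i : ℂ) • (1 : Op d)) ∈ R) (hz : (fun t => z t • (1 : Op d)) ∈ R)
    {w : T → ℝ} (hw : ∀ t ∈ S, lenSq (s t) + ‖z t‖ ≤ w t) :
    Tame θ R S w (fun t => xs g (s t) + z t • (1 : Op d)) := by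
  refine Tame.add ?_ (Tame.scalar z hz 1 fun t ht => ?_)
  · simp only [xs]
    refine Tame.sum fun i _ => Tame.sum fun j _ => ?_
    have h1 : (fun t => ((s t i * s t j : ℝ) : ℂ) • (1 : Op d)) ∈ R := by
      have := R.mul_mem (hs i) (hs j)
      convert this using 1
      funext t
      change _ = ((s t i : ℂ) • (1 : Op d)) * ((s t j : ℂ) • (1 : Op d))
      rw [smul_mul_smul_comm, one_mul, Complex.ofReal_mul]
    have h2 := (Tame.scalar (θ := θ) (S := S) (w := w) _ h1 1 (fun t ht => by
      rw [Complex.norm_real, Real.norm_eq_abs, one_mul]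
      exact (abs_mul_le_lenSq _ i j).trans
        ((le_add_of_nonneg_right (norm_nonneg _)).trans (hw t ht)))).mul
      (Tame.const (S := S) (w := fun _ => 1) hR (hg.smooth_inv_entry i j) fun _ _ => le_rfl)
    simpa using h2
  · rw [one_mul]
    exact (le_add_of_nonneg_left (lenSq_nonneg _)).trans (hw t ht)

end Quadratic

/-! ### Lower bounds for self-adjoint operators -/

section LowerBound

variable {d : ℕ}

/-- The operator inequality `c ≤ a`, through quadratic forms. -/
def LowerBound (a : Op d) (c : ℝ) : Prop :=
  ∀ ξ, ∃ b : ℝ, inner ℂ ξ (a ξ) = (b : ℂ) ∧ c * ‖ξ‖ ^ 2 ≤ b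

theorem LowerBound.nonneg {a : Op d} {c : ℝ} (hc : 0 ≤ c) (h : LowerBound a c) : 0 ≤ a := by
  rw [ContinuousLinearMap.nonneg_iff_isPositive, ContinuousLinearMap.isPositive_iff_complex]
  intro ξ
  obtain ⟨b, hb, hl⟩ := h ξ
  have h1 : inner ℂ (a ξ) ξ = (b : ℂ) := by
    rw [← inner_conj_symm, hb, Complex.conj_ofReal]
  rw [h1]
  have h2 : 0 ≤ b := le_trans (by positivity) hl
  exact ⟨by simp, by simpa using h2⟩

theorem LowerBound.isUnit {a : Op d} {c : ℝ} (hc : 0 < c) (h : LowerBound a c) : IsUnit a :=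
  (isUnit_of_coercive hc fun ξ => by
    obtain ⟨b, hb, hl⟩ := h ξ
    rw [hb, Complex.norm_real]
    exact hl.trans (Real.le_norm_self b)).1

theorem LowerBound.le_spectrum {a : Op d} {c : ℝ} (h : LowerBound a c) {r : ℝ}
    (hr : r ∈ spectrum ℝ a) : c ≤ r := by
  by_contra hlt
  push Not at hlt
  rw [spectrum.mem_iff, IsUnit.sub_iff] at hr
  refine hr (LowerBound.isUnit (c := c - r) (by linarith) fun ξ => ?_)
  obtain ⟨b, hb, hl⟩ := h ξ
  refine ⟨b - r * ‖ξ‖ ^ 2, ?_, by linarith⟩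
  change inner ℂ ξ (a ξ - (r : ℂ) • ξ) = _
  rw [inner_sub_right, hb, inner_smul_right, inner_self_eq_norm_sq_to_K]
  push_cast
  rfl

theorem lowerBound_cfc {a : Op d} (ha : IsSelfAdjoint a) {f : ℝ → ℝ} (hf : Continuous f) {c : ℝ}
    (h : ∀ r ∈ spectrum ℝ a, c ≤ f r) : LowerBound (cfc f a) c := by
  have h1 := algebraMap_le_cfc f c a h hf.continuousOn ha
  rw [ContinuousLinearMap.le_def, ContinuousLinearMap.isPositive_iff_complex] at h1
  intro ξ
  have h2 := h1 ξ
  have h3 : inner ℂ ((cfc f a - algebraMap ℝ (Op d) c) ξ) ξ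
      = inner ℂ (cfc f a ξ) ξ - ((c * ‖ξ‖ ^ 2 : ℝ) : ℂ) := by
    change inner ℂ (cfc f a ξ - (c : ℂ) • ξ) ξ = _
    rw [inner_sub_left, inner_smul_left, inner_self_eq_norm_sq_to_K, Complex.conj_ofReal]
    push_cast
    rfl
  rw [h3] at h2
  simp only [map_sub, RCLike.re_to_complex, Complex.ofReal_re] at h2
  refine ⟨(inner ℂ (cfc f a ξ) ξ).re, ?_, by linarith [h2.2]⟩
  have h4 : inner ℂ (cfc f a ξ) ξ = (((inner ℂ (cfc f a ξ) ξ).re : ℝ) : ℂ) := by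
    have := h2.1
    push_cast at this
    linear_combination -this
  rw [← inner_conj_symm, h4, Complex.conj_ofReal]
  simp

end LowerBound

/-! ### The determinant `ν` -/

section Determinant

variable {d : ℕ} {θ : Matrix (Fin d) (Fin d) ℝ} {g : (Matrix (Fin d) (Fin d) (Op d))ˣ}

theorem nuIntegrand_eq_cfc (hg : IsRiemannianMetric θ g) (t : Fin d → ℝ) :
    nuIntegrand g t = cfc (fun r : ℝ => Real.exp (-r)) (xs g t) := by
  have hs := isSelfAdjoint_xs hg t
  rw [nuIntegrand, cfc_comp_neg (fun r => Real.exp r) (xs g t)]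
  exact (CFC.real_exp_eq_normedSpace_exp hs.neg).symm

theorem continuous_xs : Continuous (xs g) := by
  unfold xs
  fun_prop

theorem continuous_nuIntegrand : Continuous (nuIntegrand g) := by
  let _ : NormedAlgebra ℚ (Op d) := NormedAlgebra.restrictScalars ℚ ℂ (Op d)
  unfold nuIntegrand
  exact NormedSpace.exp_continuous.comp continuous_xs.neg

theorem IsRiemannianMetric.spectrum_xs (hg : IsRiemannianMetric θ g) :
    ∃ c : ℝ, 0 < c ∧ ∀ (s : Fin d → ℝ), ∀ r ∈ spectrum ℝ (xs g s),
      c * lenSq s ≤ r ∧ r ≤ xsBound g * lenSq s := by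
  obtain ⟨c, hc, h⟩ := hg.inner_xs_ge
  refine ⟨c, hc, fun s r hr => ⟨LowerBound.le_spectrum (h s) hr, ?_⟩⟩
  have h1 := spectrum.norm_le_norm_mul_of_mem hr
  have h2 : ‖(1 : Op d)‖ ≤ 1 := ContinuousLinearMap.norm_id_le
  have h3 := norm_xs_le (g := g) s
  have h4 := Real.le_norm_self r
  nlinarith [norm_nonneg (xs g s)]

theorem integrable_exp_neg_mul_lenSq {c : ℝ} (hc : 0 < c) :
    MeasureTheory.Integrable (fun t : Fin d → ℝ => Real.exp (-(c * lenSq t))) := by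
  have h := MeasureTheory.Integrable.fintype_prod (ι := Fin d) (𝕜 := ℝ)
    (f := fun _ x => Real.exp (-c * x ^ 2)) (μ := fun _ => MeasureTheory.volume)
    (fun _ => integrable_exp_neg_mul_sq hc)
  refine h.congr (Filter.Eventually.of_forall fun t => ?_)
  change ∏ i, Real.exp (-c * t i ^ 2) = _
  rw [← Real.exp_sum, ← Finset.mul_sum, neg_mul]
  rfl

theorem norm_nuIntegrand_le (hg : IsRiemannianMetric θ g) : ∃ c : ℝ, 0 < c ∧ ∀ t : Fin d → ℝ,
    ‖nuIntegrand g t‖ ≤ Real.exp (-(c * lenSq t)) := by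
  obtain ⟨c, hc, h⟩ := hg.spectrum_xs
  refine ⟨c, hc, fun t => ?_⟩
  rw [nuIntegrand_eq_cfc hg]
  refine norm_cfc_le (Real.exp_pos _).le fun r hr => ?_
  rw [Real.norm_of_nonneg (Real.exp_pos _).le]
  exact Real.exp_le_exp.mpr (neg_le_neg (h t r hr).1)

theorem integrable_nuIntegrand (hg : IsRiemannianMetric θ g) :
    MeasureTheory.Integrable (nuIntegrand g) := by
  obtain ⟨c, hc, h⟩ := norm_nuIntegrand_le hg
  have : SecondCountableTopologyEither (Fin d → ℝ) (Op d) :=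
    secondCountableTopologyEither_of_left _ _
  exact (integrable_exp_neg_mul_lenSq hc).mono' continuous_nuIntegrand.aestronglyMeasurable
    (Filter.Eventually.of_forall h)

theorem lowerBound_nu (hg : IsRiemannianMetric θ g) : ∃ c : ℝ, 0 < c ∧ LowerBound (nu g) c := by
  obtain ⟨c, hc, h⟩ := hg.spectrum_xs
  set K : ℝ := xsBound g + 1 with hK
  have hK0 : 0 < K := by
    have : 0 ≤ xsBound g :=
      Finset.sum_nonneg fun _ _ => Finset.sum_nonneg fun _ _ => norm_nonneg _
    positivity
  have hlow : ∀ t, LowerBound (nuIntegrand g t) (Real.exp (-(K * lenSq t))) := fun t => by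
    rw [nuIntegrand_eq_cfc hg]
    refine lowerBound_cfc (isSelfAdjoint_xs hg t) (by fun_prop) fun r hr => ?_
    refine Real.exp_le_exp.mpr (neg_le_neg ((h t r hr).2.trans ?_))
    have := lenSq_nonneg t
    nlinarith
  have hint := integrable_exp_neg_mul_lenSq (d := d) hK0
  have hI : 0 < ∫ t : Fin d → ℝ, Real.exp (-(K * lenSq t)) := by
    rw [MeasureTheory.integral_pos_iff_support_of_nonneg (fun t => (Real.exp_pos _).le) hint]
    have : Function.support (fun t : Fin d → ℝ => Real.exp (-(K * lenSq t))) = Set.univ := by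
      ext t; simp [Real.exp_ne_zero]
    rw [this]
    exact isOpen_univ.measure_pos _ ⟨0, trivial⟩
  have hp : 0 < Real.pi ^ (-(d : ℝ) / 2) := Real.rpow_pos_of_pos Real.pi_pos _
  refine ⟨Real.pi ^ (-(d : ℝ) / 2) * ∫ t : Fin d → ℝ, Real.exp (-(K * lenSq t)), by positivity,
    fun ξ => ?_⟩
  choose b hb hl using fun t => hlow t ξ
  have hL := ((innerSL ℂ ξ).comp
    (ContinuousLinearMap.apply ℂ (L2 d) ξ)).integral_comp_comm (integrable_nuIntegrand hg)
  have hLi := ((innerSL ℂ ξ).comp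
    (ContinuousLinearMap.apply ℂ (L2 d) ξ)).integrable_comp (integrable_nuIntegrand hg)
  simp only [ContinuousLinearMap.comp_apply, ContinuousLinearMap.apply_apply,
    innerSL_apply_apply, hb] at hL hLi
  have hbi : MeasureTheory.Integrable b := by
    simpa using hLi.re
  refine ⟨Real.pi ^ (-(d : ℝ) / 2) * ∫ t, b t, ?_, ?_⟩
  · rw [nu, smul_apply, inner_smul_right, ← hL, integral_complex_ofReal]
    push_cast
    rfl
  · rw [mul_assoc]
    refine mul_le_mul_of_nonneg_left ?_ hp.le
    rw [← MeasureTheory.integral_mul_const]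
    exact MeasureTheory.integral_mono (hint.mul_const _) hbi hl

theorem nu_nonneg (hg : IsRiemannianMetric θ g) : 0 ≤ nu g := by
  obtain ⟨c, hc, h⟩ := lowerBound_nu hg
  exact h.nonneg hc.le

theorem isUnit_nu (hg : IsRiemannianMetric θ g) : IsUnit (nu g) := by
  obtain ⟨c, hc, h⟩ := lowerBound_nu hg
  exact h.isUnit hc

theorem norm_sq_le_lenSq (t : Fin d → ℝ) : ‖t‖ ^ 2 ≤ lenSq t := by
  have h : ‖t‖ ≤ Real.sqrt (lenSq t) := by
    rw [pi_norm_le_iff_of_nonneg (Real.sqrt_nonneg _)]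
    intro i
    rw [Real.norm_eq_abs]
    exact Real.abs_le_sqrt (sq_le_lenSq t i)
  calc ‖t‖ ^ 2 ≤ Real.sqrt (lenSq t) ^ 2 := by gcongr
    _ = lenSq t := Real.sq_sqrt (lenSq_nonneg t)

theorem continuous_lenSq : Continuous (lenSq (d := d)) := by
  unfold lenSq
  fun_prop

theorem integrable_inv_one_add_lenSq_pow {c : ℝ} (hc : 0 < c) :
    MeasureTheory.Integrable (fun t : Fin d → ℝ => (1 + c * lenSq t)⁻¹ ^ (d + 1)) := by
  have h := integrable_rpow_neg_one_add_norm_sq (E := Fin d → ℝ) (μ := MeasureTheory.volume)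
    (r := 2 * (d + 1)) (by simp; linarith)
  set m : ℝ := min c 1 with hm
  have hm0 : 0 < m := lt_min hc one_pos
  refine (h.const_mul (m⁻¹ ^ (d + 1))).mono' ?_ (Filter.Eventually.of_forall fun t => ?_)
  · refine Continuous.aestronglyMeasurable ?_
    have : ∀ t : Fin d → ℝ, 1 + c * lenSq t ≠ 0 := fun t => by
      have := lenSq_nonneg t; positivity
    exact ((continuous_const.add (continuous_const.mul continuous_lenSq)).inv₀ this).pow _
  · have h0 := lenSq_nonneg t
    rw [Real.norm_of_nonneg (by positivity)]
    have h1 : (1 + ‖t‖ ^ 2 : ℝ) ^ (-(2 * ((d : ℝ) + 1)) / 2) = (1 + ‖t‖ ^ 2)⁻¹ ^ (d + 1) := by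
      have h2 : -(2 * ((d : ℝ) + 1)) / 2 = -((d + 1 : ℕ) : ℝ) := by push_cast; ring
      rw [h2, Real.rpow_neg (by positivity), Real.rpow_natCast, inv_pow]
    rw [h1, ← mul_pow, ← mul_inv]
    gcongr
    have h3 := norm_sq_le_lenSq t
    have h4 : m ≤ c := min_le_left _ _
    have h5 : m ≤ 1 := min_le_right _ _
    have h6 : m * ‖t‖ ^ 2 ≤ c * lenSq t := by gcongr
    nlinarith

end Determinant

/-! ### Smoothness of `ν` and of its square root -/

/-! ### Smoothness of `ν` and of its powers -/

section Smoothness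

variable {d : ℕ} {θ : Matrix (Fin d) (Fin d) ℝ} {g : (Matrix (Fin d) (Fin d) (Op d))ˣ}

theorem real_smul_eq (r : ℝ) (x : Op d) : r • x = (r : ℂ) • x := rfl

/-- The algebra of almost everywhere strongly measurable families. -/
def measurableFamilies {T : Type*} [MeasurableSpace T] (μ : MeasureTheory.Measure T) (d : ℕ) :
    Subalgebra ℂ (T → Op d) where
  carrier := {F | MeasureTheory.AEStronglyMeasurable F μ}
  mul_mem' := fun h k => MeasureTheory.AEStronglyMeasurable.mul h k
  add_mem' := fun h k => MeasureTheory.AEStronglyMeasurable.add h k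
  algebraMap_mem' := fun _ => MeasureTheory.aestronglyMeasurable_const

theorem xs_smul (r : ℝ) (t : Fin d → ℝ) : xs g (r • t) = ((r ^ 2 : ℝ) : ℂ) • xs g t := by
  simp only [xs, Finset.smul_sum, smul_smul, Pi.smul_apply, smul_eq_mul]
  refine Finset.sum_congr rfl fun i _ => Finset.sum_congr rfl fun j _ => ?_
  congr 1
  push_cast
  ring

theorem lenSq_smul (r : ℝ) (t : Fin d → ℝ) : lenSq (r • t) = r ^ 2 * lenSq t := by
  simp only [lenSq, Pi.smul_apply, smul_eq_mul, mul_pow, Finset.mul_sum]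

theorem nuIntegrand_sqrt_smul (hg : IsRiemannianMetric θ g) {u : ℝ} (hu : 0 ≤ u)
    (t : Fin d → ℝ) :
    nuIntegrand g (Real.sqrt u • t) = cfc (fun r : ℝ => Real.exp (-(u * r))) (xs g t) := by
  rw [nuIntegrand_eq_cfc hg, xs_smul, Real.sq_sqrt hu]
  have := cfc_comp_smul (R := ℝ) u (fun r => Real.exp (-r)) (xs g t) (by fun_prop)
    (isSelfAdjoint_xs hg t)
  simp only [smul_eq_mul] at this
  rw [this]
  rfl

theorem integrableOn_pow_mul_exp :
    MeasureTheory.IntegrableOn (fun u : ℝ => u ^ d * Real.exp (-u)) (Set.Ioi 0) := by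
  have h := Real.GammaIntegral_convergent (s := (d : ℝ) + 1) (by positivity)
  refine h.congr_fun (fun u _ => ?_) measurableSet_Ioi
  change Real.exp (-u) * u ^ ((d : ℝ) + 1 - 1) = _
  rw [add_sub_cancel_right, Real.rpow_natCast, mul_comm]

theorem integral_pow_mul_exp_mul {r : ℝ} (hr : 0 ≤ r) :
    ∫ u in Set.Ioi (0 : ℝ), u ^ d * Real.exp (-u) * Real.exp (-(u * r))
      = (1 + r)⁻¹ ^ (d + 1) * Real.Gamma (d + 1) := by
  have h := Real.integral_rpow_mul_exp_neg_mul_Ioi (a := (d : ℝ) + 1) (r := 1 + r)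
    (by positivity) (by positivity)
  have h1 : (1 / (1 + r)) ^ ((d : ℝ) + 1) = (1 + r)⁻¹ ^ (d + 1) := by
    rw [one_div, ← Real.rpow_natCast]
    push_cast
    rfl
  rw [h1] at h
  rw [← h]
  refine MeasureTheory.setIntegral_congr_fun measurableSet_Ioi fun u _ => ?_
  rw [add_sub_cancel_right, Real.rpow_natCast, mul_assoc, ← Real.exp_add]
  congr 2
  ring

theorem xInv_one_eq_cfc (hg : IsRiemannianMetric θ g) (t : Fin d → ℝ) :
    xInv g t 1 = cfc (fun r : ℝ => (1 + r)⁻¹) (xs g t) := by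
  have hs := isSelfAdjoint_xs hg t
  obtain ⟨c, hc, h⟩ := hg.spectrum_xs
  have hne : ∀ r ∈ spectrum ℝ (xs g t), 1 + r ≠ 0 := fun r hr => by
    have := (h t r hr).1
    have := lenSq_nonneg t
    have : 0 ≤ c * lenSq t := by positivity
    linarith
  rw [cfc_inv (fun r : ℝ => 1 + r) (xs g t) hne (by fun_prop) hs, xInv,
    cfc_const_add (1 : ℝ) (fun r => r) (xs g t) (by fun_prop) hs, cfc_id' ℝ (xs g t) hs, map_one,
    one_smul, add_comm]

/-- The Laplace transform formula `Γ(d+1) (1 + x)^{-(d+1)} = ∫ u^d e^{-u} e^{-u x} du`. -/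
theorem integral_nuIntegrand_sqrt_smul (hg : IsRiemannianMetric θ g) (t : Fin d → ℝ) :
    ∫ u in Set.Ioi (0 : ℝ), (u ^ d * Real.exp (-u)) • nuIntegrand g (Real.sqrt u • t)
      = Real.Gamma (d + 1) • xInv g t 1 ^ (d + 1) := by
  have hs := isSelfAdjoint_xs hg t
  obtain ⟨c, hc, h⟩ := hg.spectrum_xs
  have hpos : ∀ r ∈ spectrum ℝ (xs g t), 0 ≤ r := fun r hr => by
    have := (h t r hr).1
    have := lenSq_nonneg t
    have : 0 ≤ c * lenSq t := by positivity
    linarith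
  have h1 : ∫ u in Set.Ioi (0 : ℝ), (u ^ d * Real.exp (-u)) • nuIntegrand g (Real.sqrt u • t)
      = ∫ u in Set.Ioi (0 : ℝ),
        cfc (fun r : ℝ => u ^ d * Real.exp (-u) * Real.exp (-(u * r))) (xs g t) := by
    refine MeasureTheory.setIntegral_congr_fun measurableSet_Ioi fun u hu => ?_
    rw [nuIntegrand_sqrt_smul hg (le_of_lt hu),
      ← cfc_const_mul _ (fun r : ℝ => Real.exp (-(u * r))) (xs g t) (by fun_prop)]
  have h2 := cfc_setIntegral (μ := MeasureTheory.volume) (s := Set.Ioi (0 : ℝ)) measurableSet_Ioi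
    (fun u r : ℝ => u ^ d * Real.exp (-u) * Real.exp (-(u * r)))
    (fun u => u ^ d * Real.exp (-u)) (xs g t) (by fun_prop)
    (by
      refine MeasureTheory.ae_restrict_of_forall_mem measurableSet_Ioi fun u hu r hr => ?_
      have hu' : (0 : ℝ) < u := hu
      rw [Real.norm_of_nonneg (by positivity)]
      refine mul_le_of_le_one_right (by positivity) (Real.exp_le_one_iff.mpr ?_)
      have := mul_nonneg hu'.le (hpos r hr)
      linarith)
    integrableOn_pow_mul_exp.2 hs
  rw [h1, ← h2, cfc_congr (g := fun r => Real.Gamma (d + 1) * (1 + r)⁻¹ ^ (d + 1))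
    (fun r hr => (integral_pow_mul_exp_mul (hpos r hr)).trans (mul_comm _ _))]
  have hne : ∀ r ∈ spectrum ℝ (xs g t), 1 + r ≠ 0 := fun r hr => by
    have := hpos r hr; positivity
  have hcont : ContinuousOn (fun r : ℝ => (1 + r)⁻¹) (spectrum ℝ (xs g t)) :=
    ContinuousOn.inv₀ (by fun_prop) hne
  rw [cfc_const_mul _ (fun r : ℝ => (1 + r)⁻¹ ^ (d + 1)) (xs g t) (hcont.pow _),
    cfc_pow (fun r : ℝ => (1 + r)⁻¹) (d + 1) (xs g t) hcont hs, xInv_one_eq_cfc hg]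

theorem continuous_nuIntegrand_sqrt : Continuous
    (fun p : (Fin d → ℝ) × ℝ =>
      (p.2 ^ d * Real.exp (-p.2)) • nuIntegrand g (Real.sqrt p.2 • p.1)) := by
  have h1 : Continuous fun p : (Fin d → ℝ) × ℝ => p.2 ^ d * Real.exp (-p.2) := by fun_prop
  have h2 : Continuous fun p : (Fin d → ℝ) × ℝ => Real.sqrt p.2 • p.1 := by fun_prop
  exact h1.smul (continuous_nuIntegrand.comp h2)

theorem integrable_nuIntegrand_sqrt (hg : IsRiemannianMetric θ g) : MeasureTheory.Integrable
    (fun p : (Fin d → ℝ) × ℝ =>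
      (p.2 ^ d * Real.exp (-p.2)) • nuIntegrand g (Real.sqrt p.2 • p.1))
    (MeasureTheory.volume.prod (MeasureTheory.volume.restrict (Set.Ioi (0 : ℝ)))) := by
  obtain ⟨c, hc, h⟩ := norm_nuIntegrand_le hg
  have : SecondCountableTopologyEither ((Fin d → ℝ) × ℝ) (Op d) :=
    secondCountableTopologyEither_of_left _ _
  have : SecondCountableTopologyEither ℝ (Op d) :=
    secondCountableTopologyEither_of_left _ _
  have hmeas : MeasureTheory.AEStronglyMeasurable (fun p : (Fin d → ℝ) × ℝ =>
      (p.2 ^ d * Real.exp (-p.2)) • nuIntegrand g (Real.sqrt p.2 • p.1))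
      (MeasureTheory.volume.prod (MeasureTheory.volume.restrict (Set.Ioi (0 : ℝ)))) :=
    continuous_nuIntegrand_sqrt.aestronglyMeasurable
  have hb : ∀ (t : Fin d → ℝ) (u : ℝ), 0 < u →
      ‖(u ^ d * Real.exp (-u)) • nuIntegrand g (Real.sqrt u • t)‖
        ≤ u ^ d * Real.exp (-u) * Real.exp (-(u * (c * lenSq t))) := fun t u hu => by
    rw [norm_smul, Real.norm_of_nonneg (by positivity)]
    refine mul_le_mul_of_nonneg_left ((h _).trans (le_of_eq ?_)) (by positivity)
    rw [lenSq_smul, Real.sq_sqrt hu.le]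
    congr 1
    ring
  have hi : ∀ r : ℝ, 0 ≤ r → MeasureTheory.IntegrableOn
      (fun u : ℝ => u ^ d * Real.exp (-u) * Real.exp (-(u * r))) (Set.Ioi 0) := fun r hr => by
    refine MeasureTheory.Integrable.mono' (integrableOn_pow_mul_exp (d := d))
      (Continuous.aestronglyMeasurable (by fun_prop))
      (MeasureTheory.ae_restrict_of_forall_mem measurableSet_Ioi fun u hu => ?_)
    have hu' : (0 : ℝ) < u := hu
    rw [Real.norm_of_nonneg (by positivity)]
    refine mul_le_of_le_one_right (by positivity) (Real.exp_le_one_iff.mpr ?_)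
    have := mul_nonneg hu'.le hr
    linarith
  have hl : ∀ t : Fin d → ℝ, 0 ≤ c * lenSq t := fun t => mul_nonneg hc.le (lenSq_nonneg t)
  have hti : ∀ t : Fin d → ℝ, MeasureTheory.Integrable
      (fun u : ℝ => (u ^ d * Real.exp (-u)) • nuIntegrand g (Real.sqrt u • t))
      (MeasureTheory.volume.restrict (Set.Ioi (0 : ℝ))) := fun t => by
    refine MeasureTheory.Integrable.mono' (hi _ (hl t))
      (Continuous.aestronglyMeasurable
        (continuous_nuIntegrand_sqrt.comp (Continuous.prodMk_right t)))
      (MeasureTheory.ae_restrict_of_forall_mem measurableSet_Ioi fun u hu => hb t u hu)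
  rw [MeasureTheory.integrable_prod_iff hmeas]
  refine ⟨Filter.Eventually.of_forall hti, ?_⟩
  refine ((integrable_inv_one_add_lenSq_pow hc).mul_const (Real.Gamma (d + 1))).mono'
    hmeas.norm.integral_prod_right' (Filter.Eventually.of_forall fun t => ?_)
  rw [Real.norm_of_nonneg (MeasureTheory.integral_nonneg fun _ => norm_nonneg _),
    ← integral_pow_mul_exp_mul (hl t)]
  exact MeasureTheory.setIntegral_mono_on (hti t).norm (hi _ (hl t)) measurableSet_Ioi
    fun u hu => hb t u hu

/-- Up to a scalar, `ν` is the integral of `(1 + x(t))^{-(d+1)}`: by the Laplace transform formula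
and Fubini's theorem, both are multiples of the Gaussian integral. -/
theorem exists_nu_eq_integral_xInv (hg : IsRiemannianMetric θ g) :
    ∃ c : ℂ, nu g = c • ∫ t : Fin d → ℝ, xInv g t 1 ^ (d + 1) := by
  have hsw := MeasureTheory.integral_integral_swap
    (f := fun (t : Fin d → ℝ) (u : ℝ) =>
      (u ^ d * Real.exp (-u)) • nuIntegrand g (Real.sqrt u • t))
    (integrable_nuIntegrand_sqrt hg)
  simp only [integral_nuIntegrand_sqrt_smul hg] at hsw
  rw [MeasureTheory.integral_smul] at hsw
  have h1 : ∫ u in Set.Ioi (0 : ℝ), ∫ t : Fin d → ℝ,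
      (u ^ d * Real.exp (-u)) • nuIntegrand g (Real.sqrt u • t)
      = Real.Gamma ((d : ℝ) / 2 + 1) • ∫ t : Fin d → ℝ, nuIntegrand g t := by
    rw [Real.Gamma_eq_integral (by positivity), ← integral_smul_const]
    refine MeasureTheory.setIntegral_congr_fun measurableSet_Ioi fun u hu => ?_
    have hu' : (0 : ℝ) < u := hu
    change ∫ t : Fin d → ℝ, (u ^ d * Real.exp (-u)) • nuIntegrand g (Real.sqrt u • t)
      = (Real.exp (-u) * u ^ ((d : ℝ) / 2 + 1 - 1)) • _
    rw [MeasureTheory.integral_smul, MeasureTheory.Measure.integral_comp_smul, smul_smul]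
    congr 1
    have h2 : Real.sqrt u ^ d = u ^ ((d : ℝ) / 2) := by
      rw [Real.sqrt_eq_rpow, ← Real.rpow_natCast, ← Real.rpow_mul hu'.le]
      congr 1
      ring
    have h3 : u ^ d = u ^ ((d : ℝ) / 2) * u ^ ((d : ℝ) / 2) := by
      rw [← Real.rpow_add hu', ← Real.rpow_natCast]
      congr 1
      ring
    have h4 : (0 : ℝ) < u ^ ((d : ℝ) / 2) := Real.rpow_pos_of_pos hu' _
    rw [Module.finrank_fin_fun, h2, abs_of_pos (inv_pos.mpr h4), add_sub_cancel_right, h3]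
    field_simp
  rw [h1] at hsw
  have hG : Real.Gamma ((d : ℝ) / 2 + 1) ≠ 0 := (Real.Gamma_pos_of_pos (by positivity)).ne'
  have h2 : ∫ t : Fin d → ℝ, nuIntegrand g t = (Real.Gamma ((d : ℝ) / 2 + 1))⁻¹ •
      Real.Gamma (d + 1) • ∫ t : Fin d → ℝ, xInv g t 1 ^ (d + 1) := by
    rw [hsw, inv_smul_smul₀ hG]
  refine ⟨((Real.pi ^ (-(d : ℝ) / 2) : ℝ) : ℂ) *
    (((Real.Gamma ((d : ℝ) / 2 + 1))⁻¹ * Real.Gamma (d + 1) : ℝ) : ℂ), ?_⟩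
  rw [nu, h2, mul_smul, smul_smul (Real.Gamma ((d : ℝ) / 2 + 1))⁻¹]
  rfl

theorem Tame.pow {T : Type*} {R : Subalgebra ℂ (T → Op d)} {S : Set T} {w : T → ℝ}
    {F : T → Op d} (h : Tame θ R S w F) (n : ℕ) :
    Tame θ R S (fun t => w t ^ n) (fun t => F t ^ n) := by
  induction n with
  | zero =>
    have := Tame.scalar (θ := θ) (R := R) (S := S) (w := fun _ => 1) (fun _ => 1)
      (by simp only [one_smul]; exact R.one_mem) 1 (by simp)
    simpa using this
  | succ n ih =>
    simp only [pow_succ]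
    exact ih.mul h

theorem continuousAt_inverse {a : Op d} (ha : IsUnit a) : ContinuousAt Ring.inverse a := by
  obtain ⟨u, rfl⟩ := ha
  exact NormedRing.inverse_continuousAt u

theorem nu_mem_smooth (hg : IsRiemannianMetric θ g) : nu g ∈ smooth θ := by
  obtain ⟨c, hc⟩ := exists_nu_eq_integral_xInv hg
  rw [hc]
  refine smooth_smul ?_ c
  have : SecondCountableTopologyEither (Fin d → ℝ) (Op d) :=
    secondCountableTopologyEither_of_left _ _
  have hl := fun t : Fin d → ℝ => lenSq_nonneg t
  have h1 : Tame θ (measurableFamilies MeasureTheory.volume d) Set.univ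
      (fun t : Fin d → ℝ => 1 + lenSq t) (fun t => xs g t + (1 : ℂ) • (1 : Op d)) :=
    tame_xs_add hg (fun x => MeasureTheory.aestronglyMeasurable_const) id (fun _ => 1)
      (fun i => Continuous.aestronglyMeasurable (by unfold id; fun_prop))
      MeasureTheory.aestronglyMeasurable_const (fun t _ => by simp [add_comm])
  obtain ⟨C, hC0, hC⟩ := norm_xInv_le hg
  have hcont : Continuous (fun t : Fin d → ℝ => xInv g t 1) := by
    refine continuous_iff_continuousAt.mpr fun t => ?_
    exact ContinuousAt.comp (f := fun t => xs g t + (1 : ℂ) • (1 : Op d))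
      (continuousAt_inverse (isUnit_xs_add hg t (by simp)))
      (continuous_xs.add continuous_const).continuousAt
  have h2 := h1.inverse (w' := fun t => (1 + 1 * lenSq t)⁻¹) hcont.aestronglyMeasurable C 1
    (fun t _ => by
      have := hC t 1 one_ne_zero (by simp)
      rwa [norm_one, add_comm, ← one_mul (lenSq t)] at this)
    (fun t _ => by have := hl t; positivity) (fun t _ => by have := hl t; positivity)
    (fun t _ => by
      have := hl t
      rw [one_mul, mul_inv_cancel₀ (by positivity)])
  exact ((h2.pow (d + 1)).integral_mem_smooth (fun _ h => h) (by simp)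
    (integrable_inv_one_add_lenSq_pow one_pos)).2

/-- The square root of a positive element is an integral of its resolvents. -/
theorem rpow_half_eq_integral {a : Op d} (ha : 0 ≤ a) :
    ∃ c : ℂ, a ^ (1 / 2 : ℝ) = c • ∫ t in Set.Ioi (0 : ℝ),
      ((t ^ (-(1 / 2) : ℝ) : ℝ) : ℂ) • (a * Ring.inverse (a + (t : ℂ) • (1 : Op d))) := by
  have hp : (1 / 2 : ℝ) ∈ Set.Ioo (0 : ℝ) 1 := by norm_num
  have hsa : IsSelfAdjoint a := ha.isSelfAdjoint
  have hpos : ∀ r ∈ spectrum ℝ a, 0 ≤ r := fun r hr => spectrum_nonneg_of_nonneg ha hr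
  set I : ℝ := ∫ t in Set.Ioi 0, Real.rpowIntegrand₀₁ (1 / 2) t 1 with hI
  have hIpos : 0 < I := Real.integral_rpowIntegrand₀₁_one_pos hp
  obtain ⟨M, hM0, hM⟩ : ∃ M : ℝ, 0 ≤ M ∧ ∀ r ∈ spectrum ℝ a, r ≤ M :=
    ⟨‖a‖ * ‖(1 : Op d)‖, by positivity, fun r hr =>
      (Real.le_norm_self r).trans (spectrum.norm_le_norm_mul_of_mem hr)⟩
  have hform : ∀ t ∈ Set.Ioi (0 : ℝ), ∀ r ∈ spectrum ℝ a,
      Real.rpowIntegrand₀₁ (1 / 2) t r = t ^ (-(1 / 2) : ℝ) * (r * (r + t)⁻¹) :=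
    fun t ht r hr => by
      rw [Real.rpowIntegrand₀₁_eq_pow_div hp (le_of_lt ht) (hpos r hr), add_comm t r]
      norm_num
      ring
  have h2 := cfc_setIntegral (μ := MeasureTheory.volume) (s := Set.Ioi (0 : ℝ)) measurableSet_Ioi
    (fun t r : ℝ => Real.rpowIntegrand₀₁ (1 / 2) t r)
    (fun t => Real.rpowIntegrand₀₁ (1 / 2) t M) a
    ((Real.continuousOn_rpowIntegrand₀₁_uncurry hp (spectrum ℝ a) hpos))
    (by
      refine MeasureTheory.ae_restrict_of_forall_mem measurableSet_Ioi fun t ht r hr => ?_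
      have ht' : (0 : ℝ) < t := ht
      rw [Real.norm_of_nonneg (Real.rpowIntegrand₀₁_nonneg hp.1 ht'.le (hpos r hr))]
      exact Real.rpowIntegrand₀₁_monotoneOn hp ht'.le (hpos r hr) hM0 (hM r hr))
    (Real.integrableOn_rpowIntegrand₀₁_Ioi hp hM0).2 hsa
  have h3 : cfc (fun r => ∫ t in Set.Ioi (0 : ℝ), Real.rpowIntegrand₀₁ (1 / 2) t r) a
      = I • a ^ (1 / 2 : ℝ) := by
    have h4 := cfc_const_mul I (fun r : ℝ => r ^ (1 / 2 : ℝ)) a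
      (ContinuousOn.rpow_const continuousOn_id fun _ _ => Or.inr hp.1.le)
    rw [CFC.rpow_eq_cfc_real ha, ← h4]
    exact cfc_congr fun r hr => by
      rw [Real.integral_rpowIntegrand₀₁_eq_rpow_mul_const hp (hpos r hr), mul_comm]
  refine ⟨((I⁻¹ : ℝ) : ℂ), ?_⟩
  rw [← inv_smul_smul₀ hIpos.ne' (a ^ (1 / 2 : ℝ)), ← h3, h2]
  rw [real_smul_eq]
  congr 1
  refine MeasureTheory.setIntegral_congr_fun measurableSet_Ioi fun t ht => ?_
  have ht' : (0 : ℝ) < t := ht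
  have hne : ∀ r ∈ spectrum ℝ a, r + t ≠ 0 := fun r hr => by
    have := hpos r hr; positivity
  have hcont : ContinuousOn (fun r : ℝ => (r + t)⁻¹) (spectrum ℝ a) :=
    ContinuousOn.inv₀ (by fun_prop) hne
  change cfc (fun r => Real.rpowIntegrand₀₁ (1 / 2) t r) a = _
  rw [cfc_congr (hform t ht), cfc_const_mul _ (fun r : ℝ => r * (r + t)⁻¹) a
    (continuousOn_id.mul hcont), cfc_mul (fun r : ℝ => r) (fun r : ℝ => (r + t)⁻¹) a
    continuousOn_id hcont, cfc_id' ℝ a hsa, cfc_inv (fun r : ℝ => r + t) a hne (by fun_prop) hsa,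
    cfc_add_const t (fun r : ℝ => r) a (by fun_prop) hsa, cfc_id' ℝ a hsa]
  rfl

theorem integrableOn_rpow_mul_inv : MeasureTheory.IntegrableOn
    (fun t : ℝ => t ^ (-(1 / 2) : ℝ) * (1 + t)⁻¹) (Set.Ioi 0) := by
  have hp : (1 / 2 : ℝ) ∈ Set.Ioo (0 : ℝ) 1 := by norm_num
  refine (Real.integrableOn_rpowIntegrand₀₁_Ioi hp zero_le_one).congr_fun (fun t ht => ?_)
    measurableSet_Ioi
  have ht' : (0 : ℝ) < t := ht
  change Real.rpowIntegrand₀₁ (1 / 2) t 1 = _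
  rw [Real.rpowIntegrand₀₁_eq_pow_div hp ht'.le zero_le_one, add_comm 1 t]
  norm_num
  ring

/-- `C^∞` contains the square roots of its elements that are bounded below. -/
theorem rpow_half_mem_smooth {a : Op d} (ha : a ∈ smooth θ) {c : ℝ} (hc : 0 < c)
    (hl : LowerBound a c) : a ^ (1 / 2 : ℝ) ∈ smooth θ := by
  obtain ⟨k, hk⟩ := rpow_half_eq_integral (hl.nonneg hc.le)
  rw [hk]
  refine smooth_smul ?_ k
  have : SecondCountableTopologyEither ℝ (Op d) := secondCountableTopologyEither_of_left _ _
  set μ := MeasureTheory.volume.restrict (Set.Ioi (0 : ℝ)) with hμ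
  have hR : ∀ x : Op d, (fun _ : ℝ => x) ∈ measurableFamilies μ d :=
    fun x => MeasureTheory.aestronglyMeasurable_const
  have hsc : (fun t : ℝ => (t : ℂ) • (1 : Op d)) ∈ measurableFamilies μ d :=
    Continuous.aestronglyMeasurable
      ((Complex.continuous_ofReal).smul (continuous_const (y := (1 : Op d))))
  have h1 : Tame θ (measurableFamilies μ d) (Set.Ioi 0) (fun t : ℝ => 1 + t)
      (fun t => a + (t : ℂ) • (1 : Op d)) := by
    refine Tame.add (Tame.const hR ha fun t ht => ?_) (Tame.scalar _ hsc 1 fun t ht => ?_)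
    · have ht' : (0 : ℝ) < t := ht
      linarith
    · have ht' : (0 : ℝ) < t := ht
      rw [Complex.norm_real, Real.norm_of_nonneg ht'.le]
      linarith
  have hlow : ∀ t : ℝ, LowerBound (a + (t : ℂ) • (1 : Op d)) (c + t) := fun t ξ => by
    obtain ⟨b, hb, hbl⟩ := hl ξ
    refine ⟨b + t * ‖ξ‖ ^ 2, ?_, by linarith⟩
    rw [inner_smul_one_apply, hb]
    push_cast
    rfl
  have hcont : MeasureTheory.AEStronglyMeasurable
      (fun t : ℝ => Ring.inverse (a + (t : ℂ) • (1 : Op d))) μ := by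
    refine ContinuousOn.aestronglyMeasurable (fun t ht => ?_) measurableSet_Ioi
    have ht' : (0 : ℝ) < t := ht
    refine ContinuousAt.continuousWithinAt ?_
    exact ContinuousAt.comp (f := fun t : ℝ => a + (t : ℂ) • (1 : Op d))
      (continuousAt_inverse ((hlow t).isUnit (by linarith)))
      (continuous_const.add
        ((Complex.continuous_ofReal).smul (continuous_const (y := (1 : Op d))))).continuousAt
  set m : ℝ := min c 1 with hm
  have hm0 : 0 < m := lt_min hc one_pos
  have h2 := h1.inverse (w' := fun t => (1 + t)⁻¹) hcont m⁻¹ 1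
    (fun t ht => by
      have ht' : (0 : ℝ) < t := ht
      have h3 := (isUnit_of_coercive (c := c + t) (by linarith) fun ξ => by
        obtain ⟨b, hb, hbl⟩ := hlow t ξ
        rw [hb, Complex.norm_real]
        exact hbl.trans (Real.le_norm_self b)).2
      refine h3.trans ?_
      rw [← mul_inv]
      have h4 : m ≤ c := min_le_left _ _
      have h5 : m ≤ 1 := min_le_right _ _
      gcongr
      nlinarith)
    (fun t ht => by have ht' : (0 : ℝ) < t := ht; positivity)
    (fun t ht => by have ht' : (0 : ℝ) < t := ht; positivity)
    (fun t ht => by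
      have ht' : (0 : ℝ) < t := ht
      rw [mul_inv_cancel₀ (by positivity)])
  have hs : (fun t : ℝ => ((t ^ (-(1 / 2) : ℝ) : ℝ) : ℂ) • (1 : Op d))
      ∈ measurableFamilies μ d := by
    have h : ContinuousOn (fun t : ℝ => ((t ^ (-(1 / 2) : ℝ) : ℝ) : ℂ)) (Set.Ioi 0) :=
      Complex.continuous_ofReal.comp_continuousOn
        (ContinuousOn.rpow_const continuousOn_id fun t ht => Or.inl (ne_of_gt ht))
    have h' : ContinuousOn (fun t : ℝ => ((t ^ (-(1 / 2) : ℝ) : ℝ) : ℂ) • (1 : Op d))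
        (Set.Ioi 0) := h.smul continuousOn_const
    exact h'.aestronglyMeasurable measurableSet_Ioi
  have h3 : Tame θ (measurableFamilies μ d) (Set.Ioi 0) (fun t : ℝ => t ^ (-(1 / 2) : ℝ))
      (fun t => ((t ^ (-(1 / 2) : ℝ) : ℝ) : ℂ) • (1 : Op d)) :=
    Tame.scalar _ hs 1 fun t ht => by
      have ht' : (0 : ℝ) < t := ht
      rw [Complex.norm_real, Real.norm_of_nonneg (by positivity), one_mul]
  have h4 := h3.mul ((Tame.const (S := Set.Ioi 0) (w := fun _ => 1) hR ha fun _ _ => le_rfl).mul h2)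
  simp only [one_mul, smul_mul_assoc] at h4
  exact (h4.integral_mem_smooth (fun _ h => h)
    (MeasureTheory.ae_restrict_mem measurableSet_Ioi) integrableOn_rpow_mul_inv).2

theorem nuHalf_mem_smooth (hg : IsRiemannianMetric θ g) : nuHalf g ∈ smooth θ := by
  obtain ⟨c, hc, h⟩ := lowerBound_nu hg
  exact rpow_half_mem_smooth (nu_mem_smooth hg) hc h

theorem isStrictlyPositive_nu (hg : IsRiemannianMetric θ g) : IsStrictlyPositive (nu g) :=
  (isUnit_nu hg).isStrictlyPositive (nu_nonneg hg)

theorem nuHalf_mul_nuNegHalf (hg : IsRiemannianMetric θ g) : nuHalf g * nuNegHalf g = 1 :=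
  CFC.rpow_mul_rpow_neg _ (isStrictlyPositive_nu hg)

theorem nuNegHalf_mul_nuHalf (hg : IsRiemannianMetric θ g) : nuNegHalf g * nuHalf g = 1 :=
  CFC.rpow_neg_mul_rpow _ (isStrictlyPositive_nu hg)

theorem nuHalf_mul_nuHalf (hg : IsRiemannianMetric θ g) : nuHalf g * nuHalf g = nu g := by
  rw [nuHalf, ← CFC.rpow_add (isUnit_nu hg)]
  norm_num
  exact CFC.rpow_one _ (nu_nonneg hg)

theorem isSelfAdjoint_nuHalf : IsSelfAdjoint (nuHalf g) :=
  (CFC.rpow_nonneg (a := nu g)).isSelfAdjoint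

theorem isSelfAdjoint_nuNegHalf : IsSelfAdjoint (nuNegHalf g) :=
  (CFC.rpow_nonneg (a := nu g)).isSelfAdjoint

theorem nuNegHalf_mem_smooth (hg : IsRiemannianMetric θ g) : nuNegHalf g ∈ smooth θ := by
  have h : nuNegHalf g = Ring.inverse (nuHalf g) :=
    (Ring.inverse_unit
      (⟨nuHalf g, nuNegHalf g, nuHalf_mul_nuNegHalf hg, nuNegHalf_mul_nuHalf hg⟩ : (Op d)ˣ)).symm
  rw [h]
  exact smooth_inverse (nuHalf_mem_smooth hg)

end Smoothness

/-! ### Sobolev spaces and values of unbounded operators -/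

section Values

variable {H : Type*} [NormedAddCommGroup H] [InnerProductSpace ℂ H]

/-- The partial operator `A` is defined at `ξ` and takes the value `η` there. -/
def IsVal (A : H →ₗ.[ℂ] H) (ξ η : H) : Prop := ∃ h : ξ ∈ A.domain, A ⟨ξ, h⟩ = η

variable {A B : H →ₗ.[ℂ] H} {ξ η ζ : H}

theorem IsVal.mem (h : IsVal A ξ η) : ξ ∈ A.domain := h.1

theorem IsVal.value (h : IsVal A ξ η) : value A ξ = η := by
  obtain ⟨h1, h2⟩ := h
  unfold NCTorus.value
  rw [dif_pos h1, h2]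

theorem IsVal.unique (h : IsVal A ξ η) (h' : IsVal A ξ ζ) : η = ζ := by
  rw [← h.value, h'.value]

theorem IsVal.add (h : IsVal A ξ η) (k : IsVal B ξ ζ) : IsVal (A + B) ξ (η + ζ) := by
  obtain ⟨h1, rfl⟩ := h
  obtain ⟨k1, rfl⟩ := k
  exact ⟨⟨h1, k1⟩, rfl⟩

theorem IsVal.smul (h : IsVal A ξ η) (c : ℂ) : IsVal (c • A) ξ (c • η) := by
  obtain ⟨h1, rfl⟩ := h
  exact ⟨h1, rfl⟩

theorem IsVal.sum {ι : Type*} {s : Finset ι} {A : ι → H →ₗ.[ℂ] H} {η : ι → H}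
    (h : ∀ i ∈ s, IsVal (A i) ξ (η i)) : IsVal (∑ i ∈ s, A i) ξ (∑ i ∈ s, η i) := by
  classical
  induction s using Finset.induction_on with
  | empty => exact ⟨Submodule.mem_top, rfl⟩
  | insert i s hi ih =>
    rw [Finset.sum_insert hi, Finset.sum_insert hi]
    exact (h i (Finset.mem_insert_self i s)).add
      (ih fun j hj => h j (Finset.mem_insert_of_mem hj))

theorem isVal_bdd (a : H →L[ℂ] H) (ξ : H) : IsVal (bdd a) ξ (a ξ) := ⟨Submodule.mem_top, rfl⟩

theorem IsVal.comp (h : IsVal A ξ η) (k : IsVal B η ζ) : IsVal (comp B A) ξ ζ := by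
  obtain ⟨h1, rfl⟩ := h
  obtain ⟨k1, rfl⟩ := k
  exact ⟨⟨h1, k1⟩, rfl⟩

theorem IsVal.domRestrict (h : IsVal A ξ η) {S : Submodule ℂ H} (hξ : ξ ∈ S) :
    IsVal (A.domRestrict S) ξ η := by
  obtain ⟨h1, rfl⟩ := h
  exact ⟨⟨hξ, h1⟩, rfl⟩

end Values

section Sobolev

variable {d : ℕ} {θ : Matrix (Fin d) (Fin d) ℝ}

theorem sq_le_normSq (n : Fin d → ℤ) (i : Fin d) : (n i : ℝ) ^ 2 ≤ normSq n :=
  Finset.single_le_sum (f := fun j => (n j : ℝ) ^ 2) (fun _ _ => sq_nonneg _) (Finset.mem_univ i)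

theorem one_le_normSq {n : Fin d → ℤ} (hn : n ≠ 0) : 1 ≤ normSq n := by
  obtain ⟨i, hi⟩ := Function.ne_iff.mp hn
  have h : (1 : ℝ) ≤ (n i : ℝ) ^ 2 := by
    have : (1 : ℤ) ≤ n i ^ 2 := by
      have : 0 < n i ^ 2 := by
        have : n i ≠ 0 := hi
        positivity
      omega
    exact_mod_cast this
  exact h.trans (sq_le_normSq n i)

theorem normSq_le_pow_two (n : Fin d → ℤ) : normSq n ^ 1 ≤ normSq n ^ 2 := by
  by_cases hn : n = 0
  · subst hn; simp [normSq]
  · exact pow_le_pow_right₀ (one_le_normSq hn) (by norm_num)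

theorem isD_of_mem {ξ : L2 d} (h : ξ ∈ sobolev d 1) (j : Fin d) :
    IsD j ξ (D j ⟨ξ, h⟩) := fun _ => rfl

theorem mem_sobolev_one_iff {ξ : L2 d} : ξ ∈ sobolev d 1 ↔ ∀ j, ∃ η, IsD j ξ η := by
  refine ⟨fun h j => ⟨_, isD_of_mem h j⟩, fun h => ?_⟩
  choose η hη using h
  change Summable fun n : Fin d → ℤ => normSq n ^ 1 * ‖ξ n‖ ^ 2
  have : Summable fun n => ∑ j, ‖η j n‖ ^ 2 := summable_sum fun j _ => summable_norm_sq (η j)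
  refine this.congr fun n => ?_
  rw [pow_one, normSq, Finset.sum_mul]
  refine Finset.sum_congr rfl fun j _ => ?_
  rw [hη j n, norm_mul, mul_pow, Complex.norm_intCast, sq_abs]

theorem sobolev_two_le_one : sobolev d 2 ≤ sobolev d 1 := fun _ hξ =>
  Summable.of_nonneg_of_le (fun n => mul_nonneg (pow_nonneg (normSq_nonneg n) 1) (sq_nonneg _))
    (fun n => mul_le_mul_of_nonneg_right (normSq_le_pow_two n) (sq_nonneg _)) hξ

theorem mem_sobolev_two_iff {ξ : L2 d} :
    ξ ∈ sobolev d 2 ↔ ∀ j, ∃ η, IsD j ξ η ∧ η ∈ sobolev d 1 := by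
  have key : ∀ {η : Fin d → L2 d}, (∀ j, IsD j ξ (η j)) → ∀ n : Fin d → ℤ,
      ∑ j, normSq n ^ 1 * ‖η j n‖ ^ 2 = normSq n ^ 2 * ‖ξ n‖ ^ 2 := fun {η} hη n => by
    rw [← Finset.mul_sum, pow_one, sq (normSq n), mul_assoc]
    congr 1
    rw [normSq, Finset.sum_mul]
    refine Finset.sum_congr rfl fun j _ => ?_
    rw [hη j n, norm_mul, mul_pow, Complex.norm_intCast, sq_abs]
  constructor
  · intro h j
    have h1 := sobolev_two_le_one h
    refine ⟨_, isD_of_mem h1 j, ?_⟩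
    have h2 : Summable fun n : Fin d → ℤ => normSq n ^ 2 * ‖ξ n‖ ^ 2 := h
    refine h2.of_nonneg_of_le
      (fun n => mul_nonneg (pow_nonneg (normSq_nonneg n) 1) (sq_nonneg _)) fun n => ?_
    rw [← key (fun j => isD_of_mem h1 j) n]
    exact Finset.single_le_sum
      (f := fun j => normSq n ^ 1 * ‖(D j ⟨ξ, h1⟩ : L2 d) n‖ ^ 2)
      (fun _ _ => mul_nonneg (pow_nonneg (normSq_nonneg n) 1) (sq_nonneg _)) (Finset.mem_univ j)
  · intro h
    choose η hη hη1 using h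
    change Summable fun n : Fin d → ℤ => normSq n ^ 2 * ‖ξ n‖ ^ 2
    have : Summable fun n : Fin d → ℤ => ∑ j, normSq n ^ 1 * ‖η j n‖ ^ 2 :=
      summable_sum fun j _ => hη1 j
    exact this.congr (key hη)

theorem IsD.isVal {j : Fin d} {ξ η : L2 d} (h : IsD j ξ η) (hξ : ξ ∈ sobolev d 1) :
    IsVal (D j) ξ η := ⟨hξ, (isD_of_mem hξ j).unique h⟩

theorem smooth.isD_apply {x : Op d} (hx : x ∈ smooth θ) {j : Fin d} {ξ ξ' : L2 d}
    (h : IsD j ξ ξ') : IsD j (x ξ) (x ξ' + NCTorus.der θ j x ξ) := h.apply (smooth.der hx j).1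

theorem smooth.mem_sobolev_one {x : Op d} (hx : x ∈ smooth θ) {ξ : L2 d} (h : ξ ∈ sobolev d 1) :
    x ξ ∈ sobolev d 1 := by
  rw [mem_sobolev_one_iff] at h ⊢
  intro j
  obtain ⟨η, hη⟩ := h j
  exact ⟨_, smooth.isD_apply hx hη⟩

theorem smooth.mem_sobolev_two {x : Op d} (hx : x ∈ smooth θ) {ξ : L2 d} (h : ξ ∈ sobolev d 2) :
    x ξ ∈ sobolev d 2 := by
  have h1 := sobolev_two_le_one h
  rw [mem_sobolev_two_iff] at h ⊢
  intro j
  obtain ⟨η, hη, hη1⟩ := h j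
  exact ⟨_, smooth.isD_apply hx hη, (sobolev d 1).add_mem (smooth.mem_sobolev_one hx hη1)
    (smooth.mem_sobolev_one (smooth.der hx j).2 h1)⟩

theorem vac_mem_sobolev_two : vac d ∈ sobolev d 2 :=
  mem_sobolev_two_iff.mpr fun j => ⟨0, isD_vac j, (sobolev d 1).zero_mem⟩

theorem smooth.vac_mem_sobolev_two {x : Op d} (hx : x ∈ smooth θ) : x (vac d) ∈ sobolev d 2 :=
  smooth.mem_sobolev_two hx NCTorus.vac_mem_sobolev_two

theorem smooth.isD_vac {x : Op d} (hx : x ∈ smooth θ) (j : Fin d) :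
    IsD j (x (vac d)) (NCTorus.der θ j x (vac d)) := (smooth.der hx j).1.isD_vac

variable (g : (Matrix (Fin d) (Fin d) (Op d))ˣ)

/-- The coefficients `b_ij = ν^{1/2} (g⁻¹)_ij ν^{1/2}` of the Laplacian in divergence form. -/
def bcoef (i j : Fin d) : Op d := nuHalf g * g.inv i j * nuHalf g

variable {g}

theorem bcoef_mem_smooth (hg : IsRiemannianMetric θ g) (i j : Fin d) : bcoef g i j ∈ smooth θ :=
  smooth_mul (smooth_mul (nuHalf_mem_smooth hg) (hg.smooth_inv_entry i j)) (nuHalf_mem_smooth hg)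

theorem isVal_Ag (hg : IsRiemannianMetric θ g) {ξ : L2 d} (hξ : ξ ∈ sobolev d 2)
    {w : Fin d → L2 d} {v : Fin d → Fin d → L2 d}
    (hw : ∀ j, IsD j (nuNegHalf g ξ) (w j)) (hv : ∀ i j, IsD i (bcoef g i j (w j)) (v i j)) :
    IsVal (Ag g) ξ (nuNegHalf g (∑ i, ∑ j, v i j)) := by
  have h2 := smooth.mem_sobolev_two (nuNegHalf_mem_smooth hg) hξ
  have hw1 : ∀ j, w j ∈ sobolev d 1 := fun j => by
    obtain ⟨η, hη, hη1⟩ := mem_sobolev_two_iff.mp h2 j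
    rwa [(hw j).unique hη]
  refine IsVal.domRestrict ?_ hξ
  refine IsVal.comp (IsVal.comp (isVal_bdd _ _) ?_) (isVal_bdd _ _)
  refine IsVal.sum fun i _ => IsVal.sum fun j _ => ?_
  exact (((hw j).isVal (sobolev_two_le_one h2)).comp (isVal_bdd _ _)).comp
    ((hv i j).isVal (smooth.mem_sobolev_one (bcoef_mem_smooth hg i j) (hw1 j)))

theorem exists_isVal_Ag (hg : IsRiemannianMetric θ g) {ξ : L2 d} (hξ : ξ ∈ sobolev d 2) :
    ∃ (w : Fin d → L2 d) (v : Fin d → Fin d → L2 d), (∀ j, IsD j (nuNegHalf g ξ) (w j)) ∧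
      (∀ j, w j ∈ sobolev d 1) ∧
      (∀ i j, IsD i (bcoef g i j (w j)) (v i j)) ∧
      IsVal (Ag g) ξ (nuNegHalf g (∑ i, ∑ j, v i j)) := by
  have h2 := smooth.mem_sobolev_two (nuNegHalf_mem_smooth hg) hξ
  choose w hw hw1 using mem_sobolev_two_iff.mp h2
  have hb := fun i j => mem_sobolev_one_iff.mp
    (smooth.mem_sobolev_one (bcoef_mem_smooth hg i j) (hw1 j)) i
  choose v hv using hb
  exact ⟨w, v, hw, hw1, hv, isVal_Ag hg hξ hw hv⟩

theorem domain_Ag (hg : IsRiemannianMetric θ g) : (Ag g).domain = sobolev d 2 := by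
  refine le_antisymm (fun ξ hξ => hξ.1) fun ξ hξ => ?_
  obtain ⟨w, v, -, -, -, h⟩ := exists_isVal_Ag hg hξ
  exact h.mem

variable (θ g)

/-- The action of `A_g` on smooth elements: `A_g (a 1) = (lapOp a) 1`. -/
def lapOp (a : Op d) : Op d :=
  ∑ i, ∑ j, nuNegHalf g * der θ i (bcoef g i j * der θ j (nuNegHalf g * a))

/-- The action of `V(s)` on smooth elements: `V(s) (a 1) = (firstOp s a) 1`. -/
def firstOp (s : Fin d → ℝ) (a : Op d) : Op d :=
  ∑ i, (s i : ℂ) • ((∑ j, g.inv i j * nuHalf g * der θ j (nuNegHalf g * a)) +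
    ∑ j, nuNegHalf g * der θ j (nuHalf g * g.inv j i * a))

variable {θ g}

theorem lapOp_mem_smooth (hg : IsRiemannianMetric θ g) {a : Op d} (ha : a ∈ smooth θ) :
    lapOp θ g a ∈ smooth θ :=
  smooth_sum fun i _ => smooth_sum fun j _ => smooth_mul (nuNegHalf_mem_smooth hg)
    (smooth.der (smooth_mul (bcoef_mem_smooth hg i j)
      (smooth.der (smooth_mul (nuNegHalf_mem_smooth hg) ha) j).2) i).2

theorem isVal_Ag_smooth (hg : IsRiemannianMetric θ g) {a : Op d} (ha : a ∈ smooth θ) :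
    IsVal (Ag g) (a (vac d)) (lapOp θ g a (vac d)) := by
  have hq := nuNegHalf_mem_smooth hg
  have h1 := fun j => smooth.der (smooth_mul hq ha) j
  have h := isVal_Ag hg (smooth.vac_mem_sobolev_two ha)
    (w := fun j => der θ j (nuNegHalf g * a) (vac d))
    (v := fun i j => der θ i (bcoef g i j * der θ j (nuNegHalf g * a)) (vac d))
    (fun j => smooth.isD_vac (smooth_mul hq ha) j)
    (fun i j => smooth.isD_vac (smooth_mul (bcoef_mem_smooth hg i j) (h1 j).2) i)
  convert h using 1
  simp only [lapOp, sum_apply, map_sum, mul_apply_eq_comp]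

theorem isVal_V_smooth (hg : IsRiemannianMetric θ g) (s : Fin d → ℝ) {a : Op d}
    (ha : a ∈ smooth θ) : IsVal (V g s) (a (vac d)) (firstOp θ g s a (vac d)) := by
  have hq := nuNegHalf_mem_smooth hg
  have hh := nuHalf_mem_smooth hg
  have h : IsVal (V g s) (a (vac d)) (∑ i, (s i : ℂ) •
      ((∑ j, (g.inv i j * nuHalf g) (der θ j (nuNegHalf g * a) (vac d))) +
        ∑ j, nuNegHalf g (der θ j (nuHalf g * g.inv j i * a) (vac d)))) := by
    refine IsVal.sum fun i _ => IsVal.smul (IsVal.add (IsVal.sum fun j _ => ?_)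
      (IsVal.sum fun j _ => ?_)) _
    · exact ((isVal_bdd (nuNegHalf g) _).comp
        ((smooth.isD_vac (smooth_mul hq ha) j).isVal (sobolev_two_le_one
          (smooth.vac_mem_sobolev_two (smooth_mul hq ha))))).comp (isVal_bdd _ _)
    · have hb := smooth_mul (smooth_mul hh (hg.smooth_inv_entry j i)) ha
      exact ((isVal_bdd (nuHalf g * g.inv j i) _).comp
        ((smooth.isD_vac hb j).isVal (sobolev_two_le_one
          (smooth.vac_mem_sobolev_two hb)))).comp (isVal_bdd _ _)
  convert h using 1
  simp only [firstOp, sum_apply, add_apply,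
    smul_apply, mul_apply_eq_comp]

theorem smooth_add {x y : Op d} (hx : x ∈ smooth θ) (hy : y ∈ smooth θ) : x + y ∈ smooth θ :=
  ((smooth_tame hx).add (smooth_tame hy)).mem_smooth ()

theorem firstOp_mem_smooth (hg : IsRiemannianMetric θ g) (s : Fin d → ℝ) {a : Op d}
    (ha : a ∈ smooth θ) : firstOp θ g s a ∈ smooth θ := by
  have hq := nuNegHalf_mem_smooth hg
  have hh := nuHalf_mem_smooth hg
  refine smooth_sum fun i _ => smooth_smul ?_ _
  refine smooth_add (smooth_sum fun j _ => ?_) (smooth_sum fun j _ => ?_)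
  · exact smooth_mul (smooth_mul (hg.smooth_inv_entry i j) hh)
      (smooth.der (smooth_mul hq ha) j).2
  · exact smooth_mul hq
      (smooth.der (smooth_mul (smooth_mul hh (hg.smooth_inv_entry j i)) ha) j).2

end Sobolev

/-! ### The resolvent of the Laplacian -/

section Resolvent

variable {d : ℕ} {θ : Matrix (Fin d) (Fin d) ℝ} {g : (Matrix (Fin d) (Fin d) (Op d))ˣ}

theorem inner_eq_tsum (ξ η : L2 d) : inner ℂ ξ η = ∑' n, η n * (starRingEnd ℂ) (ξ n) := by
  rw [lp.inner_eq_tsum]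
  rfl

theorem IsD.inner_symm {i : Fin d} {a a' w w' : L2 d} (ha : IsD i a a') (hw : IsD i w w') :
    inner ℂ a w' = inner ℂ a' w := by
  rw [inner_eq_tsum, inner_eq_tsum]
  refine tsum_congr fun n => ?_
  rw [ha n, hw n, map_mul, map_intCast]
  ring

/-- Moving derivatives across the inner product and commuting them:
`⟨D_k a, D_i w⟩ = ⟨D_i a, D_k w⟩`. -/
theorem IsD.inner_swap {i k : Fin d} {a ak ai w wk wi : L2 d} (hk : IsD k a ak) (hi : IsD i a ai)
    (hwk : IsD k w wk) (hwi : IsD i w wi) : inner ℂ ak wi = inner ℂ ai wk := by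
  rw [inner_eq_tsum, inner_eq_tsum]
  refine tsum_congr fun n => ?_
  rw [hk n, hi n, hwk n, hwi n, map_mul, map_mul, map_intCast, map_intCast]
  ring

theorem form_bcoef (η ζ : Fin d → L2 d) : form (bcoef g) η ζ =
    form (fun i j => g.inv i j) (fun i => nuHalf g (η i)) (fun i => nuHalf g (ζ i)) := by
  unfold form
  refine Finset.sum_congr rfl fun i _ => Finset.sum_congr rfl fun j _ => ?_
  have h : ∀ a b : L2 d, inner ℂ a (nuHalf g b) = inner ℂ (nuHalf g a) b := fun a b => by
    have h1 := ContinuousLinearMap.adjoint_inner_left (nuHalf g) b a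
    rw [← ContinuousLinearMap.star_eq_adjoint, (isSelfAdjoint_nuHalf (g := g)).star_eq] at h1
    exact h1.symm
  rw [← h]
  rfl

theorem bcoef_elliptic (hg : IsRiemannianMetric θ g) : ∃ c : ℝ, 0 < c ∧ ∀ η : Fin d → L2 d,
    ∃ b : ℝ, form (bcoef g) η η = b ∧ c * ∑ i, ‖η i‖ ^ 2 ≤ b := by
  obtain ⟨c, hc, h⟩ := hg.elliptic
  set q := ‖nuNegHalf g‖ ^ 2 + 1 with hq
  have hq0 : 0 < q := by positivity
  refine ⟨c / q, by positivity, fun η => ?_⟩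
  obtain ⟨h1, h2⟩ := h fun i => nuHalf g (η i)
  rw [← form_bcoef] at h1 h2
  refine ⟨(form (bcoef g) η η).re, Complex.ext rfl (by simpa using h2), le_trans ?_ h1⟩
  rw [div_mul_eq_mul_div, div_le_iff₀ hq0, mul_assoc]
  refine mul_le_mul_of_nonneg_left ?_ hc.le
  rw [Finset.sum_mul]
  refine Finset.sum_le_sum fun i _ => ?_
  have h3 : nuNegHalf g (nuHalf g (η i)) = η i :=
    congrArg (fun T : Op d => T (η i)) (nuNegHalf_mul_nuHalf hg)
  have h4 := (nuNegHalf g).le_opNorm (nuHalf g (η i))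
  rw [h3] at h4
  calc ‖η i‖ ^ 2 ≤ (‖nuNegHalf g‖ * ‖nuHalf g (η i)‖) ^ 2 :=
        pow_le_pow_left₀ (norm_nonneg _) h4 2
    _ ≤ ‖nuHalf g (η i)‖ ^ 2 * q := by rw [mul_pow, hq]; nlinarith [sq_nonneg ‖nuHalf g (η i)‖]

/-- For `z` off the negative axis, `‖a + z N‖` controls both `a` and `N`. -/
theorem exists_norm_add_mul_ge {z : ℂ} (hz : z ∈ Complex.slitPlane) : ∃ δ : ℝ, 0 < δ ∧
    ∀ a N : ℝ, 0 ≤ a → 0 ≤ N → δ * (a + N) ≤ ‖(a : ℂ) + z * N‖ := by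
  have hp := slitPlane_pos hz
  set r := (‖z‖ + z.re) / 2 with hr
  have hr0 : 0 < r := by positivity
  refine ⟨(1 + (‖z‖ + 1) / r)⁻¹, by positivity, fun a N ha hN => ?_⟩
  have h1 := norm_add_mul_ge_slit hz (N := N) ha
  rw [← hr] at h1
  have h2 : a ≤ ‖(a : ℂ) + z * N‖ + ‖z‖ * N := by
    have h3 : (a : ℂ) = (a + z * N) - z * N := by ring
    have h4 := norm_sub_le ((a : ℂ) + z * N) (z * N)
    rw [← h3, norm_mul, Complex.norm_real, Complex.norm_real, Real.norm_of_nonneg ha,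
      Real.norm_of_nonneg hN] at h4
    exact h4
  have h5 : N ≤ ‖(a : ℂ) + z * N‖ / r := by rw [le_div_iff₀ hr0, mul_comm]; exact h1
  rw [inv_mul_le_iff₀ (by positivity)]
  have h6 : (1 + (‖z‖ + 1) / r) * ‖(a : ℂ) + z * N‖
      = ‖(a : ℂ) + z * N‖ + (‖z‖ + 1) * (‖(a : ℂ) + z * N‖ / r) := by ring
  rw [h6]
  nlinarith [mul_le_mul_of_nonneg_left h5 (show 0 ≤ ‖z‖ + 1 by positivity)]

variable (θ g) in
/-- The operator `∑ D_i b_ij D_j u` in terms of the first derivatives `u1` and the second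
derivatives `u2` of `u`. -/
def divForm (u1 : Fin d → L2 d) (u2 : Fin d → Fin d → L2 d) : L2 d :=
  ∑ i, ∑ j, (bcoef g i j (u2 i j) + der θ i (bcoef g i j) (u1 j))

theorem inner_divForm (hg : IsRiemannianMetric θ g) {u1 : Fin d → L2 d}
    {u2 : Fin d → Fin d → L2 d} (h2 : ∀ k j, IsD k (u1 j) (u2 k j))
    {w : L2 d} {w1 : Fin d → L2 d} (hw : ∀ j, IsD j w (w1 j)) :
    inner ℂ w (divForm θ g u1 u2) = form (bcoef g) w1 u1 := by
  simp only [divForm, form, inner_sum]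
  refine Finset.sum_congr rfl fun i _ => Finset.sum_congr rfl fun j _ => ?_
  exact IsD.inner_symm (hw i) (smooth.isD_apply (bcoef_mem_smooth hg i j) (h2 i j))

theorem inner_secondDeriv_divForm (hg : IsRiemannianMetric θ g) {u : L2 d} {u1 : Fin d → L2 d}
    {u2 : Fin d → Fin d → L2 d} (h1 : ∀ j, IsD j u (u1 j)) (h2 : ∀ k j, IsD k (u1 j) (u2 k j))
    (k : Fin d) :
    inner ℂ (u2 k k) (divForm θ g u1 u2) =
      form (bcoef g) (u2 k) (u2 k) + form (fun i j => der θ k (bcoef g i j)) (u2 k) u1 := by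
  simp only [divForm, form, inner_sum, ← Finset.sum_add_distrib]
  refine Finset.sum_congr rfl fun i _ => Finset.sum_congr rfl fun j _ => ?_
  have hsymm : u2 k i = u2 i k := by
    ext n
    rw [h2 k i n, h2 i k n, h1 i n, h1 k n]
    ring
  rw [hsymm, ← inner_add_right]
  have hb := bcoef_mem_smooth hg i j
  exact IsD.inner_swap (h2 k k) (h2 i k) (smooth.isD_apply hb (h2 k j))
    (smooth.isD_apply hb (h2 i j))

theorem exists_bound_family {ι : Type*} [Fintype ι] (F : ι → Op d) :
    ∃ M : ℝ, 0 ≤ M ∧ ∀ i, ‖F i‖ ≤ M :=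
  ⟨∑ i, ‖F i‖, Finset.sum_nonneg fun _ _ => norm_nonneg _, fun i =>
    Finset.single_le_sum (f := fun i => ‖F i‖) (fun _ _ => norm_nonneg _) (Finset.mem_univ i)⟩

theorem norm_sum_form_le {M : ℝ} {m : Fin d → Fin d → Fin d → Op d}
    (hM : ∀ k i j, ‖m k i j‖ ≤ M) (η : Fin d → Fin d → L2 d) (ζ : Fin d → L2 d)
    {ε : ℝ} (hε : 0 < ε) :
    ‖∑ k, form (m k) (η k) ζ‖ ≤ ε * (∑ k, ∑ i, ‖η k i‖ ^ 2) +
      d ^ 3 * M ^ 2 / (4 * ε) * ∑ j, ‖ζ j‖ ^ 2 := by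
  rcases Nat.eq_zero_or_pos d with hd | hd
  · subst hd; simp
  have hd' : (0 : ℝ) < d := by exact_mod_cast hd
  -- each term is split by `a b ≤ (ε / d) a² + (d / 4ε) b²`, the sums having `d³` terms
  have h1 : ∀ k i j, M * (‖η k i‖ * ‖ζ j‖) ≤
      ε / d * ‖η k i‖ ^ 2 + d * M ^ 2 / (4 * ε) * ‖ζ j‖ ^ 2 := fun k i j => by
    have h := sq_nonneg (2 * ε * ‖η k i‖ - d * M * ‖ζ j‖)
    have : ε / d * ‖η k i‖ ^ 2 + d * M ^ 2 / (4 * ε) * ‖ζ j‖ ^ 2 - M * (‖η k i‖ * ‖ζ j‖)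
        = (2 * ε * ‖η k i‖ - d * M * ‖ζ j‖) ^ 2 / (4 * ε * d) := by
      field_simp
      ring
    have h2 : 0 ≤ (2 * ε * ‖η k i‖ - d * M * ‖ζ j‖) ^ 2 / (4 * ε * d) := by positivity
    linarith
  calc ‖∑ k, form (m k) (η k) ζ‖ ≤ ∑ k, M * ∑ i, ∑ j, ‖η k i‖ * ‖ζ j‖ :=
        norm_sum_le_of_le _ fun k _ => norm_form_le (m k) (hM k) _ _
    _ = ∑ k, ∑ i, ∑ j, M * (‖η k i‖ * ‖ζ j‖) := by simp only [Finset.mul_sum]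
    _ ≤ ∑ k : Fin d, ∑ i, ∑ j, (ε / d * ‖η k i‖ ^ 2 + d * M ^ 2 / (4 * ε) * ‖ζ j‖ ^ 2) :=
        Finset.sum_le_sum fun k _ => Finset.sum_le_sum fun i _ => Finset.sum_le_sum fun j _ =>
          h1 k i j
    _ = _ := by
        simp only [Finset.sum_add_distrib, Finset.sum_const, Finset.card_univ, Fintype.card_fin,
          nsmul_eq_mul, ← Finset.mul_sum]
        field_simp

theorem norm_sum_inner_le {M : ℝ} {m : Fin d → Op d} (hM : ∀ k, ‖m k‖ ≤ M) (hM0 : 0 ≤ M)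
    (η : Fin d → L2 d) (u : L2 d) :
    ‖∑ k, inner ℂ (η k) (m k u)‖ ≤ M * ∑ k, ‖η k‖ ^ 2 + d * M * ‖u‖ ^ 2 := by
  calc ‖∑ k, inner ℂ (η k) (m k u)‖ ≤ ∑ k, (M * ‖η k‖ ^ 2 + M * ‖u‖ ^ 2) := by
        refine norm_sum_le_of_le _ fun k _ => (norm_inner_le_norm _ _).trans ?_
        have h1 := (m k).le_of_opNorm_le (hM k) u
        have h2 := mul_le_mul_of_nonneg_left h1 (norm_nonneg (η k))
        nlinarith [mul_nonneg hM0 (sq_nonneg (‖η k‖ - ‖u‖)),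
          mul_nonneg hM0 (sq_nonneg (‖η k‖)), mul_nonneg hM0 (sq_nonneg ‖u‖)]
    _ = _ := by
        simp only [Finset.sum_add_distrib, Finset.sum_const, Finset.card_univ, Fintype.card_fin,
          nsmul_eq_mul, ← Finset.mul_sum]
        ring

/-- The a priori estimate behind the resolvent: pairing `(L + z ν) u` with `κ u + ∑ D_k² u`
controls all derivatives of `u` up to order two once `κ` is large. -/
theorem exists_coercive (hg : IsRiemannianMetric θ g) {z : ℂ} (hz : z ∈ Complex.slitPlane) :
    ∃ κ c : ℝ, 1 ≤ κ ∧ 0 < c ∧ ∀ (u : L2 d) (u1 : Fin d → L2 d) (u2 : Fin d → Fin d → L2 d),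
      (∀ j, IsD j u (u1 j)) → (∀ k j, IsD k (u1 j) (u2 k j)) →
      c * ‖u + ∑ k, u2 k k‖ ^ 2 ≤ ‖inner ℂ ((κ : ℂ) • u + ∑ k, u2 k k)
        (divForm θ g u1 u2 + z • nu g u)‖ := by
  -- the commutator terms are at most `ε Y + K X + ‖z‖ (M' X + d M' W)` in terms of the sums
  -- `W`, `X`, `Y` of the squares of the derivatives of order `0`, `1`, `2`; half of the coercivity
  -- absorbs `ε Y`, and `κ`, which multiplies the coercivity of `X` and `W`, absorbs the rest
  obtain ⟨c, hc, hb⟩ := bcoef_elliptic hg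
  obtain ⟨c', hc', hν⟩ := lowerBound_nu hg
  obtain ⟨δ, hδ, hδz⟩ := exists_norm_add_mul_ge hz
  obtain ⟨M, hM0, hM⟩ := exists_bound_family
    fun p : Fin d × Fin d × Fin d => der θ p.1 (bcoef g p.2.1 p.2.2)
  obtain ⟨M', hM0', hM'⟩ := exists_bound_family fun k : Fin d => der θ k (nu g)
  set ε := δ * c / 2 with hε
  have hε0 : 0 < ε := by positivity
  set K := d ^ 3 * M ^ 2 / (4 * ε) with hK
  have hK0 : 0 ≤ K := by positivity
  set κ := 1 + (K + ‖z‖ * M') / (δ * c) + (1 + ‖z‖ * (d * M')) / (δ * c') with hκ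
  have hA : 0 ≤ (K + ‖z‖ * M') / (δ * c) := by positivity
  have hB : 0 ≤ (1 + ‖z‖ * (d * M')) / (δ * c') := by positivity
  have hκ1 : 1 ≤ κ := by linarith
  have hκA : K + ‖z‖ * M' ≤ δ * (κ * c) := by
    have : (K + ‖z‖ * M') / (δ * c) ≤ κ := by linarith
    rw [div_le_iff₀ (by positivity)] at this
    linarith
  have hκB : 1 + ‖z‖ * (d * M') ≤ δ * (κ * c') := by
    have : (1 + ‖z‖ * (d * M')) / (δ * c') ≤ κ := by linarith
    rw [div_le_iff₀ (by positivity)] at this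
    linarith
  clear_value κ K
  refine ⟨κ, min 1 ε / (2 * (d + 1)), hκ1, by positivity, fun u u1 u2 h1 h2 => ?_⟩
  set W := ‖u‖ ^ 2 with hW
  set X := ∑ j, ‖u1 j‖ ^ 2 with hX
  set Y := ∑ k, ∑ i, ‖u2 k i‖ ^ 2 with hY
  have hX0 : 0 ≤ X := Finset.sum_nonneg fun _ _ => sq_nonneg _
  have hY0 : 0 ≤ Y := Finset.sum_nonneg fun _ _ => Finset.sum_nonneg fun _ _ => sq_nonneg _
  have hW0 : 0 ≤ W := sq_nonneg _
  have hνs := nu_mem_smooth hg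
  obtain ⟨B0, hB0, hB0'⟩ := hb u1
  choose B1 hB1 hB1' using fun k => hb (u2 k)
  obtain ⟨N0, hN0, hN0'⟩ := hν u
  choose N1 hN1 hN1' using fun k => hν (u1 k)
  set E1 := ∑ k, form (fun i j => der θ k (bcoef g i j)) (u2 k) u1 with hE1
  set E2 := ∑ k, inner ℂ (u1 k) (der θ k (nu g) u) with hE2
  have hid : inner ℂ ((κ : ℂ) • u + ∑ k, u2 k k) (divForm θ g u1 u2 + z • nu g u) =
      (((κ * B0 + ∑ k, B1 k : ℝ) : ℂ) + z * ((κ * N0 + ∑ k, N1 k : ℝ) : ℂ)) + (E1 + z * E2) := by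
    have e1 : inner ℂ u (divForm θ g u1 u2) = B0 := by rw [inner_divForm hg h2 h1, hB0]
    have e2 : ∀ k, inner ℂ (u2 k k) (divForm θ g u1 u2) =
        B1 k + form (fun i j => der θ k (bcoef g i j)) (u2 k) u1 := fun k => by
      rw [inner_secondDeriv_divForm hg h1 h2, hB1]
    have e3 : ∀ k, inner ℂ (u2 k k) (nu g u) = N1 k + inner ℂ (u1 k) (der θ k (nu g) u) :=
      fun k => by
        rw [← IsD.inner_symm (h2 k k) (smooth.isD_apply hνs (h1 k)), inner_add_right, hN1]
    simp only [inner_add_left, inner_add_right, inner_smul_left, inner_smul_right, sum_inner,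
      e1, e2, e3, hN0, Finset.sum_add_distrib, Complex.conj_ofReal, hE1, hE2]
    push_cast
    ring
  have hE1b : ‖E1‖ ≤ ε * Y + K * X := by
    rw [hK]
    exact norm_sum_form_le (fun k i j => hM (k, i, j)) u2 u1 hε0
  have hE2b : ‖E2‖ ≤ M' * X + d * M' * W := norm_sum_inner_le hM' hM0' u1 u
  rw [← hX] at hB0'
  rw [← hW] at hN0'
  set SB := ∑ k, B1 k
  set SN := ∑ k, N1 k
  clear_value E1 E2
  have hB1s : c * Y ≤ SB := by
    rw [hY, Finset.mul_sum]
    exact Finset.sum_le_sum fun k _ => hB1' k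
  have hN1s : 0 ≤ SN :=
    Finset.sum_nonneg fun k _ => (by positivity : 0 ≤ c' * ‖u1 k‖ ^ 2).trans (hN1' k)
  have hκ0 : 0 ≤ κ := by linarith
  clear_value W X Y SB SN
  have hP : κ * (c * X) + c * Y ≤ κ * B0 + SB :=
    add_le_add (mul_le_mul_of_nonneg_left hB0' hκ0) hB1s
  have hN : κ * (c' * W) ≤ κ * N0 + SN := by
    have := mul_le_mul_of_nonneg_left hN0' hκ0
    linarith
  have hmain := hδz (κ * B0 + SB) (κ * N0 + SN)
    ((add_nonneg (mul_nonneg hκ0 (mul_nonneg hc.le hX0)) (mul_nonneg hc.le hY0)).trans hP)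
    ((mul_nonneg hκ0 (mul_nonneg hc'.le hW0)).trans hN)
  have hE : ‖E1 + z * E2‖ ≤ ε * Y + K * X + ‖z‖ * (M' * X + d * M' * W) := by
    refine (norm_add_le _ _).trans (add_le_add hE1b ?_)
    rw [norm_mul]
    exact mul_le_mul_of_nonneg_left hE2b (norm_nonneg _)
  have hlow : ε * Y + W ≤ ‖inner ℂ ((κ : ℂ) • u + ∑ k, u2 k k)
      (divForm θ g u1 u2 + z • nu g u)‖ := by
    rw [hid]
    have htri := norm_sub_le ((((κ * B0 + SB : ℝ) : ℂ) +
      z * ((κ * N0 + SN : ℝ) : ℂ)) + (E1 + z * E2)) (E1 + z * E2)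
    rw [add_sub_cancel_right] at htri
    have hδP := mul_le_mul_of_nonneg_left (add_le_add hP hN) hδ.le
    have t1 := mul_le_mul_of_nonneg_right hκA hX0
    have t2 := mul_le_mul_of_nonneg_right hκB hW0
    have t3 : δ * c * Y = 2 * ε * Y := by rw [hε]; ring
    linarith
  refine le_trans ?_ hlow
  have hv : ‖u + ∑ k, u2 k k‖ ^ 2 ≤ 2 * (d + 1) * (W + Y) := by
    have hs : ‖∑ k, u2 k k‖ ^ 2 ≤ d * Y := by
      calc ‖∑ k, u2 k k‖ ^ 2 ≤ (∑ k, ‖u2 k k‖) ^ 2 :=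
            pow_le_pow_left₀ (norm_nonneg _) (norm_sum_le _ _) 2
        _ ≤ d * ∑ k, ‖u2 k k‖ ^ 2 := by
            simpa using sq_sum_le_card_mul_sum_sq (s := Finset.univ) (f := fun k => ‖u2 k k‖)
        _ ≤ d * Y := by
            rw [hY]
            refine mul_le_mul_of_nonneg_left (Finset.sum_le_sum fun k _ => ?_) (by positivity)
            exact Finset.single_le_sum (f := fun i => ‖u2 k i‖ ^ 2) (fun _ _ => sq_nonneg _)
              (Finset.mem_univ k)
    have ht : ‖u + ∑ k, u2 k k‖ ^ 2 ≤ 2 * W + 2 * ‖∑ k, u2 k k‖ ^ 2 := by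
      have h := pow_le_pow_left₀ (norm_nonneg _) (norm_add_le u (∑ k, u2 k k)) 2
      have h' := add_sq_le (a := ‖u‖) (b := ‖∑ k, u2 k k‖)
      rw [hW]
      linarith
    have := mul_nonneg (Nat.cast_nonneg (α := ℝ) d) hW0
    linarith
  calc min 1 ε / (2 * (d + 1)) * ‖u + ∑ k, u2 k k‖ ^ 2
      ≤ min 1 ε / (2 * (d + 1)) * (2 * (d + 1) * (W + Y)) :=
        mul_le_mul_of_nonneg_left hv (by positivity)
    _ = min 1 ε * Y + min 1 ε * W := by field_simp; ring
    _ ≤ ε * Y + W := by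
      have := mul_le_mul_of_nonneg_right (min_le_right 1 ε) hY0
      have := mul_le_mul_of_nonneg_right (min_le_left 1 ε) hW0
      linarith

end Resolvent

/-! ### The inverse of `A_g + z` -/

section Parametrix

variable {d : ℕ} {θ : Matrix (Fin d) (Fin d) ℝ} {g : (Matrix (Fin d) (Fin d) (Op d))ˣ}

theorem one_add_normSq_pos (n : Fin d → ℤ) : 0 < 1 + normSq n := by
  have := normSq_nonneg n
  linarith

theorem norm_invOneAdd_mul_le (n : Fin d → ℤ) {a : ℂ} (ha : ‖a‖ ≤ 1 + normSq n) :
    ‖a * ((1 + normSq n : ℝ) : ℂ)⁻¹‖ ≤ 1 := by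
  have h := one_add_normSq_pos n
  rw [norm_mul, norm_inv, Complex.norm_real, Real.norm_of_nonneg h.le, ← div_eq_mul_inv,
    div_le_one h]
  exact ha

variable (d) in
/-- The inverse `(1 + ∑ D_k²)⁻¹` of the flat Laplacian. -/
def flatInv : Op d := diag (fun n => 1 * ((1 + normSq n : ℝ) : ℂ)⁻¹) 1 fun n =>
  norm_invOneAdd_mul_le n (by rw [norm_one]; linarith [normSq_nonneg n])

/-- The bounded operator `D_j (1 + ∑ D_k²)⁻¹`. -/
def flatInv1 (j : Fin d) : Op d := diag (fun n => (n j : ℂ) * ((1 + normSq n : ℝ) : ℂ)⁻¹) 1 fun n =>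
  norm_invOneAdd_mul_le n (by
    rw [Complex.norm_intCast]
    nlinarith [sq_le_normSq n j, sq_nonneg (|(n j : ℝ)| - 1), sq_abs (n j : ℝ)])

/-- The bounded operator `D_k D_j (1 + ∑ D_k²)⁻¹`. -/
def flatInv2 (k j : Fin d) : Op d :=
  diag (fun n => (n k * n j : ℂ) * ((1 + normSq n : ℝ) : ℂ)⁻¹) 1 fun n =>
  norm_invOneAdd_mul_le n (by
    rw [norm_mul, Complex.norm_intCast, Complex.norm_intCast]
    nlinarith [sq_le_normSq n j, sq_le_normSq n k, sq_nonneg (|(n j : ℝ)| - |(n k : ℝ)|),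
      sq_abs (n j : ℝ), sq_abs (n k : ℝ)])

theorem isD_flatInv (v : L2 d) (j : Fin d) : IsD j (flatInv d v) (flatInv1 j v) := fun n => by
  simp only [flatInv, flatInv1, diag_apply]
  ring

theorem isD_flatInv1 (v : L2 d) (k j : Fin d) : IsD k (flatInv1 j v) (flatInv2 k j v) := fun n => by
  simp only [flatInv1, flatInv2, diag_apply]
  ring

theorem flatInv_mem_sobolev_two (v : L2 d) : flatInv d v ∈ sobolev d 2 :=
  mem_sobolev_two_iff.mpr fun j => ⟨_, isD_flatInv v j,
    mem_sobolev_one_iff.mpr fun k => ⟨_, isD_flatInv1 v k j⟩⟩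

theorem flatInv_add_sum_apply (v : L2 d) : flatInv d v + ∑ k, flatInv2 k k v = v := by
  ext n
  have h : ((1 + normSq n : ℝ) : ℂ) ≠ 0 := by exact_mod_cast (one_add_normSq_pos n).ne'
  rw [lp.coeFn_add, Pi.add_apply, lp.coeFn_sum, Finset.sum_apply]
  simp only [flatInv, flatInv2, diag_apply]
  rw [← Finset.sum_mul, ← Finset.sum_mul, ← add_mul, ← add_mul]
  have h2 : (1 + ∑ k, (n k * n k : ℂ)) = ((1 + normSq n : ℝ) : ℂ) := by
    rw [normSq]
    push_cast
    simp only [sq]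
  rw [h2, mul_inv_cancel₀ h, one_mul]

/-- Every vector of `W^{2,2}` is of the form `(1 + ∑ D_k²)⁻¹ v`. -/
theorem exists_flatInv_eq {ξ : L2 d} (hξ : ξ ∈ sobolev d 2) : ∃ v, flatInv d v = ξ := by
  choose w hw hw1 using mem_sobolev_two_iff.mp hξ
  choose y hy using fun j => mem_sobolev_one_iff.mp (hw1 j) j
  refine ⟨ξ + ∑ j, y j, ?_⟩
  ext n
  have h : ((1 + normSq n : ℝ) : ℂ) ≠ 0 := by exact_mod_cast (one_add_normSq_pos n).ne'
  simp only [flatInv, diag_apply]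
  rw [lp.coeFn_add, Pi.add_apply, lp.coeFn_sum, Finset.sum_apply]
  have h1 : ∀ j, (y j : L2 d) n = (n j * n j : ℂ) * ξ n := fun j => by
    rw [hy j n, hw j n, mul_assoc]
  have h2 : (1 + ∑ k, (n k * n k : ℂ)) = ((1 + normSq n : ℝ) : ℂ) := by
    rw [normSq]
    push_cast
    simp only [sq]
  have h3 : ξ n + ∑ j, (n j * n j : ℂ) * ξ n = ((1 + normSq n : ℝ) : ℂ) * ξ n := by
    rw [← h2, add_mul, one_mul, Finset.sum_mul]
  simp only [h1]
  rw [h3]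
  field_simp

theorem inner_flatInv_left (v w : L2 d) :
    inner ℂ (flatInv d v) w = inner ℂ v (flatInv d w) := by
  rw [inner_eq_tsum, inner_eq_tsum]
  refine tsum_congr fun n => ?_
  simp only [flatInv, diag_apply, map_mul, map_inv₀, Complex.conj_ofReal, map_one]
  ring

theorem inner_flatInv_self (v : L2 d) : ∃ r : ℝ, 0 ≤ r ∧ inner ℂ v (flatInv d v) = r := by
  refine ⟨‖flatInv d v‖ ^ 2 + ∑ j, ‖flatInv1 j v‖ ^ 2, by positivity, ?_⟩
  have h1 : ∀ k, inner ℂ (flatInv2 k k v) (flatInv d v) = ((‖flatInv1 k v‖ : ℂ) ^ 2) := fun k => by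
    rw [← IsD.inner_symm (isD_flatInv1 v k k) (isD_flatInv v k), inner_self_eq_norm_sq_to_K]
    rfl
  calc inner ℂ v (flatInv d v)
      = inner ℂ (flatInv d v + ∑ k, flatInv2 k k v) (flatInv d v) := by
        rw [flatInv_add_sum_apply]
    _ = _ := by
        rw [inner_add_left, sum_inner, inner_self_eq_norm_sq_to_K]
        simp only [h1]
        push_cast
        rfl

variable (θ g) in
/-- The bounded operator `(L + z ν) (1 + ∑ D_k²)⁻¹`, where `L = ∑ D_i b_ij D_j`. -/
def lapFlatInv (z : ℂ) : Op d :=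
  (∑ i, ∑ j, (bcoef g i j * flatInv2 i j + der θ i (bcoef g i j) * flatInv1 j)) +
    z • (nu g * flatInv d)

theorem lapFlatInv_apply (z : ℂ) (v : L2 d) : lapFlatInv θ g z v =
    divForm θ g (fun j => flatInv1 j v) (fun i j => flatInv2 i j v) + z • nu g (flatInv d v) := by
  simp only [lapFlatInv, divForm, sum_apply, add_apply, smul_apply, mul_apply_eq_comp]

theorem isUnit_lapFlatInv (hg : IsRiemannianMetric θ g) {z : ℂ} (hz : z ∈ Complex.slitPlane) :
    IsUnit (lapFlatInv θ g z) := by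
  obtain ⟨κ, c, hκ, hc, h⟩ := exists_coercive hg hz
  -- `E = (κ + ∑ D_k²) (1 + ∑ D_k²)⁻¹`
  set E : Op d := 1 + ((κ - 1 : ℝ) : ℂ) • flatInv d with hE
  have hEv : ∀ v, E v = (κ : ℂ) • flatInv d v + ∑ k, flatInv2 k k v := fun v => by
    rw [hE, add_apply, smul_apply, one_apply_eq_self]
    conv_lhs => enter [1]; rw [← flatInv_add_sum_apply v]
    push_cast
    module
  have hEu : IsUnit E := by
    refine (isUnit_of_coercive one_pos fun v => ?_).1
    obtain ⟨r, hr, hv⟩ := inner_flatInv_self v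
    rw [hE, add_apply, smul_apply, one_apply_eq_self, inner_add_right, inner_smul_right, hv,
      inner_self_eq_norm_sq_to_K]
    have : ((‖v‖ : ℂ) ^ 2 + ((κ - 1 : ℝ) : ℂ) * r) = ((‖v‖ ^ 2 + (κ - 1) * r : ℝ) : ℂ) := by
      push_cast; ring
    have h0 : 0 ≤ (κ - 1) * r := mul_nonneg (by linarith) hr
    erw [this]
    rw [Complex.norm_real, Real.norm_of_nonneg (by positivity)]
    linarith
  have hET : IsUnit (E * lapFlatInv θ g z) := by
    refine (isUnit_of_coercive hc fun v => ?_).1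
    have h1 := h (flatInv d v) (fun j => flatInv1 j v) (fun i j => flatInv2 i j v)
      (isD_flatInv v) (isD_flatInv1 v)
    rw [flatInv_add_sum_apply, ← hEv, ← lapFlatInv_apply] at h1
    refine h1.trans (le_of_eq ?_)
    rw [mul_apply_eq_comp, hE]
    simp only [add_apply, smul_apply, one_apply_eq_self, inner_add_left, inner_add_right,
      inner_smul_left, inner_smul_right, inner_flatInv_left, Complex.conj_ofReal]
  have := hEu.unit⁻¹.isUnit.mul hET
  rwa [← mul_assoc, IsUnit.val_inv_mul, one_mul] at this

theorem exists_isResolvent (hg : IsRiemannianMetric θ g) {z : ℂ} (hz : z ∈ Complex.slitPlane) :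
    ∃ R, IsResolvent (Ag g) z R := by
  have hT := isUnit_lapFlatInv hg hz
  set T := lapFlatInv θ g z with hTdef
  have hq := nuNegHalf_mem_smooth hg
  have hqh : ∀ ξ, nuNegHalf g (nuHalf g ξ) = ξ := fun ξ =>
    congrArg (fun S : Op d => S ξ) (nuNegHalf_mul_nuHalf hg)
  have hhq : ∀ ξ, nuHalf g (nuNegHalf g ξ) = ξ := fun ξ =>
    congrArg (fun S : Op d => S ξ) (nuHalf_mul_nuNegHalf hg)
  have hnu : ∀ ξ, nu g ξ = nuHalf g (nuHalf g ξ) := fun ξ =>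
    congrArg (fun S : Op d => S ξ) (nuHalf_mul_nuHalf hg).symm
  -- `A_g + z = ν^{-1/2} (L + z ν) ν^{-1/2}` on `ν^{1/2} (1 + ∑ D_k²)⁻¹ v`
  have hA : ∀ v, nuHalf g (flatInv d v) ∈ sobolev d 2 ∧
      IsVal (Ag g) (nuHalf g (flatInv d v))
        (nuNegHalf g (T v) - z • nuHalf g (flatInv d v)) := fun v => by
    have h2 := smooth.mem_sobolev_two (nuHalf_mem_smooth hg) (flatInv_mem_sobolev_two v)
    refine ⟨h2, ?_⟩
    have h := isVal_Ag hg h2 (w := fun j => flatInv1 j v)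
      (v := fun i j => bcoef g i j (flatInv2 i j v) + der θ i (bcoef g i j) (flatInv1 j v))
      (fun j => by rw [hqh]; exact isD_flatInv v j)
      (fun i j => smooth.isD_apply (bcoef_mem_smooth hg i j) (isD_flatInv1 v i j))
    convert h using 1
    rw [hTdef, lapFlatInv_apply, map_add, map_smul, hnu, hqh, add_sub_cancel_right]
    rfl
  refine ⟨nuHalf g * flatInv d * Ring.inverse T * nuHalf g, fun ξ => ?_, fun η => ?_⟩
  · obtain ⟨-, h1, h2⟩ := hA (Ring.inverse T (nuHalf g ξ))
    refine ⟨h1, ?_⟩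
    have h3 : T (Ring.inverse T (nuHalf g ξ)) = nuHalf g ξ :=
      congrArg (fun S : Op d => S (nuHalf g ξ)) (Ring.mul_inverse_cancel T hT)
    rw [h3, hqh] at h2
    exact (congrArg (· + z • nuHalf g (flatInv d (Ring.inverse T (nuHalf g ξ)))) h2).trans
      (sub_add_cancel _ _)
  · obtain ⟨η, hη⟩ := η
    have hη2 : η ∈ sobolev d 2 := hη.1
    obtain ⟨v, hv⟩ := exists_flatInv_eq (smooth.mem_sobolev_two hq hη2)
    have hηv : η = nuHalf g (flatInv d v) := by rw [hv, hhq]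
    have h4 : Ag g ⟨η, hη⟩ + z • η = nuNegHalf g (T v) := by
      have h5 := (hA v).2
      rw [← hηv] at h5
      rw [IsVal.unique ⟨hη, rfl⟩ h5, sub_add_cancel]
    change (nuHalf g * flatInv d * Ring.inverse T * nuHalf g) (Ag g ⟨η, hη⟩ + z • η) = η
    rw [h4]
    change nuHalf g (flatInv d (Ring.inverse T (nuHalf g (nuNegHalf g (T v))))) = η
    have h6 : Ring.inverse T (T v) = v :=
      congrArg (fun S : Op d => S v) (Ring.inverse_mul_cancel T hT)
    rw [hhq, h6, hηv]

theorem isResolvent_resolv (hg : IsRiemannianMetric θ g) {z : ℂ} (hz : z ∈ Complex.slitPlane) :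
    IsResolvent (Ag g) z (resolv (Ag g) z) := by
  have h := exists_isResolvent hg hz
  unfold resolv
  rw [dif_pos h]
  exact h.choose_spec

theorem inner_Ag_nonneg (hg : IsRiemannianMetric θ g) {ξ η : L2 d} (h : IsVal (Ag g) ξ η) :
    ∃ a : ℝ, 0 ≤ a ∧ inner ℂ ξ η = a := by
  obtain ⟨c, hc, hb⟩ := bcoef_elliptic hg
  have hξ : ξ ∈ sobolev d 2 := h.mem.1
  obtain ⟨w, v, hw, -, hv, h'⟩ := exists_isVal_Ag hg hξ
  obtain ⟨a, ha, ha'⟩ := hb w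
  refine ⟨a, le_trans (by positivity) ha', ?_⟩
  rw [h.unique h', ← ha]
  have h1 := ContinuousLinearMap.adjoint_inner_left (nuNegHalf g) (∑ i, ∑ j, v i j) ξ
  rw [← ContinuousLinearMap.star_eq_adjoint, (isSelfAdjoint_nuNegHalf (g := g)).star_eq] at h1
  rw [← h1]
  simp only [form, inner_sum]
  exact Finset.sum_congr rfl fun i _ => Finset.sum_congr rfl fun j _ =>
    IsD.inner_symm (hw i) (hv i j)

theorem norm_resolv_le (hg : IsRiemannianMetric θ g) {z : ℂ} (hz0 : z ≠ 0) (hz : 0 ≤ z.re) :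
    ‖resolv (Ag g) z‖ ≤ ‖z‖⁻¹ := by
  have hz' : z ∈ Complex.slitPlane := by
    rcases hz.lt_or_eq with h | h
    · exact Or.inl h
    · exact Or.inr fun him => hz0 (Complex.ext h.symm him)
  have hR := isResolvent_resolv hg hz'
  refine ContinuousLinearMap.opNorm_le_bound _ (by positivity) fun ξ => ?_
  obtain ⟨h1, h2⟩ := hR.right_inv ξ
  set u := resolv (Ag g) z ξ with hu
  obtain ⟨a, ha, ha'⟩ := inner_Ag_nonneg hg (ξ := u) ⟨h1, rfl⟩
  have h3 : inner ℂ u ξ = (a : ℂ) + z * ((‖u‖ ^ 2 : ℝ) : ℂ) := by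
    conv_lhs => rw [← h2]
    rw [inner_add_right, inner_smul_right, ha', inner_self_eq_norm_sq_to_K]
    push_cast
    rfl
  have h4 := (norm_add_mul_ge_half hz ha (sq_nonneg ‖u‖)).2
  rw [← h3] at h4
  have h5 := h4.trans (norm_inner_le_norm u ξ)
  have hz1 : 0 < ‖z‖ := norm_pos_iff.mpr hz0
  rw [inv_mul_eq_div, le_div_iff₀ hz1]
  rcases (norm_nonneg u).eq_or_lt with h0 | h0
  · rw [← h0, zero_mul]; exact norm_nonneg _
  · refine le_of_mul_le_mul_left ?_ h0
    calc ‖u‖ * (‖u‖ * ‖z‖) = ‖z‖ * ‖u‖ ^ 2 := by ring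
      _ ≤ _ := h5

end Parametrix

/-! ### Conjugation by right multiplications and the splitting -/

section Splitting

variable {d : ℕ} {θ : Matrix (Fin d) (Fin d) ℝ} {g : (Matrix (Fin d) (Fin d) (Op d))ˣ}

theorem isD_rmul {j : Fin d} {ξ η : L2 d} (h : IsD j ξ η) (n : Fin d → ℤ) :
    IsD j (rmul θ n ξ) (rmul θ n (η + (n j : ℂ) • ξ)) := fun k => by
  rw [rmul_apply, rmul_apply, lp.coeFn_add, Pi.add_apply, lp.coeFn_smul, Pi.smul_apply,
    smul_eq_mul, h, Pi.sub_apply]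
  push_cast
  ring

theorem star_rmul_mul (n : Fin d → ℤ) : star (rmul θ n) * rmul θ n = 1 :=
  star_weightedShift_mul _ _ _

theorem star_rmul_rmul (n : Fin d → ℤ) (ξ : L2 d) : (star (rmul θ n)) (rmul θ n ξ) = ξ := by
  rw [← mul_apply_eq_comp, star_rmul_mul, one_apply_eq_self]

theorem norm_rmul_le (n : Fin d → ℤ) : ‖rmul θ n‖ ≤ 1 := by
  have h := CStarRing.norm_star_mul_self (x := rmul θ n)
  rw [star_rmul_mul] at h
  have h1 : ‖(1 : Op d)‖ ≤ 1 := ContinuousLinearMap.norm_id_le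
  nlinarith [norm_nonneg (rmul θ n)]

theorem der_add {x y : Op d} (hx : x ∈ smooth θ) (hy : y ∈ smooth θ) (j : Fin d) :
    der θ j (x + y) = der θ j x + der θ j y :=
  ((smooth.der hx j).1.add (smooth.der hy j).1).der_eq

theorem der_smul {x : Op d} (hx : x ∈ smooth θ) (c : ℂ) (j : Fin d) :
    der θ j (c • x) = c • der θ j x :=
  ((smooth.der hx j).1.smul c).der_eq

theorem smooth.rmul_apply {x : Op d} (hx : x ∈ smooth θ) (n : Fin d → ℤ) (ξ : L2 d) :
    x (rmul θ n ξ) = rmul θ n (x ξ) :=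
  (congrArg (fun T : Op d => T ξ) (rmul_mul_of_mem θ hx.1 n)).symm

/-- Conjugating `A_g` by `λ_r(e_n)` replaces each `D_j` by `D_j + n_j`, which turns `A_g` into
`x(n) + V(n) + A_g`. -/
theorem isVal_Ag_rmul (hg : IsRiemannianMetric θ g) {a : Op d} (ha : a ∈ smooth θ)
    (n : Fin d → ℤ) : IsVal (Ag g) (rmul θ n (a (vac d)))
      (rmul θ n ((xs g (fun i => (n i : ℝ)) * a + firstOp θ g (fun i => (n i : ℝ)) a +
        lapOp θ g a) (vac d))) := by
  have hq := nuNegHalf_mem_smooth hg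
  have hqa := smooth_mul hq ha
  have hb := bcoef_mem_smooth hg
  set c : Fin d → Op d := fun j => der θ j (nuNegHalf g * a) + (n j : ℂ) • (nuNegHalf g * a) with hc
  have hcs : ∀ j, c j ∈ smooth θ := fun j => smooth_add (smooth.der hqa j).2 (smooth_smul hqa _)
  have hmem : rmul θ n (a (vac d)) ∈ sobolev d 2 := by
    have h := smooth.vac_mem_sobolev_two ha
    rw [mem_sobolev_two_iff] at h ⊢
    intro j
    obtain ⟨η, hη, hη1⟩ := h j
    refine ⟨_, isD_rmul hη n, mem_sobolev_one_iff.mpr fun k => ?_⟩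
    obtain ⟨η', hη'⟩ := mem_sobolev_one_iff.mp ((sobolev d 1).add_mem hη1
      ((sobolev d 1).smul_mem (n j : ℂ) (sobolev_two_le_one (smooth.vac_mem_sobolev_two ha)))) k
    exact ⟨_, isD_rmul hη' n⟩
  have h := isVal_Ag hg hmem (w := fun j => rmul θ n (c j (vac d)))
    (v := fun i j => rmul θ n ((der θ i (bcoef g i j * c j) +
      (n i : ℂ) • (bcoef g i j * c j)) (vac d)))
    (fun j => by
      rw [smooth.rmul_apply hq]
      exact isD_rmul (smooth.isD_vac hqa j) n)
    (fun i j => by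
      rw [smooth.rmul_apply (hb i j)]
      exact isD_rmul (smooth.isD_vac (smooth_mul (hb i j) (hcs j)) i) n)
  convert h using 1
  have hterm : ∀ i j, nuNegHalf g * (der θ i (bcoef g i j * c j) +
      (n i : ℂ) • (bcoef g i j * c j)) =
      nuNegHalf g * der θ i (bcoef g i j * der θ j (nuNegHalf g * a)) +
      (n j : ℂ) • (nuNegHalf g * der θ i (nuHalf g * g.inv i j * a)) +
      ((n i : ℂ) • (g.inv i j * nuHalf g * der θ j (nuNegHalf g * a)) +
      ((n i * n j : ℂ)) • (g.inv i j * a)) := fun i j => by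
    have h1 : bcoef g i j * (nuNegHalf g * a) = nuHalf g * g.inv i j * a := by
      rw [bcoef, mul_assoc, ← mul_assoc (nuHalf g) (nuNegHalf g), nuHalf_mul_nuNegHalf hg, one_mul]
    have h2 : ∀ x : Op d, nuNegHalf g * (bcoef g i j * x) = g.inv i j * nuHalf g * x := fun x => by
      rw [bcoef, ← mul_assoc, ← mul_assoc, ← mul_assoc, nuNegHalf_mul_nuHalf hg, one_mul]
    have h3 : g.inv i j * nuHalf g * (nuNegHalf g * a) = g.inv i j * a := by
      rw [mul_assoc, ← mul_assoc (nuHalf g), nuHalf_mul_nuNegHalf hg, one_mul]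
    have h4 : bcoef g i j * c j = bcoef g i j * der θ j (nuNegHalf g * a) +
        (n j : ℂ) • (nuHalf g * g.inv i j * a) := by
      rw [hc, mul_add, mul_smul_comm, h1]
    rw [mul_add, mul_smul_comm, h2]
    rw [h4, der_add (smooth_mul (hb i j) (smooth.der hqa j).2) (h1 ▸ smooth_smul
      (smooth_mul (hb i j) hqa) _), der_smul (h1 ▸ smooth_mul (hb i j) hqa), mul_add,
      mul_smul_comm, hc, mul_add, mul_smul_comm, h3, smul_add, smul_smul]
  have hsum : xs g (fun i => (n i : ℝ)) * a + firstOp θ g (fun i => (n i : ℝ)) a + lapOp θ g a =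
      ∑ i, ∑ j, nuNegHalf g * (der θ i (bcoef g i j * c j) +
        (n i : ℂ) • (bcoef g i j * c j)) := by
    simp only [hterm, Finset.sum_add_distrib, xs, firstOp, lapOp, Finset.sum_mul, smul_mul_assoc,
      smul_add, Finset.smul_sum]
    rw [Finset.sum_comm (f := fun i j => (n j : ℂ) •
      (nuNegHalf g * der θ i (nuHalf g * g.inv i j * a)))]
    push_cast
    abel
  rw [hsum]
  simp only [sum_apply, map_sum, mul_apply_eq_comp, smooth.rmul_apply hq]

theorem xs_mem_smooth (hg : IsRiemannianMetric θ g) (s : Fin d → ℝ) : xs g s ∈ smooth θ :=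
  smooth_sum fun i _ => smooth_sum fun j _ => smooth_smul (hg.smooth_inv_entry i j) _

theorem xInv_mem_smooth (hg : IsRiemannianMetric θ g) (s : Fin d → ℝ) (z : ℂ) :
    xInv g s z ∈ smooth θ :=
  smooth_inverse (smooth_add (xs_mem_smooth hg s) (smooth_smul_one z))

variable (θ g) in
/-- The smooth element `x_m(s,z)`, as an operator. -/
def xmOp (s : Fin d → ℝ) (z : ℂ) : ℕ → Op d
  | 0 => 1
  | m + 1 => firstOp θ g s (xInv g s z * xmOp s z m) + lapOp θ g (xInv g s z * xmOp s z m)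

variable (θ g) in
/-- The smooth element `x_m^𝒜(s,z)`, as an operator. -/
def xmAOp (𝒜 : Finset ℕ) (s : Fin d → ℝ) (z : ℂ) : ℕ → Op d
  | 0 => 1
  | m + 1 =>
    if m + 1 ∈ 𝒜 then firstOp θ g s (xInv g s z * xmAOp 𝒜 s z m)
    else lapOp θ g (xInv g s z * xmAOp 𝒜 s z m)

theorem one_mem_smooth : (1 : Op d) ∈ smooth θ := by
  simpa using smooth_smul_one (θ := θ) (1 : ℂ)

theorem xmOp_mem_smooth (hg : IsRiemannianMetric θ g) (s : Fin d → ℝ) (z : ℂ) (m : ℕ) :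
    xmOp θ g s z m ∈ smooth θ := by
  induction m with
  | zero => exact one_mem_smooth
  | succ m ih =>
    have h := smooth_mul (xInv_mem_smooth hg s z) ih
    exact smooth_add (firstOp_mem_smooth hg s h) (lapOp_mem_smooth hg h)

theorem xmAOp_mem_smooth (hg : IsRiemannianMetric θ g) (𝒜 : Finset ℕ) (s : Fin d → ℝ) (z : ℂ)
    (m : ℕ) : xmAOp θ g 𝒜 s z m ∈ smooth θ := by
  induction m with
  | zero => exact one_mem_smooth
  | succ m ih =>
    have h := smooth_mul (xInv_mem_smooth hg s z) ih
    rw [xmAOp]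
    split_ifs
    exacts [firstOp_mem_smooth hg s h, lapOp_mem_smooth hg h]

theorem xmOp_vac (hg : IsRiemannianMetric θ g) (s : Fin d → ℝ) (z : ℂ) (m : ℕ) :
    xmOp θ g s z m (vac d) = xm g s z m := by
  induction m with
  | zero => rfl
  | succ m ih =>
    have h := smooth_mul (xInv_mem_smooth hg s z) (xmOp_mem_smooth hg s z m)
    rw [xm, ← ih]
    exact ((isVal_V_smooth hg s h).add (isVal_Ag_smooth hg h)).value.symm

theorem xmAOp_vac (hg : IsRiemannianMetric θ g) (𝒜 : Finset ℕ) (s : Fin d → ℝ) (z : ℂ) (m : ℕ) :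
    xmAOp θ g 𝒜 s z m (vac d) = xmA g 𝒜 s z m := by
  induction m with
  | zero => rfl
  | succ m ih =>
    have h := smooth_mul (xInv_mem_smooth hg s z) (xmAOp_mem_smooth hg 𝒜 s z m)
    rw [xmA, xmAOp, ← ih]
    split_ifs
    · exact (isVal_V_smooth hg s h).value.symm
    · exact (isVal_Ag_smooth hg h).value.symm

theorem xInv_xm_mem_domain (hg : IsRiemannianMetric θ g) (s : Fin d → ℝ) (z : ℂ) (m : ℕ) :
    xInv g s z (xm g s z m) ∈ (V g s + Ag g).domain := by
  have h := smooth_mul (xInv_mem_smooth hg s z) (xmOp_mem_smooth hg s z m)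
  rw [← xmOp_vac hg]
  exact ((isVal_V_smooth hg s h).add (isVal_Ag_smooth hg h)).mem

theorem xInv_xmA_mem_domain (hg : IsRiemannianMetric θ g) (𝒜 : Finset ℕ) (s : Fin d → ℝ) (z : ℂ)
    (m : ℕ) : xInv g s z (xmA g 𝒜 s z m) ∈ (V g s + Ag g).domain := by
  have h := smooth_mul (xInv_mem_smooth hg s z) (xmAOp_mem_smooth hg 𝒜 s z m)
  rw [← xmAOp_vac hg]
  exact ((isVal_V_smooth hg s h).add (isVal_Ag_smooth hg h)).mem

/-- One step of the iterated resolvent identity. -/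
theorem conjResolv_xm (hg : IsRiemannianMetric θ g) (n : Fin d → ℤ) {z : ℂ}
    (hz : z ∈ Complex.slitPlane) (m : ℕ) :
    conjResolv g θ n z (xm g (fun i => (n i : ℝ)) z m) =
      xInv g (fun i => (n i : ℝ)) z (xm g (fun i => (n i : ℝ)) z m) -
        conjResolv g θ n z (xm g (fun i => (n i : ℝ)) z (m + 1)) := by
  set s : Fin d → ℝ := fun i => (n i : ℝ) with hs
  have hR := isResolvent_resolv hg hz
  set a := xInv g s z * xmOp θ g s z m with ha
  have hsm : a ∈ smooth θ := smooth_mul (xInv_mem_smooth hg s z) (xmOp_mem_smooth hg s z m)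
  obtain ⟨h1, h2⟩ := isVal_Ag_rmul hg hsm n
  have h3 := hR.left_inv ⟨_, h1⟩
  rw [h2] at h3
  have h4 : xs g s * a + firstOp θ g s a + lapOp θ g a + z • a =
      xmOp θ g s z m + xmOp θ g s z (m + 1) := by
    have h5 : (xs g s + z • 1) * a = xmOp θ g s z m := by
      rw [ha, ← mul_assoc, xInv, Ring.mul_inverse_cancel _ (isUnit_xs_add hg s hz), one_mul]
    rw [← h5, xmOp, ← ha, add_mul, smul_mul_assoc, one_mul]
    abel
  have h6 : (xs g s * a + firstOp θ g s a + lapOp θ g a) (vac d) + z • a (vac d) =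
      xm g s z m + xm g s z (m + 1) := by
    rw [← xmOp_vac hg, ← xmOp_vac hg, ← add_apply, ← h4]
    rfl
  change resolv (Ag g) z (rmul θ n ((xs g s * a + firstOp θ g s a + lapOp θ g a) (vac d)) +
    z • rmul θ n (a (vac d))) = rmul θ n (a (vac d)) at h3
  rw [← map_smul, ← map_add, h6] at h3
  have h7 := congrArg (fun v => (star (rmul θ n)) v) h3
  beta_reduce at h7
  rw [star_rmul_rmul, map_add, map_add, map_add] at h7
  rw [← xmOp_vac hg s z m, ← xmOp_vac hg s z (m + 1), eq_sub_iff_add_eq]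
  rw [← xmOp_vac hg s z m, ← xmOp_vac hg s z (m + 1)] at h7
  exact h7

/-- The resolvent identity iterated `M` times, starting from `x_0 = 1`. -/
theorem conjResolv_vac (hg : IsRiemannianMetric θ g) (n : Fin d → ℤ) {z : ℂ}
    (hz : z ∈ Complex.slitPlane) (M : ℕ) :
    conjResolv g θ n z (vac d) =
      xInv g (fun i => (n i : ℝ)) z (∑ m ∈ Finset.range M,
        (-1 : ℂ) ^ m • xm g (fun i => (n i : ℝ)) z m) +
      (-1 : ℂ) ^ M • conjResolv g θ n z (xm g (fun i => (n i : ℝ)) z M) := by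
  induction M with
  | zero => simp [xm]
  | succ M ih =>
    rw [ih, conjResolv_xm hg n hz M, Finset.sum_range_succ, map_add, map_smul, pow_succ]
    module

theorem IsVal.map_sum {H : Type*} [NormedAddCommGroup H] [InnerProductSpace ℂ H]
    {A : H →ₗ.[ℂ] H} {ι : Type*} {t : Finset ι} {ξ η : ι → H}
    (h : ∀ i ∈ t, IsVal A (ξ i) (η i)) : IsVal A (∑ i ∈ t, ξ i) (∑ i ∈ t, η i) := by
  classical
  induction t using Finset.induction_on with
  | empty => exact ⟨A.domain.zero_mem, A.map_zero⟩
  | insert i t hi ih =>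
    rw [Finset.sum_insert hi, Finset.sum_insert hi]
    obtain ⟨h1, h2⟩ := h i (Finset.mem_insert_self i t)
    obtain ⟨k1, k2⟩ := ih fun j hj => h j (Finset.mem_insert_of_mem hj)
    refine ⟨A.domain.add_mem h1 k1, ?_⟩
    rw [← h2, ← k2, ← A.map_add]
    rfl

/-- `x_m^𝒜` depends only on `𝒜 ∩ {1, …, m}`. -/
theorem xmA_congr {𝒜 ℬ : Finset ℕ} {m : ℕ} (h : ∀ k, 1 ≤ k → k ≤ m → (k ∈ 𝒜 ↔ k ∈ ℬ))
    (s : Fin d → ℝ) (z : ℂ) : xmA g 𝒜 s z m = xmA g ℬ s z m := by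
  induction m with
  | zero => rfl
  | succ m ih =>
    rw [xmA, xmA, ih fun k h1 h2 => h k h1 (h2.trans m.le_succ)]
    simp only [h (m + 1) (by omega) le_rfl]

/-- Expanding the product of the factors `V(s) + A_g`. -/
theorem xm_eq_sum_xmA (hg : IsRiemannianMetric θ g) (s : Fin d → ℝ) (z : ℂ) (m : ℕ) :
    xm g s z m = ∑ 𝒜 ∈ (Finset.Icc 1 m).powerset, xmA g 𝒜 s z m := by
  induction m with
  | zero => simp [xm, xmA]
  | succ m ih =>
    have hI : Finset.Icc 1 (m + 1) = insert (m + 1) (Finset.Icc 1 m) := by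
      ext k
      simp only [Finset.mem_Icc, Finset.mem_insert]
      omega
    have hnot : m + 1 ∉ Finset.Icc 1 m := by simp
    have hV : ∀ 𝒜 : Finset ℕ, IsVal (V g s) (xInv g s z (xmA g 𝒜 s z m))
        (value (V g s) (xInv g s z (xmA g 𝒜 s z m))) := fun 𝒜 => by
      have h := isVal_V_smooth hg s
        (smooth_mul (xInv_mem_smooth hg s z) (xmAOp_mem_smooth hg 𝒜 s z m))
      rw [mul_apply_eq_comp, xmAOp_vac hg] at h
      rwa [h.value]
    have hA : ∀ 𝒜 : Finset ℕ, IsVal (Ag g) (xInv g s z (xmA g 𝒜 s z m))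
        (value (Ag g) (xInv g s z (xmA g 𝒜 s z m))) := fun 𝒜 => by
      have h := isVal_Ag_smooth hg
        (smooth_mul (xInv_mem_smooth hg s z) (xmAOp_mem_smooth hg 𝒜 s z m))
      rw [mul_apply_eq_comp, xmAOp_vac hg] at h
      rwa [h.value]
    rw [xm, ih, map_sum, hI, Finset.sum_powerset_insert hnot]
    rw [((IsVal.map_sum fun 𝒜 _ => hV 𝒜).add (IsVal.map_sum fun 𝒜 _ => hA 𝒜)).value, add_comm]
    congr 1
    · refine Finset.sum_congr rfl fun 𝒜 h𝒜 => ?_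
      rw [xmA, if_neg fun h => hnot (Finset.mem_powerset.mp h𝒜 h)]
    · refine Finset.sum_congr rfl fun 𝒜 h𝒜 => ?_
      rw [xmA, if_pos (Finset.mem_insert_self _ _), xmA_congr (𝒜 := insert (m + 1) 𝒜) (ℬ := 𝒜)]
      intro k _ h2
      rw [Finset.mem_insert, or_iff_right (by omega)]

/-- Sorting the subsets `𝒜` of `{1, …, m}`, `m ≤ d`, by `k = 2m - |𝒜|`. -/
theorem sum_good (hg : IsRiemannianMetric θ g) (s : Fin d → ℝ) (z : ℂ) :
    ∑ k ∈ Finset.range (2 * d + 1), good g k s z =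
      xInv g s z (∑ m ∈ Finset.range (d + 1), (-1 : ℂ) ^ m • xm g s z m) := by
  unfold good
  rw [← map_sum]
  congr 1
  have hf : ∀ k, (Finset.range (min k d + 1)).filter (fun m => k ≤ 2 * m) =
      (Finset.range (d + 1)).filter (fun m => m ≤ k ∧ k ≤ 2 * m) := fun k => by
    ext m
    simp only [Finset.mem_filter, Finset.mem_range]
    omega
  simp only [hf, Finset.sum_filter]
  rw [Finset.sum_comm]
  refine Finset.sum_congr rfl fun m hm => ?_
  rw [Finset.mem_range] at hm
  rw [← Finset.sum_filter, ← Finset.smul_sum, xm_eq_sum_xmA hg, Finset.sum_powerset,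
    Nat.card_Icc, Nat.add_sub_cancel]
  congr 1
  refine Finset.sum_nbij' (fun k => 2 * m - k) (fun j => 2 * m - j) ?_ ?_ ?_ ?_ ?_
  · intro k hk
    simp only [Finset.mem_filter, Finset.mem_range] at hk ⊢
    omega
  · intro j hj
    simp only [Finset.mem_filter, Finset.mem_range] at hj ⊢
    omega
  · intro k hk
    simp only [Finset.mem_filter, Finset.mem_range] at hk
    omega
  · intro j hj
    simp only [Finset.mem_range] at hj
    omega
  · intro k _
    rfl

theorem splitting (hg : IsRiemannianMetric θ g) (n : Fin d → ℤ) {z : ℂ}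
    (hz : z ∈ Complex.slitPlane) :
    conjResolv g θ n z (vac d) =
      (∑ k ∈ Finset.range (2 * d + 1), good g k (fun i => (n i : ℝ)) z) +
        (-1 : ℂ) ^ (d + 1) • bad g θ n z := by
  rw [sum_good hg, conjResolv_vac hg n hz (d + 1)]
  rfl

end Splitting

/-! ### Analyticity of the good terms and the bound for the bad term -/

section Estimates

variable {d : ℕ} {θ : Matrix (Fin d) (Fin d) ℝ} {g : (Matrix (Fin d) (Fin d) (Op d))ˣ}
  {T : Type*} {R : Subalgebra ℂ (T → Op d)} {S : Set T} {w : T → ℝ} {a : T → Op d}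

theorem Tame.const_mul (hR : ∀ x : Op d, (fun _ : T => x) ∈ R) (h : Tame θ R S w a)
    {x : Op d} (hx : x ∈ smooth θ) : Tame θ R S w (fun t => x * a t) := by
  have := (Tame.const (S := S) (w := fun _ => 1) hR hx fun _ _ => le_rfl).mul h
  simpa using this

/-- `A_g` does not change the order of a family. -/
theorem Tame.lapOp (hg : IsRiemannianMetric θ g) (hR : ∀ x : Op d, (fun _ : T => x) ∈ R)
    (h : Tame θ R S w a) : Tame θ R S w (fun t => lapOp θ g (a t)) :=
  Tame.sum fun i _ => Tame.sum fun j _ =>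
    ((((h.const_mul hR (nuNegHalf_mem_smooth hg)).der j).const_mul hR
      (bcoef_mem_smooth hg i j)).der i).const_mul hR (nuNegHalf_mem_smooth hg)

/-- `V(s)` raises the order of a family by one. -/
theorem Tame.firstOp (hg : IsRiemannianMetric θ g) (hR : ∀ x : Op d, (fun _ : T => x) ∈ R)
    {s : T → Fin d → ℝ} (hs : ∀ i, (fun t => (s t i : ℂ) • (1 : Op d)) ∈ R) {ρ : T → ℝ}
    (hρ : ∀ t ∈ S, ∀ i, |s t i| ≤ ρ t) (h : Tame θ R S w a) :
    Tame θ R S (fun t => ρ t * w t) (fun t => firstOp θ g (s t) (a t)) := by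
  have hq := nuNegHalf_mem_smooth hg
  have hh := nuHalf_mem_smooth hg
  refine Tame.sum fun i _ => ?_
  have h1 : Tame θ R S ρ (fun t => (s t i : ℂ) • (1 : Op d)) := Tame.scalar _ (hs i) 1 fun t ht => by
    rw [Complex.norm_real, one_mul]
    exact hρ t ht i
  have h2 : Tame θ R S w (fun t =>
      (∑ j, g.inv i j * nuHalf g * NCTorus.der θ j (nuNegHalf g * a t)) +
        ∑ j, nuNegHalf g * NCTorus.der θ j (nuHalf g * g.inv j i * a t)) :=
    Tame.add
      (Tame.sum fun j _ => ((h.const_mul hR hq).der j).const_mul hR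
        (smooth_mul (hg.smooth_inv_entry i j) hh))
      (Tame.sum fun j _ => ((h.const_mul hR
        (smooth_mul hh (hg.smooth_inv_entry j i))).der j).const_mul hR hq)
  have h3 := h1.mul h2
  simpa only [smul_mul_assoc, one_mul] using h3

/-- Each step of the recursion for `x_m` multiplies the weight by that of `V(s) (x(s) + z)⁻¹`. -/
theorem tame_xmOp (hg : IsRiemannianMetric θ g) (hR : ∀ x : Op d, (fun _ : T => x) ∈ R)
    {s : T → Fin d → ℝ} {z : T → ℂ} (hs : ∀ i, (fun t => (s t i : ℂ) • (1 : Op d)) ∈ R)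
    {ρ r : T → ℝ} (hρ : ∀ t ∈ S, ∀ i, |s t i| ≤ ρ t) (hρ1 : ∀ t ∈ S, 1 ≤ ρ t)
    (hr : ∀ t ∈ S, 0 ≤ r t) (hx : Tame θ R S r (fun t => xInv g (s t) (z t))) (m : ℕ) :
    Tame θ R S (fun t => (ρ t * r t) ^ m) (fun t => xmOp θ g (s t) (z t) m) := by
  induction m with
  | zero =>
    simp only [pow_zero, xmOp]
    exact Tame.const hR one_mem_smooth fun _ _ => le_rfl
  | succ m ih =>
    have h := hx.mul ih
    have hnn : ∀ t ∈ S, 0 ≤ r t * (ρ t * r t) ^ m := fun t ht =>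
      mul_nonneg (hr t ht) (pow_nonneg (mul_nonneg (zero_le_one.trans (hρ1 t ht)) (hr t ht)) m)
    have h1 : Tame θ R S (fun t => ρ t * (r t * (ρ t * r t) ^ m))
        (fun t => xmOp θ g (s t) (z t) (m + 1)) := by
      simp only [xmOp]
      refine (h.firstOp hg hR hs hρ).add ((h.lapOp hg hR).weight 1 hnn fun t ht => ?_)
      rw [one_mul]
      exact le_mul_of_one_le_left (hnn t ht) (hρ1 t ht)
    simpa only [pow_succ', mul_assoc] using h1

theorem tame_xmAOp (hg : IsRiemannianMetric θ g) (hR : ∀ x : Op d, (fun _ : T => x) ∈ R)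
    {s : T → Fin d → ℝ} {z : T → ℂ} (hs : ∀ i, (fun t => (s t i : ℂ) • (1 : Op d)) ∈ R)
    (hx : Tame θ R ∅ (fun _ => 1) (fun t => xInv g (s t) (z t))) (𝒜 : Finset ℕ) (m : ℕ) :
    Tame θ R ∅ (fun _ => 1) (fun t => xmAOp θ g 𝒜 (s t) (z t) m) := by
  induction m with
  | zero => exact Tame.const hR one_mem_smooth fun _ _ => le_rfl
  | succ m ih =>
    have h := hx.mul ih
    simp only [mul_one] at h
    simp only [xmAOp]
    split_ifs
    · have := h.firstOp hg hR hs (ρ := fun _ => 1) (by simp)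
      simpa only [mul_one] using this
    · exact h.lapOp hg hR

variable (d) in
/-- The algebra of families on `ℂ` that are analytic off the negative half axis. -/
def analyticFamilies : Subalgebra ℂ (ℂ → Op d) where
  carrier := {F | AnalyticOnNhd ℂ F Complex.slitPlane}
  mul_mem' := fun h k z hz => (h z hz).mul (k z hz)
  add_mem' := fun h k z hz => (h z hz).add (k z hz)
  algebraMap_mem' := fun _ _ _ => analyticAt_const

theorem tame_xInv_analytic (hg : IsRiemannianMetric θ g) (s : Fin d → ℝ) :
    Tame θ (analyticFamilies d) ∅ (fun _ => 1) (fun z => xInv g s z) := by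
  have hlin : (fun z : ℂ => z • (1 : Op d)) ∈ analyticFamilies d :=
    fun z _ => analyticAt_id.smul analyticAt_const
  refine (tame_xs_add (T := ℂ) (R := analyticFamilies d) (S := ∅) (w := fun _ => 1) hg
    (fun x _ _ => analyticAt_const) (fun _ => s) id (fun i _ _ => analyticAt_const) hlin
    (by simp)).inverse ?_ 1 1 (by simp) (by simp) (by simp) (by simp)
  intro z hz
  obtain ⟨u, hu⟩ := isUnit_xs_add hg s hz
  have h1 : AnalyticAt ℂ Ring.inverse (xs g s + id z • (1 : Op d)) := by
    have := analyticAt_inverse (𝕜 := ℂ) u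
    rw [hu] at this
    exact this
  exact h1.comp (f := fun z : ℂ => xs g s + id z • (1 : Op d))
    (analyticAt_const.add (hlin z hz))

variable (θ g) in
/-- The smooth element `good_k(s,z)`, as an operator. -/
def goodOp (k : ℕ) (s : Fin d → ℝ) (z : ℂ) : Op d :=
  xInv g s z * (∑ m ∈ (Finset.range (min k d + 1)).filter (fun m => k ≤ 2 * m),
    (-1 : ℂ) ^ m • ∑ 𝒜 ∈ (Finset.Icc 1 m).powersetCard (2 * m - k), xmAOp θ g 𝒜 s z m)

theorem goodOp_vac (hg : IsRiemannianMetric θ g) (k : ℕ) (s : Fin d → ℝ) (z : ℂ) :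
    goodOp θ g k s z (vac d) = good g k s z := by
  simp only [goodOp, good, mul_apply_eq_comp, sum_apply, smul_apply, xmAOp_vac hg]

theorem tame_goodOp (hg : IsRiemannianMetric θ g) (k : ℕ) (s : Fin d → ℝ) :
    Tame θ (analyticFamilies d) ∅ (fun _ => 1) (fun z => goodOp θ g k s z) := by
  have hx := tame_xInv_analytic hg s
  have h := hx.mul (Tame.sum fun m (_ : m ∈ (Finset.range (min k d + 1)).filter
    (fun m => k ≤ 2 * m)) => (Tame.sum fun 𝒜
      (_ : 𝒜 ∈ (Finset.Icc 1 m).powersetCard (2 * m - k)) =>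
      tame_xmAOp hg (R := analyticFamilies d) (s := fun _ => s) (z := fun z => z)
        (fun x _ _ => analyticAt_const) (fun i _ _ => analyticAt_const) hx 𝒜 m).smul
          ((-1 : ℂ) ^ m))
  simp only [mul_one] at h
  exact h

theorem good_analytic (hg : IsRiemannianMetric θ g) (k : ℕ) (s : Fin d → ℝ) :
    AnalyticOnNhd ℂ (fun z => good g k s z) Complex.slitPlane ∧
      ∃ G : ℂ → Op d, AnalyticOnNhd ℂ G Complex.slitPlane ∧
        ∀ z ∈ Complex.slitPlane, G z ∈ smooth θ ∧ G z (vac d) = good g k s z := by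
  have h := tame_goodOp hg k s
  have ha : AnalyticOnNhd ℂ (fun z => goodOp θ g k s z) Complex.slitPlane := h.base.2.1
  refine ⟨?_, fun z => goodOp θ g k s z, ha, fun z _ => ⟨h.mem_smooth z, goodOp_vac hg k s z⟩⟩
  have h1 := (ContinuousLinearMap.apply ℂ (L2 d) (vac d)).comp_analyticOnNhd ha
  have h2 : (fun z => good g k s z) =
      (ContinuousLinearMap.apply ℂ (L2 d) (vac d)) ∘ fun z => goodOp θ g k s z :=
    funext fun z => (goodOp_vac hg k s z).symm
  rw [h2]
  exact h1

theorem exists_norm_xmOp_le (hg : IsRiemannianMetric θ g) (m : ℕ) : ∃ C : ℝ,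
    ∀ (s : Fin d → ℝ) (z : ℂ), 1 ≤ lenSq s → z ≠ 0 → 0 ≤ z.re →
      ‖xmOp θ g s z m‖ ≤ C * (lenSq s + ‖z‖) ^ (-(m : ℝ) / 2) := by
  set S : Set ((Fin d → ℝ) × ℂ) := {t | 1 ≤ lenSq t.1 ∧ t.2 ≠ 0 ∧ 0 ≤ t.2.re} with hS
  set p : (Fin d → ℝ) × ℂ → ℝ := fun t => lenSq t.1 + ‖t.2‖ with hp
  have hp1 : ∀ t ∈ S, 1 ≤ p t := fun t ht => ht.1.trans (le_add_of_nonneg_right (norm_nonneg _))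
  obtain ⟨C, hC0, hC⟩ := norm_xInv_le hg
  have hx : Tame θ ⊤ S (fun t => (p t)⁻¹) (fun t => xInv g t.1 t.2) := by
    refine (tame_xs_add (R := ⊤) (S := S) (w := p) hg (fun _ => Algebra.mem_top) (fun t => t.1)
      (fun t => t.2) (fun _ => Algebra.mem_top) Algebra.mem_top (fun _ _ => le_rfl)).inverse
      Algebra.mem_top C 1 (fun t ht => hC t.1 t.2 ht.2.1 ht.2.2)
      (fun t ht => zero_le_one.trans (hp1 t ht))
      (fun t ht => inv_nonneg.mpr (zero_le_one.trans (hp1 t ht)))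
      (fun t ht => (mul_inv_cancel₀ (zero_lt_one.trans_le (hp1 t ht)).ne').le)
  have h := tame_xmOp (ρ := fun t => Real.sqrt (p t)) hg (fun _ => Algebra.mem_top)
    (fun _ => Algebra.mem_top) (fun t ht i => by
      refine Real.abs_le_sqrt ((sq_le_lenSq t.1 i).trans ?_)
      exact le_add_of_nonneg_right (norm_nonneg _))
    (fun t ht => Real.one_le_sqrt.mpr (hp1 t ht))
    (fun t ht => inv_nonneg.mpr (zero_le_one.trans (hp1 t ht))) hx m
  obtain ⟨C', hC'⟩ := h.base.2.2
  refine ⟨C', fun s z hs hz hre => ?_⟩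
  have ht : (s, z) ∈ S := ⟨hs, hz, hre⟩
  have hpos : 0 < lenSq s + ‖z‖ := zero_lt_one.trans_le (hp1 _ ht)
  refine (hC' _ ht).trans (le_of_eq ?_)
  congr 1
  change (Real.sqrt (lenSq s + ‖z‖) * (lenSq s + ‖z‖)⁻¹) ^ m = _
  rw [Real.sqrt_eq_rpow, ← Real.rpow_neg_one, ← Real.rpow_add hpos, ← Real.rpow_natCast,
    ← Real.rpow_mul hpos.le]
  congr 1
  ring

theorem exists_norm_bad_le (hg : IsRiemannianMetric θ g) : ∃ C : ℝ,
    ∀ n : Fin d → ℤ, n ≠ 0 → ∀ z : ℂ, z ≠ 0 → 0 ≤ z.re →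
      ‖bad g θ n z‖ ≤ C * (‖z‖⁻¹ * (normSq n + ‖z‖) ^ (-((d : ℝ) + 1) / 2)) := by
  obtain ⟨C, hC⟩ := exists_norm_xmOp_le hg (d + 1)
  refine ⟨C * ‖vac d‖, fun n hn z hz hre => ?_⟩
  have hX := hC (fun i => (n i : ℝ)) z (one_le_normSq hn) hz hre
  have hl : lenSq (fun i => (n i : ℝ)) = normSq n := rfl
  rw [hl] at hX
  have hv := (xmOp θ g (fun i => (n i : ℝ)) z (d + 1)).le_of_opNorm_le hX (vac d)
  rw [xmOp_vac hg] at hv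
  have hR : ‖conjResolv g θ n z‖ ≤ ‖z‖⁻¹ := by
    have h1 := norm_rmul_le (θ := θ) n
    have h2 := norm_resolv_le hg hz hre
    have h3 : ‖star (rmul θ n)‖ ≤ 1 := by
      rw [ContinuousLinearMap.star_eq_adjoint, LinearIsometryEquiv.norm_map]
      exact h1
    calc ‖conjResolv g θ n z‖ ≤ ‖star (rmul θ n)‖ * ‖resolv (Ag g) z‖ * ‖rmul θ n‖ :=
          (norm_mul_le _ _).trans (mul_le_mul_of_nonneg_right (norm_mul_le _ _) (norm_nonneg _))
      _ ≤ 1 * ‖z‖⁻¹ * 1 := by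
          gcongr
      _ = ‖z‖⁻¹ := by ring
  refine ((conjResolv g θ n z).le_of_opNorm_le hR _).trans ?_
  refine (mul_le_mul_of_nonneg_left hv (by positivity)).trans (le_of_eq ?_)
  push_cast
  ring

end Estimates

end NCTorus

end

open NCTorus in
theorem theorem5p2 {d : ℕ} (θ : Matrix (Fin d) (Fin d) ℝ) (hθ : θ.transpose = -θ)
    (g : (Matrix (Fin d) (Fin d) (L2 d →L[ℂ] L2 d))ˣ) (hg : IsRiemannianMetric θ g) :
    -- all the objects are well defined: `ν`, the operator `A_g`, its resolvent, `x_m` and `x_m^𝒜`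
    (MeasureTheory.Integrable (nuIntegrand g) ∧
      0 ≤ nu g ∧ IsUnit (nu g) ∧
      (Ag g).domain = sobolev d 2 ∧
      (∀ z ∈ Complex.slitPlane, IsResolvent (Ag g) z (resolv (Ag g) z)) ∧
      ∀ (s : Fin d → ℝ), ∀ z ∈ Complex.slitPlane, IsUnit (xs g s + z • 1) ∧
        ∀ m : ℕ, xInv g s z (xm g s z m) ∈ (V g s + Ag g).domain ∧
          ∀ 𝒜 : Finset ℕ, xInv g s z (xmA g 𝒜 s z m) ∈ (V g s + Ag g).domain) ∧
    -- the splitting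
    (∀ n : Fin d → ℤ, n ≠ 0 → ∀ z ∈ Complex.slitPlane,
      conjResolv g θ n z (vac d) =
        (∑ k ∈ Finset.range (2 * d + 1), good g k (fun i => (n i : ℝ)) z) +
          (-1 : ℂ) ^ (d + 1) • bad g θ n z) ∧
    -- `good_k(s, ·)` is analytic, with values in `L_2` and, being valued in `C^∞`, in `L_∞`
    (∀ (k : ℕ) (s : Fin d → ℝ),
      AnalyticOnNhd ℂ (fun z => good g k s z) Complex.slitPlane ∧
      ∃ G : ℂ → (L2 d →L[ℂ] L2 d), AnalyticOnNhd ℂ G Complex.slitPlane ∧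
        ∀ z ∈ Complex.slitPlane, G z ∈ smooth θ ∧ G z (vac d) = good g k s z) ∧
    -- the bound for `bad_n`, uniform in `n` and `z`
    ∃ C : ℝ, ∀ n : Fin d → ℤ, n ≠ 0 → ∀ z : ℂ, z ≠ 0 → 0 ≤ z.re →
      ‖bad g θ n z‖ ≤ C * (‖z‖⁻¹ * (normSq n + ‖z‖) ^ (-((d : ℝ) + 1) / 2)) := by
  refine ⟨⟨integrable_nuIntegrand hg, nu_nonneg hg, isUnit_nu hg, domain_Ag hg,
    fun z hz => isResolvent_resolv hg hz, fun s z hz => ⟨isUnit_xs_add hg s hz, fun m =>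
      ⟨xInv_xm_mem_domain hg s z m, fun 𝒜 => xInv_xmA_mem_domain hg 𝒜 s z m⟩⟩⟩,
    fun n _ z hz => splitting hg n hz, fun k s => good_analytic hg k s, exists_norm_bad_le hg⟩
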